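/- Let $\mathbb K$ be an algebraically closed field with $\operatorname{char}\mathbb K\neq 2$. A variety is a reduced, equidimensional scheme of finite type over $\mathbb K$, and $T_{(-)}=\mathcal{H}om(\Omega_{(-)/\mathbb K},\mathcal O)$ denotes the tangent sheaf. An $n$-dimensional variety $X$ ($n\ge 2$) is called semi-smooth if it is covered by étale open sets that are isomorphic to étale open sets of $\operatorname{Spec}\mathbb K[u,v,w]/(u^2-v^2w)\times\mathbb A^{n-2}$. Let $X$ be a semi-smooth variety and $f\colon\bar X\to X$ its normalization, let $Y\subset X$ and $\bar\jmath\colon\bar Y\hookrightarrow\bar X$ be the closed subschemes defined by the conductor ideal $\mathcal I=\operatorname{Ann}(f_*\mathcal O_{\bar X}/\mathcal O_X)$ and by the ideal $\bar{\mathcal I}$ of $\mathcal O_{\bar X}$ with $f_*\bar{\mathcal I}=\mathcal I$, and let $g\colon\bar Y\to Y$ be the (degree $2$) map induced by $f$. Then: (i) There is a unique $\mathcal O_X$-linear map $\alpha\colon T_X\to f_*T_{\bar X}$ such that $\alpha(D)$ extends $D$, that is, $\alpha(D)\circ f^\#=f^\#\circ D$, for every local derivation $D$ of $\mathcal O_X$.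 The map $\alpha$ is injective, and it is an isomorphism on the smooth locus of $X$. (ii) There is a unique involution $\iota$ of $\bar Y$ over $Y$ such that $\mathcal O_Y$ is the $\iota$-invariant part of $g_*\mathcal O_{\bar Y}$. Let $(g_*T_{\bar Y})^{\rm inv}\subset g_*T_{\bar Y}$ be the subsheaf of the derivations that commute with $\iota^\#$, let $T_{\bar X}|_{\bar Y}=\bar\jmath^*T_{\bar X}$, and let $T_{\bar Y}\to T_{\bar X}|_{\bar Y}$ be the tangent map of $\bar\jmath$, i.e. the unique map whose composition with the natural map $\bar\jmath^*T_{\bar X}\to(\bar\jmath^*\Omega_{\bar X})^\vee$ is the dual of $\bar\jmath^*\Omega_{\bar X}\to\Omega_{\bar Y}$. Put $\mathcal G:=\operatorname{coker}\alpha$. Then the projection $f_*T_{\bar X}\to\mathcal G$ factors through the restriction map $f_*T_{\bar X}\to g_*(T_{\bar X}|_{\bar Y})$, and the sequence of sheaves on $X$ $$0\to (g_*T_{\bar Y})^{\rm inv}\to g_*(T_{\bar X}|_{\bar Y})\to\mathcal G\to 0$$ so obtained, whose first map is induced by the tangent map of $\bar\jmath$, is exact. (Sheaves on $Y$ are regarded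 as sheaves on $X$ through $Y\hookrightarrow X$.) -/

import Mathlib

open CategoryTheory CategoryTheory.Limits AlgebraicGeometry AlgebraicGeometry.Scheme

universe u

namespace SemiSmooth

noncomputable section

variable {S W Z : Scheme.{u}}

/-- Restriction of functions to a smaller open subset. -/
def res {V V' : Z.Opens} (hV : V' ≤ V) : Γ(Z, V) →+* Γ(Z, V') :=
  (Z.presheaf.map (homOfLE hV).op).hom

/-- The comorphism `h^# : 𝒪_W(U) → 𝒪_Z(V)` of `h : Z ⟶ W`, for `h(V) ⊆ U`. -/
def comorph (h : Z ⟶ W) {U : W.Opens} {V : Z.Opens} (hV : V ≤ h ⁻¹ᵁ U) : Γ(W, U) →+* Γ(Z, V) :=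
  (h.appLE U V hV).hom

@[simp] lemma res_self {V : Z.Opens} (a : Γ(Z, V)) : res (le_refl V) a = a := by
  simp [res]

@[simp] lemma res_res {V V' V'' : Z.Opens} (h : V' ≤ V) (h' : V'' ≤ V') (a : Γ(Z, V)) :
    res h' (res h a) = res (h'.trans h) a := by
  simp only [res, ← CommRingCat.comp_apply, ← Functor.map_comp, ← op_comp]; rfl

@[simp] lemma res_comorph (h : Z ⟶ W) {U : W.Opens} {V V' : Z.Opens} (hV : V ≤ h ⁻¹ᵁ U)
    (hV' : V' ≤ V) (a : Γ(W, U)) : res hV' (comorph h hV a) = comorph h (hV'.trans hV) a := by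
  simp only [res, comorph, ← CommRingCat.comp_apply, Scheme.Hom.appLE_map]

@[simp] lemma comorph_res (h : Z ⟶ W) {U U' : W.Opens} {V : Z.Opens} (hU : U' ≤ U)
    (hV : V ≤ h ⁻¹ᵁ U') (a : Γ(W, U)) :
    comorph h hV (res hU a) = comorph h (hV.trans (h.preimage_mono hU)) a := by
  simp only [res, comorph, ← CommRingCat.comp_apply, Scheme.Hom.map_appLE]

lemma comorph_comp {T : Scheme.{u}} (h : Z ⟶ W) (k : W ⟶ T) {U : T.Opens} {V : W.Opens} {V' : Z.Opens}
    (hV : V ≤ k ⁻¹ᵁ U) (hV' : V' ≤ h ⁻¹ᵁ V) (a : Γ(T, U)) :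
    comorph h hV' (comorph k hV a) = comorph (h ≫ k) (hV'.trans (h.preimage_mono hV)) a := by
  simp only [comorph, ← CommRingCat.comp_apply, Scheme.Hom.appLE_comp_appLE]

lemma le_of_le_id_preimage {V U : Z.Opens} (hV : V ≤ (𝟙 Z) ⁻¹ᵁ U) : V ≤ U := hV

@[simp] lemma comorph_id {V U : Z.Opens} (hV : V ≤ (𝟙 Z) ⁻¹ᵁ U) (a : Γ(Z, U)) :
    comorph (𝟙 Z) hV a = res (le_of_le_id_preimage hV) a := by
  simp only [comorph, res, Scheme.Hom.appLE, Scheme.Hom.id_app]; rfl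

/-- For `h : Z ⟶ W` over `S` (with `p : W ⟶ S` the structure map) and `V ⊆ Z` open, the
`S`-derivations `𝒪_W → (h|_V)_* 𝒪_V`: for every open `U ⊆ W` an additive map
`𝒪_W(U) → 𝒪_Z(V ∩ h⁻¹U)` satisfying the Leibniz rule and vanishing on functions from `S`,
compatibly with restriction. -/
structure DerivationAlong (p : W ⟶ S) (h : Z ⟶ W) (V : Z.Opens) where
  toFun (U : W.Opens) : Γ(W, U) →+ Γ(Z, V ⊓ h ⁻¹ᵁ U)
  leibniz (U : W.Opens) (a b : Γ(W, U)) :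
    toFun U (a * b) =
      comorph h inf_le_right a * toFun U b + comorph h inf_le_right b * toFun U a
  map_const (U : W.Opens) (T : S.Opens) (hU : U ≤ p ⁻¹ᵁ T) (c : Γ(S, T)) :
    toFun U (comorph p hU c) = 0
  map_res {U U' : W.Opens} (hU : U' ≤ U) (a : Γ(W, U)) :
    toFun U' (res hU a) = res (inf_le_inf_left V (h.preimage_mono hU)) (toFun U a)

namespace DerivationAlong

variable {p : W ⟶ S} {h : Z ⟶ W} {V : Z.Opens}

lemma toFun_injective : Function.Injective
    (toFun : DerivationAlong p h V → ∀ U : W.Opens, Γ(W, U) →+ Γ(Z, V ⊓ h ⁻¹ᵁ U)) :=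
  fun d e H ↦ by cases d; cases e; cases H; rfl

instance : Zero (DerivationAlong p h V) where
  zero := ⟨0, by simp, by simp, by simp⟩

instance : Add (DerivationAlong p h V) where
  add d e := ⟨d.toFun + e.toFun,
    fun U a b ↦ by simp only [Pi.add_apply, AddMonoidHom.add_apply, leibniz]; ring,
    fun U T hU c ↦ by simp only [Pi.add_apply, AddMonoidHom.add_apply, map_const, add_zero],
    fun hU a ↦ by simp only [Pi.add_apply, AddMonoidHom.add_apply, map_res, map_add]⟩

instance : Neg (DerivationAlong p h V) where
  neg d := ⟨-d.toFun,
    fun U a b ↦ by simp only [Pi.neg_apply, AddMonoidHom.neg_apply, leibniz]; ring,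
    fun U T hU c ↦ by simp only [Pi.neg_apply, AddMonoidHom.neg_apply, map_const, neg_zero],
    fun hU a ↦ by simp only [Pi.neg_apply, AddMonoidHom.neg_apply, map_res, map_neg]⟩

instance : Sub (DerivationAlong p h V) where
  sub d e := ⟨d.toFun - e.toFun,
    fun U a b ↦ by simp only [Pi.sub_apply, AddMonoidHom.sub_apply, leibniz]; ring,
    fun U T hU c ↦ by simp only [Pi.sub_apply, AddMonoidHom.sub_apply, map_const, sub_zero],
    fun hU a ↦ by simp only [Pi.sub_apply, AddMonoidHom.sub_apply, map_res, map_sub]⟩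

instance : SMul ℕ (DerivationAlong p h V) where
  smul n d := ⟨n • d.toFun,
    fun U a b ↦ by
      simp only [Pi.smul_apply, AddMonoidHom.smul_apply, leibniz, nsmul_eq_mul]; ring,
    fun U T hU c ↦ by simp only [Pi.smul_apply, AddMonoidHom.smul_apply, map_const, smul_zero],
    fun hU a ↦ by simp only [Pi.smul_apply, AddMonoidHom.smul_apply, map_res, map_nsmul]⟩

instance : SMul ℤ (DerivationAlong p h V) where
  smul n d := ⟨n • d.toFun,
    fun U a b ↦ by
      simp only [Pi.smul_apply, AddMonoidHom.smul_apply, leibniz, zsmul_eq_mul]; ring,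
    fun U T hU c ↦ by simp only [Pi.smul_apply, AddMonoidHom.smul_apply, map_const, smul_zero],
    fun hU a ↦ by simp only [Pi.smul_apply, AddMonoidHom.smul_apply, map_res, map_zsmul]⟩

instance : AddCommGroup (DerivationAlong p h V) :=
  toFun_injective.addCommGroup _ rfl (fun _ _ ↦ rfl) (fun _ ↦ rfl) (fun _ _ ↦ rfl)
    (fun _ _ ↦ rfl) (fun _ _ ↦ rfl)

instance : SMul Γ(Z, V) (DerivationAlong p h V) where
  smul r d := ⟨fun U ↦ (AddMonoidHom.mulLeft (res inf_le_left r)).comp (d.toFun U),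
    fun U a b ↦ by
      simp only [AddMonoidHom.comp_apply, AddMonoidHom.coe_mulLeft, leibniz]; ring,
    fun U T hU c ↦ by
      simp only [AddMonoidHom.comp_apply, AddMonoidHom.coe_mulLeft, map_const, mul_zero],
    fun hU a ↦ by
      simp only [AddMonoidHom.comp_apply, AddMonoidHom.coe_mulLeft, map_res, map_mul, res_res]⟩

@[simp] lemma add_toFun (d e : DerivationAlong p h V) (U : W.Opens) (a : Γ(W, U)) :
    (d + e).toFun U a = d.toFun U a + e.toFun U a := rfl

@[simp] lemma zero_toFun (U : W.Opens) (a : Γ(W, U)) :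
    (0 : DerivationAlong p h V).toFun U a = 0 := rfl

@[simp] lemma smul_toFun (r : Γ(Z, V)) (d : DerivationAlong p h V) (U : W.Opens) (a : Γ(W, U)) :
    (r • d).toFun U a = res inf_le_left r * d.toFun U a := rfl

lemma ext' {d e : DerivationAlong p h V} (H : ∀ U a, d.toFun U a = e.toFun U a) : d = e :=
  toFun_injective (funext fun U ↦ AddMonoidHom.ext (H U))

instance : Module Γ(Z, V) (DerivationAlong p h V) where
  one_smul d := ext' fun U a ↦ by simp
  mul_smul r s d := ext' fun U a ↦ by simp [mul_assoc]
  smul_zero r := ext' fun U a ↦ by simp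
  smul_add r d e := ext' fun U a ↦ by simp [mul_add]
  add_smul r s d := ext' fun U a ↦ by simp [add_mul]
  zero_smul d := ext' fun U a ↦ by simp

/-- Restriction of derivations to a smaller open subset of the source. -/
def restrict {V' : Z.Opens} (hV : V' ≤ V) :
    DerivationAlong p h V →+ DerivationAlong p h V' where
  toFun d := ⟨fun U ↦ (res (inf_le_inf_right _ hV)).toAddMonoidHom.comp (d.toFun U),
    fun U a b ↦ by simp [leibniz],
    fun U T hU c ↦ by simp [map_const],
    fun hU a ↦ by simp [map_res]⟩
  map_zero' := ext' fun U a ↦ by simp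
  map_add' d e := ext' fun U a ↦ by simp

@[simp] lemma restrict_toFun {V' : Z.Opens} (hV : V' ≤ V) (d : DerivationAlong p h V)
    (U : W.Opens) (a : Γ(W, U)) :
    (restrict hV d).toFun U a = res (inf_le_inf_right _ hV) (d.toFun U a) := rfl

lemma restrict_smul {V' : Z.Opens} (hV : V' ≤ V) (r : Γ(Z, V)) (d : DerivationAlong p h V) :
    restrict hV (r • d) = res hV r • restrict hV d :=
  ext' fun U a ↦ by simp

variable (p h) in
/-- The presheaf `V ↦ DerivationAlong p h V` on `Z`. -/
def presheaf : TopCat.Presheaf Ab.{u} Z where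
  obj V := .of (DerivationAlong p h V.unop)
  map i := AddCommGrpCat.ofHom (restrict i.unop.le)
  map_id _ := AddCommGrpCat.hom_ext (AddMonoidHom.ext fun _ ↦ ext' fun _ _ ↦ res_self _)
  map_comp _ _ := AddCommGrpCat.hom_ext (AddMonoidHom.ext fun _ ↦ ext' fun _ _ ↦
    (res_res _ _ _).symm)

lemma presheaf_isSheaf : (presheaf p h).IsSheaf := by
  rw [TopCat.Presheaf.isSheaf_iff_isSheafUniqueGluing]
  intro ι V d₀ hd
  let d (i : ι) : DerivationAlong p h (V i) := d₀ i
  have hd' : ∀ i j U a, res (inf_le_inf_right _ (inf_le_left : V i ⊓ V j ≤ V i))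
      ((d i).toFun U a) =
      res (inf_le_inf_right _ (inf_le_right : V i ⊓ V j ≤ V j))
      ((d j).toFun U a) := fun i j U a ↦
    congr(DerivationAlong.toFun $(hd i j) U a)
  have glue (U : W.Opens) (a : Γ(W, U)) : ∃! s : Γ(Z, iSup V ⊓ h ⁻¹ᵁ U), ∀ i,
      res (inf_le_inf_right _ (le_iSup V i)) s =
        (d i).toFun U a := by
    refine TopCat.Sheaf.existsUnique_gluing' Z.sheaf (fun i ↦ V i ⊓ h ⁻¹ᵁ U) _
      (fun i ↦ homOfLE (inf_le_inf_right _ (le_iSup V i))) (by rw [iSup_inf_eq])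
      (fun i ↦ (d i).toFun U a) fun i j ↦ ?_
    have := congr(res (le_inf (inf_le_inf inf_le_left inf_le_left)
      (inf_le_left.trans inf_le_right) :
        (V i ⊓ h ⁻¹ᵁ U) ⊓ (V j ⊓ h ⁻¹ᵁ U) ≤ (V i ⊓ V j) ⊓ h ⁻¹ᵁ U) $(hd' i j U a))
    rw [res_res, res_res] at this
    exact this
  choose s hs hs' using glue
  have sep (U : W.Opens) (x y : Γ(Z, iSup V ⊓ h ⁻¹ᵁ U))
      (hxy : ∀ i, res (inf_le_inf_right _ (le_iSup V i)) x =
        res (inf_le_inf_right _ (le_iSup V i)) y) : x = y :=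
    TopCat.Sheaf.eq_of_locally_eq' Z.sheaf (fun i ↦ V i ⊓ h ⁻¹ᵁ U) _
      (fun i ↦ homOfLE (inf_le_inf_right _ (le_iSup V i))) (by rw [iSup_inf_eq]) x y hxy
  refine ⟨(⟨fun U ↦ AddMonoidHom.mk' (s U) fun a b ↦ sep _ _ _ fun i ↦ ?_, fun U a b ↦ ?_,
    fun U T hU c ↦ ?_, fun {U U'} hU a ↦ ?_⟩ : DerivationAlong p h (iSup V)), fun i ↦ ?_,
    fun e he ↦ ?_⟩
  · simp [hs]
  · refine sep _ _ _ fun i ↦ ?_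
    simp [hs, leibniz]
  · refine sep _ _ _ fun i ↦ ?_
    simp [hs, map_const]
  · refine sep _ _ _ fun i ↦ ?_
    rw [AddMonoidHom.mk'_apply, AddMonoidHom.mk'_apply, hs, map_res, ← hs, res_res, res_res]
  · exact ext' fun U a ↦ hs U a i
  · exact ext' fun U a ↦ hs' U a _ fun i ↦ congr(DerivationAlong.toFun $(he i) U a)

end DerivationAlong

open DerivationAlong

/-- The `𝒪_Z`-module `Der_S(h⁻¹𝒪_W, 𝒪_Z)`. By the universal property of differentials this is
`(h^* Ω_{W/S})^∨ = ℋom_{𝒪_Z}(h^* Ω_{W/S}, 𝒪_Z)`. -/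
def derivationSheaf (p : W ⟶ S) (h : Z ⟶ W) : Z.Modules :=
  letI (V : (TopologicalSpace.Opens Z)ᵒᵖ) :
      Module (Z.ringCatSheaf.obj.obj V) ((presheaf p h).obj V) :=
    inferInstanceAs (Module Γ(Z, V.unop) (DerivationAlong p h V.unop))
  { val := PresheafOfModules.ofPresheaf (R := Z.ringCatSheaf.obj) (presheaf p h)
      fun _ _ i r d ↦ restrict_smul (p := p) (h := h) i.unop.le r d
    isSheaf := presheaf_isSheaf }

/-- The tangent sheaf `T_{W/S} = ℋom(Ω_{W/S}, 𝒪_W) = Der_S(𝒪_W, 𝒪_W)` of `p : W ⟶ S`. -/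
def tangentSheaf (p : W ⟶ S) : W.Modules := derivationSheaf p (𝟙 W)

/-- A morphism of sheaves of modules from compatible linear maps on sections. -/
def modulesHom {M N : Z.Modules} (φ : ∀ V : Z.Opens, Γ(M, V) →ₗ[Γ(Z, V)] Γ(N, V))
    (hφ : ∀ {V V' : Z.Opens} (i : V' ≤ V) (m : Γ(M, V)),
      φ V' (M.presheaf.map (homOfLE i).op m) = N.presheaf.map (homOfLE i).op (φ V m)) : M ⟶ N where
  val := PresheafOfModules.homMk
    { app V := AddCommGrpCat.ofHom (φ V.unop).toAddMonoidHom
      naturality _ _ i := by ext m; exact hφ i.unop.le m }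
    fun V r m ↦ (φ V.unop).map_smul r m

lemma inf_le_inf_id (V U : Z.Opens) : V ⊓ U ≤ V ⊓ (𝟙 Z) ⁻¹ᵁ U := le_rfl

lemma inf_le_preimage_inf_id (k : Z ⟶ W) (V U : W.Opens) :
    k ⁻¹ᵁ V ⊓ k ⁻¹ᵁ U ≤ k ⁻¹ᵁ (V ⊓ (𝟙 W) ⁻¹ᵁ U) := le_rfl

/-- On sections, `D ↦ D ∘ k^#`. -/
def precompSection (p : W ⟶ S) (k : Z ⟶ W) (q : Z ⟶ S) (hq : k ≫ p = q) (V : Z.Opens) :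
    DerivationAlong q (𝟙 Z) V →ₗ[Γ(Z, V)] DerivationAlong p k V where
  toFun d :=
    { toFun U := AddMonoidHom.mk' (fun a ↦ res (inf_le_inf_id V _)
        (d.toFun (k ⁻¹ᵁ U) (comorph k le_rfl a))) fun a b ↦ by simp only [map_add]
      leibniz U a b := by
        simp only [AddMonoidHom.mk'_apply, map_mul, map_add, DerivationAlong.leibniz,
          res_comorph, comorph_id]
      map_const U T hU c := by
        subst hq
        rw [AddMonoidHom.mk'_apply, comorph_comp, DerivationAlong.map_const, map_zero]
      map_res {U U'} hU a := by
        have := d.map_res (k.preimage_mono hU) (comorph k le_rfl a)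
        simp only [res_comorph] at this
        simp only [AddMonoidHom.mk'_apply, comorph_res, this, res_res] }
  map_add' d e := ext' fun U a ↦ by
    simp only [AddMonoidHom.mk'_apply, add_toFun, map_add]
  map_smul' r d := ext' fun U a ↦ by
    simp only [AddMonoidHom.mk'_apply, smul_toFun, map_mul, res_res, RingHom.id_apply]

/-- The natural map `T_{Z/S} → (k^* Ω_{W/S})^∨`, `D ↦ D ∘ k^#`, for `k : Z ⟶ W` over `S`: the
dual of `k^* Ω_{W/S} → Ω_{Z/S}`. -/
def precomp (p : W ⟶ S) (k : Z ⟶ W) (q : Z ⟶ S) (hq : k ≫ p = q) :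
    tangentSheaf q ⟶ derivationSheaf p k :=
  modulesHom (precompSection p k q hq) fun {V V'} i d ↦ ext' fun U a ↦ by
    exact (res_res _ _ (DerivationAlong.toFun (V := V) d _ _)).trans
      (res_res _ _ (DerivationAlong.toFun (V := V) d _ _)).symm

/-- On sections, `D ↦ k^# ∘ D`. -/
def postcompSection (p : W ⟶ S) (k : Z ⟶ W) (V : W.Opens) :
    DerivationAlong p (𝟙 W) V →+ DerivationAlong p k (k ⁻¹ᵁ V) where
  toFun d :=
    { toFun U := AddMonoidHom.mk' (fun a ↦ comorph k (inf_le_preimage_inf_id k V U)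
        (d.toFun U a)) fun a b ↦ by simp only [map_add]
      leibniz U a b := by
        simp only [AddMonoidHom.mk'_apply, map_mul, map_add, DerivationAlong.leibniz,
          comorph_res, comorph_id]
      map_const U T hU c := by
        rw [AddMonoidHom.mk'_apply, DerivationAlong.map_const, map_zero]
      map_res {U U'} hU a := by
        simp only [AddMonoidHom.mk'_apply, DerivationAlong.map_res, comorph_res, res_comorph] }
  map_zero' := ext' fun U a ↦ by
    simp only [AddMonoidHom.mk'_apply, zero_toFun, map_zero]
  map_add' d e := ext' fun U a ↦ by
    simp only [AddMonoidHom.mk'_apply, add_toFun, map_add]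

lemma postcompSection_smul (p : W ⟶ S) (k : Z ⟶ W) (V : W.Opens) (r : Γ(W, V))
    (d : DerivationAlong p (𝟙 W) V) :
    postcompSection p k V (r • d) = comorph k le_rfl r • postcompSection p k V d :=
  ext' fun U a ↦ by
    change comorph k _ (res _ r * d.toFun U a) = res _ (comorph k _ r) * comorph k _ (d.toFun U a)
    rw [map_mul, comorph_res, res_comorph]

/-- The natural map `T_{W/S} → k_* ((k^* Ω_{W/S})^∨)`, `D ↦ k^# ∘ D`. -/
def postcomp (p : W ⟶ S) (k : Z ⟶ W) :
    tangentSheaf p ⟶ (Modules.pushforward k).obj (derivationSheaf p k) :=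
  modulesHom (fun V ↦
    { toFun := postcompSection p k V
      map_add' := map_add _
      map_smul' r d := by
        have : comorph k (U := V) le_rfl r = k.app V r := by simp [comorph, Scheme.Hom.appLE]
        exact (postcompSection_smul p k V r d).trans (by rw [this]; rfl) })
    fun {V V'} i d ↦ ext' fun U a ↦
      (comorph_res k _ _ (DerivationAlong.toFun (V := V) d _ _)).trans
        (res_comorph k _ _ (DerivationAlong.toFun (V := V) d _ _)).symm

/-- The natural map `k^* T_{W/S} → (k^* Ω_{W/S})^∨`. -/
def pullbackTangent (p : W ⟶ S) (k : Z ⟶ W) :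
    (Modules.pullback k).obj (tangentSheaf p) ⟶ derivationSheaf p k :=
  ((Modules.pullbackPushforwardAdjunction k).homEquiv _ _).symm (postcomp p k)

/-- `α : T_X → f_* T_X̄` is the map induced by `f : X̄ ⟶ X` if it sends a derivation `D` of `𝒪_X`
to a derivation of `𝒪_X̄` that extends `D`, i.e. `α(D) ∘ f^# = f^# ∘ D`. Equivalently, `α` lifts
`T_X → f_* ((f^* Ω_X)^∨)` along `f_* T_X̄ → f_* ((f^* Ω_X)^∨)`. -/
def IsTangentLift {X Xb : Scheme.{u}} (p : X ⟶ S) (f : Xb ⟶ X)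
    (α : tangentSheaf p ⟶ (Modules.pushforward f).obj (tangentSheaf (f ≫ p))) : Prop :=
  α ≫ (Modules.pushforward f).map (precomp p f (f ≫ p) rfl) = postcomp p f

/-- `τ : T_Z → k^* T_W` is the tangent map of `k : Z ⟶ W` if, composed with
`k^* T_W → (k^* Ω_W)^∨`, it is the dual `D ↦ D ∘ k^#` of `k^* Ω_W → Ω_Z`. -/
def IsTangentMap (p : W ⟶ S) (k : Z ⟶ W) (q : Z ⟶ S) (hq : k ≫ p = q)
    (τ : tangentSheaf q ⟶ (Modules.pullback k).obj (tangentSheaf p)) : Prop :=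
  τ ≫ pullbackTangent p k = precomp p k q hq

/-- The conductor of a ring map `φ : A → B`: the annihilator of the `A`-module `B / φ(A)`. -/
def ringConductor {A B : Type*} [CommRing A] [CommRing B] (φ : A →+* B) : Ideal A where
  carrier := {a | ∀ b : B, φ a * b ∈ φ.range}
  zero_mem' b := by simp
  add_mem' {a a'} ha ha' b := by
    rw [map_add, add_mul]
    exact φ.range.add_mem (ha b) (ha' b)
  smul_mem' c a ha b := by
    rw [smul_eq_mul, map_mul, mul_assoc]
    exact φ.range.mul_mem ⟨c, rfl⟩ (ha b)

lemma ringConductor_map_away {A B A' B' : Type*} [CommRing A] [CommRing B] [CommRing A']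
    [CommRing B'] (φ : A →+* B) (φ' : A' →+* B') (ρ : A →+* A') (σ : B →+* B') (g : A)
    (hφ : φ.Finite) (hA : @IsLocalization.Away A _ g A' _ ρ.toAlgebra)
    (hB : @IsLocalization.Away B _ (φ g) B' _ σ.toAlgebra)
    (hc : ∀ a, φ' (ρ a) = σ (φ a)) :
    (ringConductor φ).map ρ = ringConductor φ' := by
  algebraize [ρ, σ]
  change (ringConductor φ).map (algebraMap A A') = ringConductor φ'
  replace hc : ∀ a, φ' (algebraMap A A' a) = algebraMap B B' (φ a) := hc
  have hu : ∀ k : ℕ, IsUnit (algebraMap A A' (g ^ k)) := fun k ↦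
    IsLocalization.map_units A' (⟨g ^ k, k, rfl⟩ : Submonoid.powers g)
  have hu' : ∀ k : ℕ, IsUnit (algebraMap B B' (φ g ^ k)) := fun k ↦
    IsLocalization.map_units B' (⟨φ g ^ k, k, rfl⟩ : Submonoid.powers (φ g))
  apply le_antisymm
  · rw [Ideal.map_le_iff_le_comap]
    intro a ha b'
    obtain ⟨k, b, hb⟩ := IsLocalization.Away.surj (φ g) b'
    obtain ⟨c, hc'⟩ := ha b
    obtain ⟨v, hv⟩ := hu k
    refine ⟨↑v⁻¹ * algebraMap A A' c, (hu' k).mul_left_cancel ?_⟩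
    have h1 : algebraMap B B' (φ g ^ k) * φ' ↑v⁻¹ = 1 := by
      rw [← map_pow, ← hc, ← hv, ← map_mul, Units.mul_inv, map_one]
    rw [map_mul, ← mul_assoc, h1, one_mul, hc, hc', hc, map_mul, ← hb, map_pow]
    ring
  · intro a' ha'
    obtain ⟨k, a, ha⟩ := IsLocalization.Away.surj g a'
    algebraize [φ]
    obtain ⟨S, hS⟩ := (inferInstance : Module.Finite A B).fg_top
    have key : ∀ b : B, ∃ N : ℕ, φ (g ^ N * a) * b ∈ φ.range := by
      intro b
      obtain ⟨c', hc'⟩ := ha' (algebraMap B B' b)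
      obtain ⟨l, c, hcl⟩ := IsLocalization.Away.surj g c'
      have : algebraMap B B' (φ (g ^ l * a) * b) = algebraMap B B' (φ (g ^ k * c)) := by
        rw [map_mul, ← hc, ← hc, map_mul, map_mul, map_mul, ← ha, ← hcl]
        simp only [map_mul, hc', map_pow]
        ring
      obtain ⟨⟨_, n, rfl⟩, hn⟩ := (IsLocalization.eq_iff_exists (Submonoid.powers (φ g)) B').mp this
      refine ⟨n + l, g ^ n * (g ^ k * c), ?_⟩
      simp only [map_mul, map_pow] at hn ⊢
      rw [← hn]; ring
    choose N hN using key
    have hmem : g ^ (∑ s ∈ S, N s) * a ∈ ringConductor φ := by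
      intro b
      have hb : b ∈ Submodule.span A (S : Set B) := hS ▸ trivial
      induction hb using Submodule.span_induction with
      | mem x hx =>
        obtain ⟨d, hd⟩ := Nat.exists_eq_add_of_le
          (Finset.single_le_sum (f := N) (fun _ _ ↦ Nat.zero_le _) hx)
        rw [hd, add_comm, pow_add, mul_assoc, map_mul, mul_assoc]
        exact φ.range.mul_mem ⟨_, rfl⟩ (hN x)
      | zero => simp
      | add x y _ _ hx hy => rw [mul_add]; exact φ.range.add_mem hx hy
      | smul c x _ hx =>
        rw [Algebra.smul_def, mul_left_comm]
        exact φ.range.mul_mem ⟨c, rfl⟩ hx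
    have h2 := Ideal.mem_map_of_mem (algebraMap A A') hmem
    rw [map_mul, ← ha] at h2
    exact (Ideal.unit_mul_mem_iff_mem _ (hu k)).mp
      (by simpa [mul_comm] using (Ideal.unit_mul_mem_iff_mem _ (hu _)).mp h2)

/-- The conductor ideal sheaf `Ann_{𝒪_X}(f_* 𝒪_X̄ / 𝒪_X)` of a finite morphism `f : X̄ ⟶ X`. -/
def conductor {X Xb : Scheme.{u}} (f : Xb ⟶ X) [IsFinite f] : X.IdealSheafData where
  ideal U := ringConductor (f.app U.1).hom
  map_ideal_basicOpen U r := by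
    exact ringConductor_map_away _ _ _ (Xb.presheaf.map
      (homOfLE (f.preimage_mono (X.basicOpen_le r))).op).hom r (f.finite_app U.1 U.2)
      (U.2.isLocalization_basicOpen r)
      ((U.2.preimage f).isLocalization_of_eq_basicOpen _ _ (f.preimage_basicOpen r))
      (fun a ↦ ConcreteCategory.congr_hom (f.naturality (homOfLE (X.basicOpen_le r)).op) a)

section Conductor

variable {X Xb : Scheme.{u}} (f : Xb ⟶ X) [IsFinite f]

/-- The subscheme `Y ⊆ X` defined by the conductor of `f`. -/
abbrev conductorScheme : Scheme.{u} := (conductor f).subscheme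

/-- The inclusion `Y ⟶ X`. -/
abbrev conductorι : conductorScheme f ⟶ X := (conductor f).subschemeι

/-- The subscheme `Ȳ ⊆ X̄` defined by the conductor of `f`, i.e. by the ideal sheaf of `𝒪_X̄` that
the conductor generates (its direct image on `X` is the conductor). -/
abbrev conductorSchemeBar : Scheme.{u} := ((conductor f).comap f).subscheme

/-- The inclusion `Ȳ ⟶ X̄`. -/
abbrev conductorBarι : conductorSchemeBar f ⟶ Xb := ((conductor f).comap f).subschemeι

/-- The map `g : Ȳ ⟶ Y` induced by `f`. -/
abbrev conductorMap : conductorSchemeBar f ⟶ conductorScheme f :=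
  IdealSheafData.subschemeMap _ _ f ((conductor f).le_map_comap f)

lemma conductor_square : conductorBarι f ≫ f = conductorMap f ≫ conductorι f :=
  (IdealSheafData.subschemeMap_subschemeι _ _ f _).symm

lemma conductor_square_over (p : X ⟶ S) :
    conductorBarι f ≫ f ≫ p = conductorMap f ≫ conductorι f ≫ p := by
  rw [← Category.assoc, conductor_square, Category.assoc]

end Conductor

/-- For a commutative square `a ≫ b = c ≫ d`, the identification `b_* a_* = d_* c_*`. -/
def pushforwardSquare {A B C D : Scheme.{u}} {a : A ⟶ B} {b : B ⟶ D} {c : A ⟶ C} {d : C ⟶ D}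
    (h : a ≫ b = c ≫ d) :
    Modules.pushforward a ⋙ Modules.pushforward b ≅ Modules.pushforward c ⋙ Modules.pushforward d :=
  Modules.pushforwardComp a b ≪≫ Modules.pushforwardCongr h ≪≫ (Modules.pushforwardComp c d).symm

section Involution

variable {Y Yb : Scheme.{u}}

/-- `ι` is the involution of `Ȳ` associated with the double cover `g : Ȳ ⟶ Y`: `ι` is an
involution over `Y`, and `𝒪_Y` is the subsheaf of `ι`-invariants of `g_* 𝒪_Ȳ`, that is, `g` is the
quotient map by `ι`. -/
structure IsCoverInvolution (g : Yb ⟶ Y) (ι : Yb ⟶ Yb) : Prop where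
  involutive : ι ≫ ι = 𝟙 Yb
  comp_eq : ι ≫ g = g
  existsUnique_of_invariant : ∀ (U : Y.Opens) (s : Γ(Yb, g ⁻¹ᵁ U)),
    comorph ι (V := g ⁻¹ᵁ U)
      (show g ⁻¹ᵁ U ≤ ι ⁻¹ᵁ g ⁻¹ᵁ U by rw [← Scheme.Hom.comp_preimage, comp_eq]) s = s →
    ∃! t : Γ(Y, U), g.app U t = s

variable {g : Yb ⟶ Y} {ι : Yb ⟶ Yb}

/-- The invariant part `(g_* T_Ȳ)^inv` of `g_* T_Ȳ` with respect to `ι`: the derivations `D` with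
`D ∘ ι^# = ι^# ∘ D`. -/
def invariantTangent (hι : ι ≫ g = g) (s : Y ⟶ S) : Y.Modules :=
  equalizer
    ((Modules.pushforward g).map (precomp (g ≫ s) ι (g ≫ s) (by rw [← Category.assoc, hι])))
    ((Modules.pushforward g).map (postcomp (g ≫ s) ι) ≫
      (Modules.pushforwardComp ι g).hom.app _ ≫ (Modules.pushforwardCongr hι).hom.app _)

/-- The inclusion `(g_* T_Ȳ)^inv ⟶ g_* T_Ȳ`. -/
def invariantTangentι (hι : ι ≫ g = g) (s : Y ⟶ S) :
    invariantTangent hι s ⟶ (Modules.pushforward g).obj (tangentSheaf (g ≫ s)) :=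
  equalizer.ι _ _

end Involution

section Varieties

variable {K : Type u} [Field K]

/-- A variety over `K`: a reduced equidimensional scheme of finite type over `K`. -/
class IsVariety {X : Scheme.{u}} (p : X ⟶ Spec (.of K)) : Prop where
  reduced : IsReduced X
  locallyOfFiniteType : LocallyOfFiniteType p
  quasiCompact : QuasiCompact p
  equidimensional : ∃ n : ℕ, ∀ Z ∈ irreducibleComponents X, topologicalKrullDim Z = n

instance {X : Scheme.{u}} (p : X ⟶ Spec (.of K)) [h : IsVariety p] :
    LocallyOfFinitePresentation p :=
  LocallyOfFinitePresentation.iff_locallyOfFiniteType.mpr h.locallyOfFiniteType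

variable (K) in
/-- The coordinate ring `K[u, v, w, t₁, …, tₘ] / (u² - v² w)`. -/
abbrev PinchRing (m : ℕ) : Type u :=
  MvPolynomial (Fin 3 ⊕ Fin m) K ⧸ Ideal.span
    {(MvPolynomial.X (.inl 0) ^ 2 - MvPolynomial.X (.inl 1) ^ 2 * MvPolynomial.X (.inl 2) :
      MvPolynomial (Fin 3 ⊕ Fin m) K)}

variable (K) in
/-- The product of the pinch point `u² = v² w` with `𝔸ᵐ`, as a scheme over `K`. -/
def pinch (m : ℕ) : Spec (.of (PinchRing K m)) ⟶ Spec (.of K) :=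
  Spec.map (CommRingCat.ofHom (algebraMap K (PinchRing K m)))

/-- A variety of dimension `n = m + 2` is semi-smooth if it can be covered by étale open sets that
are isomorphic to étale open sets of the product of the pinch point with `𝔸ⁿ⁻²`. -/
class IsSemiSmooth {X : Scheme.{u}} (p : X ⟶ Spec (.of K)) : Prop extends IsVariety p where
  etaleLocally : ∃ m : ℕ,
    (∀ Z ∈ irreducibleComponents X, topologicalKrullDim Z = (m + 2 : ℕ)) ∧
    ∀ x : X, ∃ (U : Scheme.{u}) (φ : U ⟶ X) (ψ : U ⟶ Spec (.of (PinchRing K m))),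
      Etale φ ∧ Etale ψ ∧ φ ≫ p = ψ ≫ pinch K m ∧ x ∈ Set.range φ

/-- `f : X̄ ⟶ X` is the normalization of the (reduced) variety `X`: `X̄` is normal and `f` is finite
and birational, i.e. an isomorphism over a dense open subset of `X` with dense preimage. -/
class IsNormalization {X Xb : Scheme.{u}} (f : Xb ⟶ X) : Prop extends IsFinite f where
  normal : ∀ x : Xb, IsDomain (Xb.presheaf.stalk x) ∧ IsIntegrallyClosed (Xb.presheaf.stalk x)
  birational : ∃ U : X.Opens, Dense (U : Set X) ∧ Dense ((f ⁻¹ᵁ U : Xb.Opens) : Set Xb) ∧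
    IsIso (f ∣_ U)

end Varieties

end

end SemiSmooth

open SemiSmooth

/-! Everything is decided on an affine open V of X. Write A = Γ(X, V), B = Γ(X̄, f⁻¹V), let I be the
conductor, an ideal of A that is also an ideal of B, and put R = A/I, S = B/I. Derivations extend
uniquely along localizations, so sections of the tangent sheaves over affine opens are derivations
of rings (`exists_eval_eq`, `ext_of_isAffineOpen`).

Existence of α. Derivations of A extend to B in at most one way, because sB ⊆ A for some s in A that
is a nonzerodivisor on B. For the pinch point, B = K[x, y, t] with u = xy, v = x, w = y².
Differentiating u² = v²w and cancelling x gives 2y·du = 2y²·dv + x·dw. Hence y divides dw, and Dx =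
dv, Dy = dw/(2y) is the extension (`exists_extend_pinch`); this is where char ≠ 2 enters. On the
smooth locus A is normal, so A = B and α is an isomorphism.

The involution. In the model I is generated by x in B, and S is generated over R by y, with y² in R
and with 1, y independent. So y ↦ -y is the only involution with invariants R, and a derivation of S
that vanishes on R is zero (`IsDoubleCover`).

From the model to X. Finitely many étale charts combine into a faithfully flat étale A → A' such
that A' is also étale over the pinch ring P. Integral closure commutes with étale base change, so A'
⊗ B is the base change to A' of the normalization of P (`nonempty_tensorProduct_algEquiv`).
Extensions of derivations, projectivity of Ω and the involution then descend along A → A'. The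
involution descends because σ(b) is the unique solution of a system of linear equations with
coefficients in A (`tmul_sub_tmul`).

Exactness. A derivation of A preserves I, so its extension to B induces a derivation e of S with
e(R) ⊆ R. The conjugate of e by ι agrees with e on R, hence everywhere, and e is invariant.
Conversely, an invariant derivation of S lifts to a derivation E of B because Ω_B is projective. It
maps A into elements whose class in S is invariant, hence lies in R; since I ⊆ A, these elements are
in A, and E comes from X. So the image of α is the full preimage of (g_* T_Ȳ)^inv under the
epimorphism f_* T_X̄ → g_*(T_X̄|_Ȳ), and the sequence follows formally (`shortExact_of_epi`).
Projectivity of Ω_B also identifies T_X̄|_Ȳ with a sheaf of derivations (`isIso_pullbackTangent`),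
on which all of this is computed. -/

namespace SemiSmooth

/-! ### Morphisms of sheaves of modules tested on a basis of opens -/

section ModulesOnBasis

variable {Z : Scheme.{u}} {M N K' : Z.Modules}

/-- `𝔅` is a basis of the topology of `Z`. -/
def IsOpensBasis (𝔅 : Z.Opens → Prop) : Prop :=
  ∀ (U : Z.Opens) (x : Z), x ∈ U → ∃ V ≤ U, x ∈ V ∧ 𝔅 V

lemma isOpensBasis_isAffineOpen : IsOpensBasis (Z := Z) IsAffineOpen := fun U x hx ↦ by
  obtain ⟨V, hV, hxV, hVU⟩ :=
    TopologicalSpace.Opens.isBasis_iff_nbhd.mp Z.isBasis_affineOpens hx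
  exact ⟨V, hVU, hxV, hV⟩

lemma Modules.section_ext {U : Z.Opens} {s t : Γ(M, U)}
    (h : ∀ x ∈ U, ∃ (V : Z.Opens) (hV : V ≤ U), x ∈ V ∧
      M.presheaf.map (homOfLE hV).op s = M.presheaf.map (homOfLE hV).op t) : s = t := by
  choose V hV hx hs using fun x : U ↦ h x.1 x.2
  exact TopCat.Sheaf.eq_of_locally_eq' ⟨M.presheaf, M.isSheaf⟩ V U (fun x ↦ homOfLE (hV x))
    (fun x hxU ↦ TopologicalSpace.Opens.mem_iSup.mpr ⟨⟨x, hxU⟩, hx _⟩) s t hs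

lemma Modules.app_map (φ : M ⟶ N) {U V : Z.Opens} (hV : V ≤ U) (s : Γ(M, U)) :
    φ.app V (M.presheaf.map (homOfLE hV).op s) = N.presheaf.map (homOfLE hV).op (φ.app U s) :=
  congr($(φ.mapPresheaf.naturality (homOfLE hV).op) s)

lemma Modules.hom_ext_of_basis {𝔅 : Z.Opens → Prop} (h𝔅 : IsOpensBasis 𝔅) {φ ψ : M ⟶ N}
    (h : ∀ U, 𝔅 U → ∀ s : Γ(M, U), φ.app U s = ψ.app U s) : φ = ψ := by
  ext U s
  refine Modules.section_ext fun x hx ↦ ?_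
  obtain ⟨V, hV, hxV, hVB⟩ := h𝔅 U x hx
  exact ⟨V, hV, hxV, by rw [← Modules.app_map, ← Modules.app_map, h V hVB]⟩

lemma Modules.mono_of_injective {𝔅 : Z.Opens → Prop} (h𝔅 : IsOpensBasis 𝔅) {φ : M ⟶ N}
    (h : ∀ U, 𝔅 U → Function.Injective (φ.app U)) : Mono φ where
  right_cancellation _ _ hab := Modules.hom_ext_of_basis h𝔅 fun U hU s ↦
    h U hU congr(Modules.Hom.app $hab U s)

lemma Modules.injective_of_mono (φ : M ⟶ N) [Mono φ] (U : Z.Opens) :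
    Function.Injective (φ.app U) := by
  have h1 : Mono ((Modules.toPresheaf Z).map φ) := inferInstance
  have h2 : Mono (((Modules.toPresheaf Z).map φ).app (.op U)) := inferInstance
  exact (AddCommGrpCat.mono_iff_injective _).mp h2

lemma Modules.epi_of_surjective {𝔅 : Z.Opens → Prop} (h𝔅 : IsOpensBasis 𝔅) {φ : M ⟶ N}
    (h : ∀ U, 𝔅 U → Function.Surjective (φ.app U)) : Epi φ where
  left_cancellation _ _ hab := Modules.hom_ext_of_basis h𝔅 fun U hU s ↦ by
    obtain ⟨t, rfl⟩ := h U hU s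
    exact congr(Modules.Hom.app $hab U t)

/-- In an abelian category a mono is the kernel of its cokernel, and the composite of `φ` with the
cokernel of `ψ` vanishes on a basis. This turns constructions of sheaf maps into existence
statements on affine opens. -/
lemma Modules.exists_lift {𝔅 : Z.Opens → Prop} (h𝔅 : IsOpensBasis 𝔅) (φ : M ⟶ N) (ψ : K' ⟶ N)
    [Mono ψ] (h : ∀ U, 𝔅 U → ∀ s : Γ(M, U), ∃ t : Γ(K', U), ψ.app U t = φ.app U s) :
    ∃ χ : M ⟶ K', χ ≫ ψ = φ := by
  have h0 : φ ≫ cokernel.π ψ = 0 := Modules.hom_ext_of_basis h𝔅 fun U hU s ↦ by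
    obtain ⟨t, ht⟩ := h U hU s
    have : (ψ ≫ cokernel.π ψ).app U t = 0 := by rw [cokernel.condition]; rfl
    rw [Modules.Hom.comp_app, AddCommGrpCat.comp_apply, ← ht]
    exact this
  exact ⟨_, (Abelian.monoIsKernelOfCokernel _ (cokernelIsCokernel ψ)).fac (KernelFork.ofι φ h0)
    WalkingParallelPair.zero⟩

/-- Dually, an epi is the cokernel of its kernel. No surjectivity of `r` on sections is needed. -/
lemma Modules.exists_desc {𝔅 : Z.Opens → Prop} (h𝔅 : IsOpensBasis 𝔅) (r : M ⟶ N) (φ : M ⟶ K')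
    [Epi r] (h : ∀ U, 𝔅 U → ∀ s : Γ(M, U), r.app U s = 0 → φ.app U s = 0) :
    ∃ χ : N ⟶ K', r ≫ χ = φ := by
  have h0 : kernel.ι r ≫ φ = 0 := Modules.hom_ext_of_basis h𝔅 fun U hU s ↦ by
    refine h U hU ((kernel.ι r).app U s) ?_
    exact congr(Modules.Hom.app $(kernel.condition r) U s)
  exact ⟨_, (Abelian.epiIsCokernelOfKernel _ (kernelIsKernel r)).fac (CokernelCofork.ofπ φ h0)
    WalkingParallelPair.one⟩

lemma Modules.isIso_of_surjective {𝔅 : Z.Opens → Prop} (h𝔅 : IsOpensBasis 𝔅) {φ : M ⟶ N}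
    [Mono φ] (h : ∀ U, 𝔅 U → Function.Surjective (φ.app U)) : IsIso φ :=
  have := Modules.epi_of_surjective h𝔅 h
  isIso_of_mono_of_epi φ

/-- The cokernel sequence of `α` pushed out along an epimorphism `r` whose kernel is contained in
the image of `α`. -/
lemma shortExact_of_epi {C : Type*} [Category C] [Abelian C] {T Q R N : C} (α : T ⟶ Q)
    (r : Q ⟶ R) [Epi r] (i : N ⟶ R) [Mono i] (β : T ⟶ N) [Epi β] (hβ : β ≫ i = α ≫ r)
    (π : R ⟶ cokernel α) (hπ : r ≫ π = cokernel.π α) :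
    ∃ w : i ≫ π = 0, (ShortComplex.mk i π w).ShortExact := by
  have w : i ≫ π = 0 := by
    rw [← cancel_epi β, ← Category.assoc, hβ, Category.assoc, hπ, cokernel.condition, comp_zero]
  have : Epi π := by
    have : Epi (r ≫ π) := by rw [hπ]; infer_instance
    exact epi_of_epi r π
  -- A map out of `R` that kills `i` kills `α ≫ r`, so it factors through `cokernel α`. The
  -- factorization can be checked after composing with the epi `r`.
  have hc : IsColimit (CokernelCofork.ofπ π w) := CokernelCofork.IsColimit.ofπ' _ _ fun {A} k hk ↦ by
    have hk' : α ≫ r ≫ k = 0 := by rw [← Category.assoc, ← hβ, Category.assoc, hk, comp_zero]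
    refine ⟨cokernel.desc α (r ≫ k) hk', ?_⟩
    rw [← cancel_epi r, ← Category.assoc, hπ, cokernel.π_desc]
  refine ⟨w, ?_⟩
  exact
    { exact := ShortComplex.exact_of_g_is_cokernel _ hc
      mono_f := ‹Mono i›
      epi_g := ‹Epi π› }

end ModulesOnBasis
end SemiSmooth



namespace SemiSmooth

/-! ### Derivations along ring homomorphisms -/

section RingDerivations

/-- `d : A → B` is a derivation along `φ : A → B` that vanishes on the image of `κ`. -/
structure IsDer {K A B : Type*} [CommRing K] [CommRing A] [CommRing B] (κ : K →+* A) (φ : A →+* B)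
    (d : A →+ B) : Prop where
  leibniz (a b : A) : d (a * b) = φ a * d b + φ b * d a
  map_const (c : K) : d (κ c) = 0

namespace IsDer

variable {K A A' B : Type*} [CommRing K] [CommRing A] [CommRing A'] [CommRing B]
  {κ : K →+* A} {φ : A →+* B} {d e : A →+ B}

/-- The bundled derivation. -/
@[reducible] def toDerivation [Algebra K A] [Algebra K B] [Algebra A B] [IsScalarTower K A B]
    (hd : IsDer (algebraMap K A) (algebraMap A B) d) : Derivation K A B :=
  Derivation.mk'
    { toFun := d
      map_add' := map_add d
      map_smul' := fun c a ↦ by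
        rw [Algebra.smul_def, hd.leibniz, hd.map_const, mul_zero, add_zero, Algebra.smul_def,
          ← IsScalarTower.algebraMap_apply]; rfl }
    fun a b ↦ by simpa [Algebra.smul_def] using hd.leibniz a b

lemma ofDerivation [Algebra K A] [Algebra K B] [Algebra A B] [IsScalarTower K A B]
    (D : Derivation K A B) : IsDer (algebraMap K A) (algebraMap A B) (D : A →+ B) where
  leibniz a b := by simp [Algebra.smul_def]
  map_const c := by simp

lemma sub (hd : IsDer κ φ d) (he : IsDer κ φ e) : IsDer κ φ (d - e) where
  leibniz a b := by simp only [AddMonoidHom.sub_apply, hd.leibniz, he.leibniz]; ring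
  map_const c := by simp only [AddMonoidHom.sub_apply, hd.map_const, he.map_const, sub_zero]

lemma compRight (hd : IsDer κ φ d) {C : Type*} [CommRing C] (f : B →+* C) :
    IsDer κ (f.comp φ) (f.toAddMonoidHom.comp d) where
  leibniz a b := by simp [hd.leibniz]
  map_const c := by simp [hd.map_const]

lemma compLeft {ψ : A' →+* B} {d : A' →+ B} {f : A →+* A'} (hd : IsDer (f.comp κ) ψ d) :
    IsDer κ (ψ.comp f) (d.comp f.toAddMonoidHom) where
  leibniz a b := by simp [hd.leibniz]
  map_const c := by simpa using hd.map_const c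

/-- Derivations extend along formally étale ring maps. -/
lemma exists_extend {f : A →+* A'} (hf : f.FormallyEtale) {ψ : A' →+* B} {d : A →+ B}
    (hd : IsDer κ (ψ.comp f) d) :
    ∃ d' : A' →+ B, IsDer (f.comp κ) ψ d' ∧ ∀ a, d' (f a) = d a := by
  algebraize [κ, f, ψ, f.comp κ, ψ.comp f, ψ.comp (f.comp κ)]
  have : Algebra.FormallyEtale A A' := hf
  have : IsScalarTower K A B := .of_algebraMap_eq' rfl
  let D : Derivation K A B := toDerivation (d := d) hd
  let D' : Derivation K A' B := ((KaehlerDifferential.isBaseChange_of_formallyEtale K A A').lift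
    D.liftKaehlerDifferential).compDer (KaehlerDifferential.D K A')
  refine ⟨(D' : A' →+ B), .ofDerivation D', fun a ↦ ?_⟩
  have h := (KaehlerDifferential.isBaseChange_of_formallyEtale K A A').lift_eq
    D.liftKaehlerDifferential (KaehlerDifferential.D K A a)
  rw [KaehlerDifferential.map_D, Derivation.liftKaehlerDifferential_comp_D] at h
  exact h

/-- Ω of `A'` is the base change of Ω of `A`, so a linear map on it is determined by the
differentials coming from `A`. -/
lemma eq_of_formallyEtale {f : A →+* A'} (hf : f.FormallyEtale) {ψ : A' →+* B} {d e : A' →+ B}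
    (hd : IsDer (f.comp κ) ψ d) (he : IsDer (f.comp κ) ψ e) (h : ∀ a, d (f a) = e (f a)) :
    d = e := by
  algebraize [κ, f, ψ, f.comp κ, ψ.comp f, ψ.comp (f.comp κ)]
  have : Algebra.FormallyEtale A A' := hf
  have : IsScalarTower K A B := .of_algebraMap_eq' rfl
  let D : Derivation K A' B := toDerivation (d := d) hd
  let E : Derivation K A' B := toDerivation (d := e) he
  have key : D.liftKaehlerDifferential = E.liftKaehlerDifferential := by
    refine (KaehlerDifferential.isBaseChange_of_formallyEtale K A A').algHom_ext' _ _ ?_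
    refine Derivation.liftKaehlerDifferential_unique _ _ ?_
    ext a
    simpa using show D (algebraMap A A' a) = E (algebraMap A A' a) from h a
  ext a
  have h1 := D.liftKaehlerDifferential_comp_D a
  rw [key, E.liftKaehlerDifferential_comp_D] at h1
  exact h1.symm

end IsDer

end RingDerivations
end SemiSmooth



namespace SemiSmooth

/-! ### Sheaf derivations on affine opens -/

section AffineDerivations

variable {K : Type u} [Field K] {W Z : Scheme.{u}}

/-- The structure map `K → Γ(W, U)` of a scheme over `K`. -/
noncomputable def kmap (p : W ⟶ Spec (.of K)) (U : W.Opens) : K →+* Γ(W, U) :=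
  (comorph p (U := ⊤) (V := U) le_top).comp (ΓSpecIso (.of K)).inv.hom

lemma res_kmap (p : W ⟶ Spec (.of K)) {U V : W.Opens} (hV : V ≤ U) (c : K) :
    res hV (kmap p U c) = kmap p V c := by
  simp only [kmap, RingHom.comp_apply]
  exact res_comorph (U := ⊤) p le_top hV _

lemma comorph_kmap (p : W ⟶ Spec (.of K)) (h : Z ⟶ W) {U : W.Opens} {V : Z.Opens}
    (hV : V ≤ h ⁻¹ᵁ U) (c : K) : comorph h hV (kmap p U c) = kmap (h ≫ p) V c := by
  simp only [kmap, RingHom.comp_apply]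
  exact comorph_comp (U := ⊤) h p le_top hV _

/-- Spec K is a point: T is everything, or T and U are empty and the functions on U form the zero
ring. Vanishing on functions from the base is thereby reduced to vanishing on K. -/
lemma exists_kmap_eq (p : W ⟶ Spec (.of K)) {U : W.Opens} {T : (Spec (.of K)).Opens}
    (hU : U ≤ p ⁻¹ᵁ T) (c : Γ(Spec (.of K), T)) : ∃ k, comorph p hU c = kmap p U k := by
  by_cases hT : T = ⊤
  · subst hT
    refine ⟨(ΓSpecIso (.of K)).hom c, ?_⟩
    have : (ΓSpecIso (.of K)).inv ((ΓSpecIso (.of K)).hom c) = c := by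
      rw [← CommRingCat.comp_apply, Iso.hom_inv_id]; rfl
    simp only [kmap, RingHom.comp_apply]
    exact congr(comorph p hU $this.symm)
  · have hT' : T = ⊥ := by
      by_contra hne
      obtain ⟨x, hx⟩ := (TopologicalSpace.Opens.ne_bot_iff_nonempty T).mp hne
      refine hT (eq_top_iff.mpr fun y _ ↦ ?_)
      have : Subsingleton (PrimeSpectrum K) := inferInstance
      rwa [show y = x from this.elim y x]
    subst hT'
    have hU' : U = ⊥ := le_bot_iff.mp hU
    subst hU'
    exact ⟨0, Subsingleton.elim _ _⟩

variable {p : W ⟶ Spec (.of K)} {h : Z ⟶ W}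

namespace DerivationAlong

lemma isDer {V : Z.Opens} (D : DerivationAlong p h V) (U : W.Opens) :
    IsDer (kmap p U) (comorph h (inf_le_right : V ⊓ h ⁻¹ᵁ U ≤ _)) (D.toFun U) where
  leibniz := D.leibniz U
  map_const _ := D.map_const U ⊤ _ _

/-- The derivation `Γ(W, U) → Γ(Z, V)` induced by a sheaf derivation, for `h(V) ⊆ U`. -/
noncomputable def eval {U : W.Opens} {V : Z.Opens} (hV : V ≤ h ⁻¹ᵁ U) (D : DerivationAlong p h V) :
    Γ(W, U) →+ Γ(Z, V) :=
  (res (le_inf le_rfl hV)).toAddMonoidHom.comp (D.toFun U)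

lemma eval_apply {U : W.Opens} {V : Z.Opens} (hV : V ≤ h ⁻¹ᵁ U) (D : DerivationAlong p h V)
    (a : Γ(W, U)) : D.eval hV a = res (le_inf le_rfl hV) (D.toFun U a) := rfl

lemma toFun_eq_eval {U : W.Opens} {V : Z.Opens} (hV : V ≤ h ⁻¹ᵁ U) (D : DerivationAlong p h V)
    (a : Γ(W, U)) : D.toFun U a = res inf_le_left (D.eval hV a) := by
  rw [eval_apply, res_res, res_self]

lemma isDer_eval {U : W.Opens} {V : Z.Opens} (hV : V ≤ h ⁻¹ᵁ U) (D : DerivationAlong p h V) :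
    IsDer (kmap p U) (comorph h hV) (D.eval hV) where
  leibniz a b := by simp [eval_apply, D.leibniz]
  map_const c := by rw [eval_apply, (D.isDer U).map_const, _root_.map_zero]

/-- Localization of functions to a basic open subset of an affine open is formally étale. -/
lemma formallyEtale_res_basicOpen {U : W.Opens} (hU : IsAffineOpen U) (g : Γ(W, U)) :
    (res (W.basicOpen_le g)).FormallyEtale := by
  exact @Algebra.FormallyEtale.of_isLocalization _ _ _ _ (Submonoid.powers g)
    (res (W.basicOpen_le g)).toAlgebra (hU.isLocalization_basicOpen g)

lemma section_ext {V : Z.Opens} {s t : Γ(Z, V)}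
    (H : ∀ x ∈ V, ∃ (V' : Z.Opens) (hV : V' ≤ V), x ∈ V' ∧ res hV s = res hV t) : s = t := by
  choose V' hV hx hs using fun x : V ↦ H x.1 x.2
  exact TopCat.Sheaf.eq_of_locally_eq' Z.sheaf V' V (fun x ↦ homOfLE (hV x))
    (fun x hxU ↦ TopologicalSpace.Opens.mem_iSup.mpr ⟨⟨x, hxU⟩, hx _⟩) s t hs

lemma kmap_basicOpen {U : W.Opens} (g : Γ(W, U)) :
    kmap p (W.basicOpen g) = (res (W.basicOpen_le g)).comp (kmap p U) :=
  RingHom.ext fun _ ↦ (res_kmap p _ _).symm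

/-- A sheaf derivation on `V` is determined by its values on `Γ(W, U)`, for `U` affine. -/
lemma ext_of_isAffineOpen {U : W.Opens} (hU : IsAffineOpen U) {V : Z.Opens} (hV : V ≤ h ⁻¹ᵁ U)
    {D E : DerivationAlong p h V} (H : ∀ a, D.eval hV a = E.eval hV a) : D = E := by
  refine ext' fun U' a ↦ section_ext fun z hz ↦ ?_
  obtain ⟨g, hg, hzg⟩ := hU.exists_basicOpen_le ⟨h z, hz.2⟩ (hV hz.1)
  refine ⟨V ⊓ h ⁻¹ᵁ W.basicOpen g, inf_le_inf_left _ (h.preimage_mono hg), ⟨hz.1, hzg⟩, ?_⟩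
  have key : D.toFun (W.basicOpen g) = E.toFun (W.basicOpen g) := by
    refine IsDer.eq_of_formallyEtale (κ := kmap p U) (formallyEtale_res_basicOpen hU g)
      (ψ := comorph h inf_le_right) ?_ ?_ fun a ↦ ?_
    · rw [← kmap_basicOpen]; exact D.isDer _
    · rw [← kmap_basicOpen]; exact E.isDer _
    · rw [D.map_res, E.map_res, toFun_eq_eval hV, toFun_eq_eval hV, H]
  rw [← D.map_res hg, ← E.map_res hg, key]

/-- Every derivation `Γ(W, U) → Γ(Z, V)`, with `U` affine, comes from a sheaf derivation. -/
lemma exists_eval_eq {U : W.Opens} (hU : IsAffineOpen U) {V : Z.Opens} (hV : V ≤ h ⁻¹ᵁ U)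
    {d : Γ(W, U) →+ Γ(Z, V)} (hd : IsDer (kmap p U) (comorph h hV) d) :
    ∃ D : DerivationAlong p h V, D.eval hV = d := by
  have loc (g : Γ(W, U)) : ∃ d' : Γ(W, W.basicOpen g) →+ Γ(Z, V ⊓ h ⁻¹ᵁ W.basicOpen g),
      IsDer (kmap p (W.basicOpen g)) (comorph h inf_le_right) d' ∧
        ∀ a, d' (res (W.basicOpen_le g) a) = res inf_le_left (d a) := by
    have h1 := hd.compRight (res (inf_le_left : V ⊓ h ⁻¹ᵁ W.basicOpen g ≤ V))
    rw [show (res (inf_le_left : V ⊓ h ⁻¹ᵁ W.basicOpen g ≤ V)).comp (comorph h hV) =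
      (comorph h inf_le_right).comp (res (W.basicOpen_le g)) from
      RingHom.ext fun a ↦ by simp] at h1
    obtain ⟨d', h2, h3⟩ := h1.exists_extend (formallyEtale_res_basicOpen hU g)
    exact ⟨d', by rwa [kmap_basicOpen], h3⟩
  choose δ hδ hδ' using loc
  -- Both sides are derivations on D(g) with the same restriction to Γ(W, U), so the uniqueness half
  -- of formal étaleness identifies them.
  have compat {g g' : Γ(W, U)} (hg : W.basicOpen g' ≤ W.basicOpen g) (c : Γ(W, W.basicOpen g)) :
      res (inf_le_inf_left V (h.preimage_mono hg)) (δ g c) = δ g' (res hg c) := by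
    have h1 := (hδ g).compRight (res (inf_le_inf_left V (h.preimage_mono hg)))
    have h2 : IsDer (kmap p (W.basicOpen g)) ((res (inf_le_inf_left V (h.preimage_mono hg))).comp
        (comorph h inf_le_right)) ((δ g').comp (res hg).toAddMonoidHom) := by
      have h3 : IsDer ((res hg).comp (kmap p (W.basicOpen g)))
          (comorph h inf_le_right) (δ g') := by
        rw [show (res hg).comp (kmap p (W.basicOpen g)) = kmap p (W.basicOpen g') from
          RingHom.ext fun c ↦ res_kmap p _ c]
        exact hδ g'
      have h4 := h3.compLeft
      rwa [show (comorph h (inf_le_right : V ⊓ h ⁻¹ᵁ W.basicOpen g' ≤ _)).comp (res hg) =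
        (res (inf_le_inf_left V (h.preimage_mono hg))).comp (comorph h inf_le_right) from
        RingHom.ext fun a ↦ by simp] at h4
    rw [kmap_basicOpen] at h1 h2
    exact congr($(IsDer.eq_of_formallyEtale (formallyEtale_res_basicOpen hU g) h1 h2
      fun a ↦ by simp [hδ']) c)
  -- Since h(V) ⊆ U, basic opens of U suffice to glue over any open U' of W, even when U' is not
  -- contained in U.
  have cover (U' : W.Opens) : V ⊓ h ⁻¹ᵁ U' ≤
      ⨆ g : {g : Γ(W, U) // W.basicOpen g ≤ U'}, V ⊓ h ⁻¹ᵁ W.basicOpen g.1 := fun z hz ↦ by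
    obtain ⟨g, hg, hzg⟩ := hU.exists_basicOpen_le ⟨h z, hz.2⟩ (hV hz.1)
    exact TopologicalSpace.Opens.mem_iSup.mpr ⟨⟨g, hg⟩, hz.1, hzg⟩
  have glue (U' : W.Opens) (a : Γ(W, U')) : ∃ s : Γ(Z, V ⊓ h ⁻¹ᵁ U'), ∀ (g : Γ(W, U))
      (hg : W.basicOpen g ≤ U'),
      res (inf_le_inf_left V (h.preimage_mono hg)) s = δ g (res hg a) := by
    obtain ⟨s, hs, -⟩ := TopCat.Sheaf.existsUnique_gluing' Z.sheaf
      (fun g : {g : Γ(W, U) // W.basicOpen g ≤ U'} ↦ V ⊓ h ⁻¹ᵁ W.basicOpen g.1) (V ⊓ h ⁻¹ᵁ U')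
      (fun g ↦ homOfLE (inf_le_inf_left V (h.preimage_mono g.2))) (cover U')
      (fun g ↦ δ g.1 (res g.2 a)) fun g g' ↦ by
        have e := W.basicOpen_mul g.1 g'.1
        have e1 : W.basicOpen (g.1 * g'.1) ≤ W.basicOpen g.1 := e.trans_le inf_le_left
        have e2 : W.basicOpen (g.1 * g'.1) ≤ W.basicOpen g'.1 := e.trans_le inf_le_right
        have h1 := (compat e1 (res g.2 a)).trans ((congr(δ _ $((res_res _ _ _).trans
          (res_res _ _ _).symm))).trans (compat e2 (res g'.2 a)).symm)
        have h2 : (V ⊓ h ⁻¹ᵁ W.basicOpen g.1) ⊓ (V ⊓ h ⁻¹ᵁ W.basicOpen g'.1) ≤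
            V ⊓ h ⁻¹ᵁ W.basicOpen (g.1 * g'.1) := by
          rw [e]; exact fun z hz ↦ ⟨hz.1.1, hz.1.2, hz.2.2⟩
        have h3 := congr(res h2 $h1)
        rw [res_res, res_res] at h3
        exact h3
    exact ⟨s, fun g hg ↦ hs ⟨g, hg⟩⟩
  choose s hs using glue
  have sep (U' : W.Opens) (x y : Γ(Z, V ⊓ h ⁻¹ᵁ U')) (hxy : ∀ (g : Γ(W, U))
      (hg : W.basicOpen g ≤ U'), res (inf_le_inf_left V (h.preimage_mono hg)) x =
        res (inf_le_inf_left V (h.preimage_mono hg)) y) : x = y :=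
    TopCat.Sheaf.eq_of_locally_eq' Z.sheaf
      (fun g : {g : Γ(W, U) // W.basicOpen g ≤ U'} ↦ V ⊓ h ⁻¹ᵁ W.basicOpen g.1) (V ⊓ h ⁻¹ᵁ U')
      (fun g ↦ homOfLE (inf_le_inf_left V (h.preimage_mono g.2))) (cover U') x y
      fun g ↦ hxy g.1 g.2
  let D : DerivationAlong p h V :=
    { toFun := fun U' ↦ AddMonoidHom.mk' (s U') fun a b ↦ sep _ _ _ fun g hg ↦ by
        rw [map_add, hs U' (a + b) g hg, hs U' a g hg, hs U' b g hg, map_add, map_add]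
      leibniz := fun U' a b ↦ sep _ _ _ fun g hg ↦ by
        simp only [AddMonoidHom.mk'_apply, map_add, map_mul, hs U' (a * b) g hg, hs U' a g hg,
          hs U' b g hg, (hδ g).leibniz, res_comorph, comorph_res]
      map_const := fun U' T hT c ↦ sep _ _ _ fun g hg ↦ by
        obtain ⟨k, hk⟩ := exists_kmap_eq p hT c
        simp only [AddMonoidHom.mk'_apply, hk, hs U' _ g hg, res_kmap, (hδ g).map_const, map_zero]
      map_res := fun {U' U''} hU' a ↦ sep _ _ _ fun g hg ↦ by
        simp only [AddMonoidHom.mk'_apply, hs U'' _ g hg, hs U' _ g (hg.trans hU'), res_res] }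
  refine ⟨D, AddMonoidHom.ext fun a ↦ ?_⟩
  rw [eval_apply]
  have h1 : D.toFun U a = res inf_le_left (d a) := sep _ _ _ fun g hg ↦ by
    rw [res_res, ← hδ' g, ← hs]; rfl
  rw [h1, res_res, res_self]

end DerivationAlong

end AffineDerivations
end SemiSmooth



namespace SemiSmooth

/-! ### Rings with projective differentials -/

section ProjectiveDifferentials

/-- The module of differentials of `κ : K → A` is finitely generated and projective. -/
def HasProjectiveDifferentials {K A : Type*} [CommRing K] [CommRing A] (κ : K →+* A) : Prop :=
  letI := κ.toAlgebra
  Module.Finite A Ω[A⁄K] ∧ Module.Projective A Ω[A⁄K]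

variable {K A B : Type*} [CommRing K] [CommRing A] [CommRing B] {κ : K →+* A}

/-- A derivation into `B` is an `A`-linear map out of Ω, and a map out of a projective module lifts
through a surjection. -/
lemma HasProjectiveDifferentials.exists_lift (h : HasProjectiveDifferentials κ) {φ : A →+* B}
    (hφ : Function.Surjective φ) {δ : A →+ B} (hδ : IsDer κ φ δ) :
    ∃ d : A →+ A, IsDer κ (RingHom.id A) d ∧ ∀ a, φ (d a) = δ a := by
  algebraize [κ, φ, φ.comp κ]
  obtain ⟨-, hp⟩ := h
  let D : Derivation K A B := IsDer.toDerivation (d := δ) hδ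
  obtain ⟨ℓ, hℓ⟩ := Module.projective_lifting_property (Algebra.linearMap A B)
    D.liftKaehlerDifferential hφ
  let E : Derivation K A A := ℓ.compDer (KaehlerDifferential.D K A)
  refine ⟨(E : A →+ A), .ofDerivation E, fun a ↦ ?_⟩
  have h := congr($hℓ (KaehlerDifferential.D K A a))
  rw [Derivation.liftKaehlerDifferential_comp_D] at h
  exact h

/-- Dual basis: Ω is a retract of Aⁿ, so d expands in the n coordinate derivations. The coefficients
are values on Ω of the linear map attached to d; they lie in J because Ω is spanned by exact
differentials. -/
lemma HasProjectiveDifferentials.exists_eq_sum (h : HasProjectiveDifferentials κ) {J : Ideal A}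
    {d : A →+ A} (hd : IsDer κ (RingHom.id A) d) (hJ : ∀ a, d a ∈ J) :
    ∃ (n : ℕ) (c : Fin n → A) (e : Fin n → A →+ A), (∀ i, c i ∈ J) ∧
      (∀ i, IsDer κ (RingHom.id A) (e i)) ∧ ∀ a, d a = ∑ i, c i * e i a := by
  algebraize [κ]
  obtain ⟨hf, hp⟩ := h
  let D : Derivation K A A := IsDer.toDerivation (d := d) hd
  obtain ⟨n, f, g, -, -, hfg⟩ := Module.Finite.exists_comp_eq_id_of_projective A Ω[A⁄K]
  refine ⟨n, fun i ↦ D.liftKaehlerDifferential (f (Pi.single i 1)),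
    fun i ↦ ((((LinearMap.proj i).comp g).compDer (KaehlerDifferential.D K A) :
      Derivation K A A) : A →+ A), fun i ↦ ?_, fun i ↦ .ofDerivation _, fun a ↦ ?_⟩
  · have : ∀ ω, D.liftKaehlerDifferential ω ∈ J := fun ω ↦ by
      have hω : ω ∈ Submodule.span A (Set.range (KaehlerDifferential.D K A)) := by
        rw [KaehlerDifferential.span_range_derivation]; trivial
      induction hω using Submodule.span_induction with
      | mem x hx =>
        obtain ⟨a, rfl⟩ := hx
        rw [Derivation.liftKaehlerDifferential_comp_D]; exact hJ a
      | zero => simp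
      | add x y _ _ hx hy => rw [map_add]; exact J.add_mem hx hy
      | smul c x _ hx => rw [map_smul]; exact J.mul_mem_left c hx
    exact this _
  · have h1 : D a = D.liftKaehlerDifferential (f (g (KaehlerDifferential.D K A a))) := by
      have h1 : f (g (KaehlerDifferential.D K A a)) = KaehlerDifferential.D K A a :=
        congr($hfg (KaehlerDifferential.D K A a))
      rw [h1, Derivation.liftKaehlerDifferential_comp_D]
    have h2 : g (KaehlerDifferential.D K A a) =
        ∑ i, g (KaehlerDifferential.D K A a) i • Pi.single (M := fun _ ↦ A) i 1 := by
      ext j; simp [Finset.sum_apply, Pi.single_apply]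
    change D a = _
    rw [h1, h2, map_sum, map_sum]
    refine Finset.sum_congr rfl fun i _ ↦ ?_
    rw [map_smul, map_smul, smul_eq_mul, mul_comm]
    rfl

lemma HasProjectiveDifferentials.of_formallyEtale (h : HasProjectiveDifferentials κ)
    {f : A →+* B} (hf : f.FormallyEtale) : HasProjectiveDifferentials (f.comp κ) := by
  algebraize [κ, f, f.comp κ]
  have : Algebra.FormallyEtale A B := hf
  obtain ⟨_, _⟩ := h
  have e := KaehlerDifferential.tensorKaehlerEquivOfFormallyEtale K A B
  exact ⟨Module.Finite.equiv e, Module.Projective.of_equiv e⟩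

end ProjectiveDifferentials

/-! ### Sheaves of modules along a closed immersion -/

section ClosedImmersion

variable {Z W : Scheme.{u}}

lemma Modules.map_map {M : Z.Modules} {U V V' : Z.Opens} (h : V ≤ U) (h' : V' ≤ V) (s : Γ(M, U)) :
    M.presheaf.map (homOfLE h').op (M.presheaf.map (homOfLE h).op s) =
      M.presheaf.map (homOfLE (h'.trans h)).op s := by
  rw [← AddCommGrpCat.comp_apply, ← Functor.map_comp]; rfl

lemma Modules.map_self {M : Z.Modules} {U : Z.Opens} (s : Γ(M, U)) :
    M.presheaf.map (homOfLE (le_refl U)).op s = s := by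
  have : M.presheaf.map (homOfLE (le_refl U)).op = 𝟙 _ := M.presheaf.map_id _
  rw [this]; rfl

lemma Modules.map_smul' {M : Z.Modules} {U V : Z.Opens} (h : V ≤ U) (r : Γ(Z, U)) (s : Γ(M, U)) :
    M.presheaf.map (homOfLE h).op (r • s) = res h r • M.presheaf.map (homOfLE h).op s :=
  Modules.map_smul M (homOfLE h) r s

variable (j : Z ⟶ W)

lemma exists_preimage_eq [IsClosedImmersion j] (U : Z.Opens) : ∃ V : W.Opens, j ⁻¹ᵁ V = U := by
  obtain ⟨V, hV, h⟩ := j.isClosedEmbedding.isInducing.isOpen_iff.mp U.2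
  exact ⟨⟨V, hV⟩, TopologicalSpace.Opens.ext h⟩

/-- The largest open subset of `W` whose preimage is contained in `U`. -/
def largestOpen (U : Z.Opens) : W.Opens := sSup {V | j ⁻¹ᵁ V ≤ U}

lemma preimage_largestOpen [IsClosedImmersion j] (U : Z.Opens) : j ⁻¹ᵁ (largestOpen j U) = U := by
  refine le_antisymm (fun z hz ↦ ?_) fun z hz ↦ ?_
  · obtain ⟨V, hV, hzV⟩ := TopologicalSpace.Opens.mem_sSup.mp hz
    exact hV hzV
  · obtain ⟨V, hV⟩ := exists_preimage_eq j U
    exact TopologicalSpace.Opens.mem_sSup.mpr ⟨V, hV.le, hV.ge hz⟩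

lemma largestOpen_mono {U U' : Z.Opens} (h : U ≤ U') : largestOpen j U ≤ largestOpen j U' :=
  sSup_le_sSup fun _ hV ↦ le_trans hV h

lemma pushforward_smul {M : Z.Modules} {V : W.Opens} (r : Γ(W, V))
    (s : Γ((Modules.pushforward j).obj M, V)) :
    r • s = (show Γ(M, j ⁻¹ᵁ V) from (j.app V r) • (show Γ(M, j ⁻¹ᵁ V) from s)) := rfl

lemma pushforward_faithful [IsClosedImmersion j] {M N : Z.Modules} {φ ψ : M ⟶ N}
    (h : (Modules.pushforward j).map φ = (Modules.pushforward j).map ψ) : φ = ψ := by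
  ext U s
  obtain ⟨V, rfl⟩ := exists_preimage_eq j U
  exact congr(Modules.Hom.app $h V s)

/-- Every open of `Z` is the trace of an open of `W`, and `largestOpen` chooses one monotonically,
so a map of pushforwards can be read on the opens of `Z`. -/
lemma pushforward_full [IsClosedImmersion j] {M N : Z.Modules}
    (χ : (Modules.pushforward j).obj M ⟶ (Modules.pushforward j).obj N) :
    ∃ ψ : M ⟶ N, (Modules.pushforward j).map ψ = χ := by
  let F (U : Z.Opens) (s : Γ(M, U)) : Γ(N, U) :=
    N.presheaf.map (homOfLE (preimage_largestOpen j U).ge).op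
      (show Γ(N, j ⁻¹ᵁ (largestOpen j U)) from χ.app (largestOpen j U)
        (M.presheaf.map (homOfLE (preimage_largestOpen j U).le).op s))
  have F_res {U U' : Z.Opens} (h : U' ≤ U) (s : Γ(M, U)) :
      F U' (M.presheaf.map (homOfLE h).op s) = N.presheaf.map (homOfLE h).op (F U s) := by
    have h1 := Modules.app_map χ (largestOpen_mono j h)
      (M.presheaf.map (homOfLE (preimage_largestOpen j U).le).op s)
    have h2 := congr(N.presheaf.map (homOfLE (preimage_largestOpen j U').ge).op $h1)
    refine Eq.trans ?_ (h2.trans ?_)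
    · refine congr(N.presheaf.map (homOfLE (preimage_largestOpen j U').ge).op
        (χ.app (largestOpen j U') $(?_)))
      exact (Modules.map_map _ _ _).trans (Modules.map_map _ _ _).symm
    · exact (Modules.map_map _ _ _).trans (Modules.map_map _ _ _).symm
  have F_eq (V : W.Opens) (s : Γ(M, j ⁻¹ᵁ V)) : F (j ⁻¹ᵁ V) s = χ.app V s := by
    have hV : V ≤ largestOpen j (j ⁻¹ᵁ V) := le_sSup (show j ⁻¹ᵁ V ≤ _ from le_rfl)
    have h1 := Modules.app_map χ hV
      (M.presheaf.map (homOfLE (preimage_largestOpen j (j ⁻¹ᵁ V)).le).op s)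
    refine h1.symm.trans congr(χ.app V $(?_))
    exact (Modules.map_map (M := M) (preimage_largestOpen j (j ⁻¹ᵁ V)).le (j.preimage_mono hV)
      s).trans (Modules.map_self (M := M) s)
  -- So far only scalars from `W` are known to commute with `F`. On an affine open of `W` every
  -- function on `Z` is the restriction of one on `W`.
  have F_smul (U : Z.Opens) (r : Γ(Z, U)) (s : Γ(M, U)) : F U (r • s) = r • F U s := by
    refine Modules.section_ext fun z hz ↦ ?_
    obtain ⟨V, hV, hzV, hVa⟩ := isOpensBasis_isAffineOpen (largestOpen j U) (j z)
      ((preimage_largestOpen j U).ge hz)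
    have hVU : j ⁻¹ᵁ V ≤ U := (j.preimage_mono hV).trans (preimage_largestOpen j U).le
    refine ⟨j ⁻¹ᵁ V, hVU, hzV, ?_⟩
    obtain ⟨r', hr'⟩ := j.app_surjective V hVa (res hVU r)
    rw [Modules.map_smul', ← F_res, ← F_res, Modules.map_smul', ← hr', F_eq, F_eq]
    exact χ.app_smul r' _
  refine ⟨modulesHom (fun U ↦ { toFun := F U, map_add' := fun s t ↦ ?_, map_smul' := F_smul U })
    F_res, ?_⟩
  · have h1 := map_add (M.presheaf.map (homOfLE (preimage_largestOpen j U).le).op).hom s t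
    have h2 := map_add (χ.app (largestOpen j U)).hom
      (M.presheaf.map (homOfLE (preimage_largestOpen j U).le).op s)
      (M.presheaf.map (homOfLE (preimage_largestOpen j U).le).op t)
    have h3 := congr(χ.app (largestOpen j U) $h1).trans h2
    exact congr(N.presheaf.map (homOfLE (preimage_largestOpen j U).ge).op $h3).trans
      (map_add (N.presheaf.map (homOfLE (preimage_largestOpen j U).ge).op).hom _ _)
  · ext V s
    exact F_eq V s

end ClosedImmersion
end SemiSmooth



namespace SemiSmooth

/-! ### The tangent sheaf along a closed immersion -/

section TangentClosedImmersion

variable {K : Type u} [Field K] {W Z : Scheme.{u}} {p : W ⟶ Spec (.of K)} {j : Z ⟶ W}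

open DerivationAlong

lemma le_id_preimage (V : Z.Opens) : V ≤ 𝟙 Z ⁻¹ᵁ V := le_rfl

lemma comorph_id_self (V : Z.Opens) : comorph (𝟙 Z) (le_id_preimage V) = RingHom.id _ :=
  RingHom.ext fun a ↦ by rw [comorph_id, res_self]; rfl

/-- The derivation of `Γ(W, V)` given by a section of the tangent sheaf on `V`. -/
noncomputable abbrev evalSelf {V : W.Opens} (D : DerivationAlong p (𝟙 W) V) : Γ(W, V) →+ Γ(W, V) :=
  D.eval (le_id_preimage V)

lemma isDer_evalSelf {V : W.Opens} (D : DerivationAlong p (𝟙 W) V) :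
    IsDer (kmap p V) (RingHom.id _) (evalSelf D) := by
  rw [← comorph_id_self]; exact D.isDer_eval _

lemma exists_evalSelf_eq {V : W.Opens} (hV : IsAffineOpen V) {d : Γ(W, V) →+ Γ(W, V)}
    (hd : IsDer (kmap p V) (RingHom.id _) d) :
    ∃ D : DerivationAlong p (𝟙 W) V, evalSelf D = d := by
  rw [← comorph_id_self] at hd; exact exists_eval_eq hV (le_id_preimage V) hd

lemma ext_evalSelf {V : W.Opens} (hV : IsAffineOpen V) {D E : DerivationAlong p (𝟙 W) V}
    (h : ∀ a, evalSelf D a = evalSelf E a) : D = E :=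
  ext_of_isAffineOpen hV (le_id_preimage V) h

lemma eval_postcompSection {V : W.Opens} (D : DerivationAlong p (𝟙 W) V) (a : Γ(W, V)) :
    (postcompSection p j V D).eval (le_refl _) a = comorph j (le_refl _) (evalSelf D a) := by
  rw [eval_apply, eval_apply, comorph_res]
  exact res_comorph _ _ _ _

lemma eval_add {U : W.Opens} {V : Z.Opens} (hV : V ≤ j ⁻¹ᵁ U) (D E : DerivationAlong p j V) :
    (D + E).eval hV = D.eval hV + E.eval hV := by
  ext a; simp [eval_apply]

lemma eval_zero {U : W.Opens} {V : Z.Opens} (hV : V ≤ j ⁻¹ᵁ U) :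
    (0 : DerivationAlong p j V).eval hV = 0 := by
  ext a; simp [eval_apply]

lemma eval_smul {U : W.Opens} {V : Z.Opens} (hV : V ≤ j ⁻¹ᵁ U) (r : Γ(Z, V))
    (D : DerivationAlong p j V) (a : Γ(W, U)) :
    (r • D).eval hV a = r * D.eval hV a := by
  simp [eval_apply]

lemma eval_sum {U : W.Opens} {V : Z.Opens} (hV : V ≤ j ⁻¹ᵁ U) {n : ℕ}
    (D : Fin n → DerivationAlong p j V) (a : Γ(W, U)) :
    (∑ i, D i).eval hV a = ∑ i, (D i).eval hV a := by
  let F : DerivationAlong p j V →+ Γ(Z, V) :=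
    AddMonoidHom.mk' (fun D ↦ D.eval hV a) fun D E ↦ congr($(eval_add hV D E) a)
  exact map_sum F D Finset.univ

lemma comorph_self_eq_app (V : W.Opens) (a : Γ(W, V)) :
    comorph j (le_refl (j ⁻¹ᵁ V)) a = j.app V a := by
  simp [comorph, Scheme.Hom.appLE]



lemma postcomp_app_surjective [IsClosedImmersion j] {V : W.Opens} (hV : IsAffineOpen V)
    (h : HasProjectiveDifferentials (kmap p V)) : Function.Surjective ((postcomp p j).app V) := by
  intro (δ : DerivationAlong p j (j ⁻¹ᵁ V))
  obtain ⟨d, hd, hdδ⟩ := h.exists_lift (φ := comorph j (le_refl (j ⁻¹ᵁ V)))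
    (fun b ↦ by
      obtain ⟨a, ha⟩ := j.app_surjective V hV b
      exact ⟨a, by rw [comorph_self_eq_app]; exact ha⟩) (δ.isDer_eval le_rfl)
  obtain ⟨D, rfl⟩ := exists_evalSelf_eq hV hd
  refine ⟨D, ?_⟩
  change postcompSection p j V D = δ
  exact ext_of_isAffineOpen hV le_rfl fun a ↦ (eval_postcompSection D a).trans (hdδ a)

/-- A derivation with values in the ideal of `Z` is a combination of derivations with coefficients
in that ideal: the kernel of restriction to `Z` is no larger than what pulling back to `Z` must
kill. -/
lemma exists_eq_sum_of_postcomp_app_eq_zero {V : W.Opens} (hV : IsAffineOpen V)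
    (h : HasProjectiveDifferentials (kmap p V)) (D : Γ(tangentSheaf p, V))
    (hD : (postcomp p j).app V D = 0) :
    ∃ (n : ℕ) (c : Fin n → Γ(W, V)) (E : Fin n → Γ(tangentSheaf p, V)),
      (∀ i, j.app V (c i) = 0) ∧ D = ∑ i, c i • E i := by
  let D' : DerivationAlong p (𝟙 W) V := D
  have hD' : postcompSection p j V D' = 0 := hD
  obtain ⟨n, c, e, hc, he, hsum⟩ := h.exists_eq_sum (J := RingHom.ker (j.app V).hom)
    (isDer_evalSelf D') fun a ↦ by
      have h1 := eval_postcompSection (j := j) D' a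
      rw [hD', eval_zero, comorph_self_eq_app] at h1
      exact h1.symm
  choose E hE using fun i ↦ exists_evalSelf_eq hV (he i)
  refine ⟨n, c, E, hc, ?_⟩
  change D' = ∑ i, c i • E i
  refine ext_evalSelf hV fun a ↦ ?_
  rw [hsum, evalSelf, eval_sum]
  refine Finset.sum_congr rfl fun i _ ↦ ?_
  rw [eval_smul, ← hE]

/-- By Yoneda and adjunction, maps from j^* T to N are maps from T to j_* N. These kill sections
with coefficients in the ideal of `Z`, hence factor through the epi `postcomp p j`. Since j_* is
fully faithful, the factorization is a map out of the sheaf of derivations. -/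
lemma isIso_pullbackTangent [IsClosedImmersion j] {𝔅 : W.Opens → Prop} (h𝔅 : IsOpensBasis 𝔅)
    (h : ∀ V, 𝔅 V → IsAffineOpen V ∧ HasProjectiveDifferentials (kmap p V)) :
    IsIso (pullbackTangent p j) := by
  have hepi : Epi (postcomp p j) := Modules.epi_of_surjective h𝔅 fun V hV ↦
    postcomp_app_surjective (h V hV).1 (h V hV).2
  let adj := Modules.pullbackPushforwardAdjunction j
  have key {N : Z.Modules} (ψ : derivationSheaf p j ⟶ N) :
      adj.homEquiv _ _ (pullbackTangent p j ≫ ψ) =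
        postcomp p j ≫ (Modules.pushforward j).map ψ := by
    rw [Adjunction.homEquiv_naturality_right, pullbackTangent, Equiv.apply_symm_apply]
  refine isIso_of_coyoneda_map_bijective _ fun N ↦ ⟨fun ψ ψ' hψ ↦ ?_, fun φ ↦ ?_⟩
  · have h1 := congr(adj.homEquiv _ _ $hψ)
    rw [key, key, cancel_epi] at h1
    exact pushforward_faithful j h1
  · obtain ⟨χ, hχ⟩ := Modules.exists_desc h𝔅 (postcomp p j) (adj.homEquiv _ _ φ) fun V hV D hD ↦ by
      obtain ⟨n, c, E, hc, rfl⟩ :=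
        exists_eq_sum_of_postcomp_app_eq_zero (h V hV).1 (h V hV).2 D hD
      rw [map_sum]
      refine Finset.sum_eq_zero fun i _ ↦ ?_
      rw [Modules.Hom.app_smul, pushforward_smul, hc, zero_smul]
      rfl
    obtain ⟨ψ, rfl⟩ := pushforward_full j χ
    exact ⟨ψ, (adj.homEquiv _ _).injective ((key ψ).trans hχ)⟩

end TangentClosedImmersion
end SemiSmooth



namespace SemiSmooth

/-! ### Composition of derivations with comorphisms, on sections -/

section EvalFormulas

variable {K : Type u} [Field K] {W Z : Scheme.{u}} {p : W ⟶ Spec (.of K)} {k : Z ⟶ W}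

open DerivationAlong

lemma eval_precompSection {q : Z ⟶ Spec (.of K)} {hq : k ≫ p = q} {U : W.Opens} {V : Z.Opens}
    (hV : V ≤ k ⁻¹ᵁ U) (D : DerivationAlong q (𝟙 Z) V) (a : Γ(W, U)) :
    (precompSection p k q hq V D).eval hV a = evalSelf D (comorph k hV a) := by
  have h1 := D.map_res hV (comorph k le_rfl a)
  rw [res_comorph] at h1
  rw [eval_apply, evalSelf, eval_apply, h1, res_res]
  exact res_res _ _ _

lemma eval_restrict {U : W.Opens} {V V' : Z.Opens} (hV : V ≤ k ⁻¹ᵁ U) (hV' : V' ≤ V)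
    (D : DerivationAlong p k V) (a : Γ(W, U)) :
    (restrict hV' D).eval (hV'.trans hV) a = res hV' (D.eval hV a) := by
  rw [eval_apply, eval_apply, restrict_toFun, res_res, res_res]

/-- Functions on `W` surject locally onto functions on `Z`, so a derivation of `Z` is determined by
its values on them. This gives injectivity of the tangent map of Ȳ ⟶ X̄. -/
lemma precomp_mono_of_isClosedImmersion {q : Z ⟶ Spec (.of K)} (hq : k ≫ p = q)
    [IsClosedImmersion k] : Mono (precomp p k q hq) := by
  refine Modules.mono_of_injective (𝔅 := fun U ↦ ∃ V, IsAffineOpen V ∧ k ⁻¹ᵁ V = U) ?_ ?_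
  · intro U x hx
    obtain ⟨V, rfl⟩ := exists_preimage_eq k U
    obtain ⟨V', hV', hx', ha⟩ := isOpensBasis_isAffineOpen V (k x) hx
    exact ⟨k ⁻¹ᵁ V', k.preimage_mono hV', hx', V', ha, rfl⟩
  · rintro _ ⟨V, hV, rfl⟩ (D : DerivationAlong q (𝟙 Z) _) (E : DerivationAlong q (𝟙 Z) _)
      (hDE : precompSection p k q hq _ D = precompSection p k q hq _ E)
    refine ext_evalSelf (hV.preimage k) fun b ↦ ?_
    obtain ⟨a, rfl⟩ := k.app_surjective V hV b
    rw [← comorph_self_eq_app, ← eval_precompSection (hq := hq), hDE, eval_precompSection]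

end EvalFormulas

lemma comorph_congr {W Z : Scheme.{u}} {h h' : Z ⟶ W} (e : h = h') {U : W.Opens} {V : Z.Opens}
    (hV : V ≤ h ⁻¹ᵁ U) (hV' : V ≤ h' ⁻¹ᵁ U) (a : Γ(W, U)) : comorph h hV a = comorph h' hV' a := by
  subst e; rfl

lemma comorph_app_of_square {A B C D : Scheme.{u}} {a : A ⟶ B} {b : B ⟶ D} {c : A ⟶ C}
    {d : C ⟶ D} (h : a ≫ b = c ≫ d) {V : D.Opens} (hV : c ⁻¹ᵁ d ⁻¹ᵁ V ≤ a ⁻¹ᵁ b ⁻¹ᵁ V)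
    (s : Γ(D, V)) : comorph a hV (b.app V s) = c.app (d ⁻¹ᵁ V) (d.app V s) := by
  rw [← comorph_self_eq_app, ← comorph_self_eq_app, ← comorph_self_eq_app, comorph_comp,
    comorph_comp]
  exact comorph_congr h _ _ _

/-! ### The conductor square on affine opens -/

section ConductorSquare

variable {X Xb : Scheme.{u}} (f : Xb ⟶ X) [IsFinite f]

lemma isPullback_conductor :
    IsPullback (conductorBarι f) (conductorMap f) f (conductorι f) :=
  isPullback_of_isClosedImmersion _ _ _ _ (conductor_square f)
    (by rw [IdealSheafData.ker_subschemeι, IdealSheafData.ker_subschemeι])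

lemma conductorMap_preimage_le (V : X.Opens) :
    conductorMap f ⁻¹ᵁ conductorι f ⁻¹ᵁ V ≤ conductorBarι f ⁻¹ᵁ f ⁻¹ᵁ V := by
  rw [← Scheme.Hom.comp_preimage, ← Scheme.Hom.comp_preimage, conductor_square]

lemma le_conductorMap_preimage (V : X.Opens) :
    conductorBarι f ⁻¹ᵁ f ⁻¹ᵁ V ≤ conductorMap f ⁻¹ᵁ conductorι f ⁻¹ᵁ V := by
  rw [← Scheme.Hom.comp_preimage, ← Scheme.Hom.comp_preimage, conductor_square]

instance : IsAffineHom (conductorMap f) :=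
  MorphismProperty.of_isPullback (P := @IsAffineHom) (isPullback_conductor f) inferInstance

/-- The restriction of functions on `f⁻¹(V)` to `Ȳ`. -/
noncomputable def barRes (V : X.Opens) :
    Γ(Xb, f ⁻¹ᵁ V) →+* Γ(conductorSchemeBar f, conductorMap f ⁻¹ᵁ conductorι f ⁻¹ᵁ V) :=
  comorph (conductorBarι f) (conductorMap_preimage_le f V)

variable {f} {V : X.Opens}

lemma barRes_surjective (hV : IsAffineOpen V) : Function.Surjective (barRes f V) := by
  intro b
  obtain ⟨a, ha⟩ := (conductorBarι f).app_surjective (f ⁻¹ᵁ V) (hV.preimage f)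
    (res (le_conductorMap_preimage f V) b)
  refine ⟨a, ?_⟩
  rw [← comorph_self_eq_app] at ha
  have h1 := congr(res (conductorMap_preimage_le f V) $ha)
  rwa [res_res, res_self, res_comorph] at h1

lemma conductorι_app_eq_zero_iff (hV : IsAffineOpen V) (a : Γ(X, V)) :
    (conductorι f).app V a = 0 ↔ a ∈ ringConductor (f.app V).hom := by
  have := (conductor f).ker_subschemeι_app ⟨V, hV⟩
  exact congr(a ∈ $this).to_iff

/-- Ȳ is the fibre product of X̄ and Y over X, so over V its ring is a pushout and the functions
vanishing on it form the ideal IB generated by the conductor I. The conductor is stable under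
multiplication by B, so IB consists of images of elements of I. -/
lemma exists_mem_ringConductor_of_barRes_eq_zero (hV : IsAffineOpen V) {b : Γ(Xb, f ⁻¹ᵁ V)} (hb : barRes f V b = 0) :
    ∃ c ∈ ringConductor (f.app V).hom, f.app V c = b := by
  have hpo := (isIso_pushoutSection_iff (isPullback_conductor f) (US := V) (UX := f ⁻¹ᵁ V)
    (UT := conductorι f ⁻¹ᵁ V) le_rfl le_rfl
    (UY := conductorMap f ⁻¹ᵁ conductorι f ⁻¹ᵁ V)
    (le_antisymm (le_inf (conductorMap_preimage_le f V) le_rfl) inf_le_right)).mp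
    (isIso_pushoutSection_of_isAffineOpen _ _ _ _ hV (hV.preimage _) (hV.preimage _))
  let J : Ideal Γ(Xb, f ⁻¹ᵁ V) := (ringConductor (f.app V).hom).map (f.app V).hom
  -- Functions on Y act on B/J because J contains the image of the conductor. With B → B/J this
  -- gives a map out of the pushout, so anything that dies on Ȳ lies in J.
  let q : Γ(conductorScheme f, conductorι f ⁻¹ᵁ V) →+* Γ(Xb, f ⁻¹ᵁ V) ⧸ J :=
    RingHom.liftOfRightInverse ((conductorι f).app V).hom
      (Function.surjInv ((conductorι f).app_surjective V hV)) (Function.rightInverse_surjInv _)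
      ⟨(Ideal.Quotient.mk J).comp (f.app V).hom, fun a ha ↦ by
        rw [RingHom.mem_ker] at ha ⊢
        exact Ideal.Quotient.eq_zero_iff_mem.mpr
          (Ideal.mem_map_of_mem _ ((conductorι_app_eq_zero_iff hV a).mp ha))⟩
  have hq (a : Γ(X, V)) : q ((conductorι f).app V a) = Ideal.Quotient.mk J (f.app V a) :=
    RingHom.liftOfRightInverse_comp_apply _ _ _ _ a
  have w : f.appLE V (f ⁻¹ᵁ V) le_rfl ≫ CommRingCat.ofHom (Ideal.Quotient.mk J) =
      (conductorι f).appLE V _ le_rfl ≫ CommRingCat.ofHom q := by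
    ext a
    simp only [Scheme.Hom.appLE, homOfLE_refl, op_id, CategoryTheory.Functor.map_id,
      Category.comp_id]
    exact (hq a).symm
  have h1 : hpo.desc (CommRingCat.ofHom (Ideal.Quotient.mk J)) (CommRingCat.ofHom q) w
      (barRes f V b) = Ideal.Quotient.mk J b :=
    congr($(hpo.inl_desc (CommRingCat.ofHom (Ideal.Quotient.mk J)) (CommRingCat.ofHom q) w) b)
  rw [hb, map_zero] at h1
  have h2 : b ∈ J := Ideal.Quotient.eq_zero_iff_mem.mp h1.symm
  refine Submodule.span_induction (p := fun b _ ↦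
    ∃ c ∈ ringConductor (f.app V).hom, f.app V c = b) ?_ ?_ ?_ ?_ h2
  · rintro _ ⟨c, hc, rfl⟩
    exact ⟨c, hc, rfl⟩
  · exact ⟨0, Ideal.zero_mem _, map_zero _⟩
  · rintro _ _ _ _ ⟨c, hc, rfl⟩ ⟨c', hc', rfl⟩
    exact ⟨c + c', Ideal.add_mem _ hc hc', map_add _ _ _⟩
  · rintro b _ _ ⟨c, hc, rfl⟩
    obtain ⟨c', hc'⟩ := hc b
    refine ⟨c', fun b' ↦ ?_, by rw [smul_eq_mul, mul_comm]; exact hc'⟩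
    rw [hc', mul_assoc]
    exact hc _

end ConductorSquare
end SemiSmooth



namespace SemiSmooth

/-! ### The exact sequence from local data -/

section Sections

/-- Taking sections over `U` preserves limits. The subgroup on which `a` and `b` agree is therefore
a cone that factors through the sections of the equalizer. -/
lemma Modules.exists_equalizer_section {Z : Scheme.{u}} {M N : Z.Modules} (a b : M ⟶ N)
    (U : Z.Opens) (s : Γ(M, U)) (h : a.app U s = b.app U s) :
    ∃ t : Γ(equalizer a b, U), (equalizer.ι a b).app U t = s := by
  let F := Modules.toPresheaf Z ⋙ (CategoryTheory.evaluation _ _).obj (.op U)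
  let H := AddMonoidHom.eqLocus (a.app U).hom (b.app U).hom
  have : PreservesLimit (parallelPair a b) F := by
    have : PreservesLimit (parallelPair a b ⋙ Modules.toPresheaf Z)
      ((CategoryTheory.evaluation _ _).obj (.op U)) :=
      (evaluation_preservesLimitsOfShape (Opposite.op U)).preservesLimit
    exact comp_preservesLimit _ _
  let ℓ := Fork.IsLimit.lift (isLimitOfHasEqualizerOfPreservesLimit F a b)
    (AddCommGrpCat.ofHom H.subtype) (by ext x; exact x.2)
  have hℓ : ℓ ≫ F.map (equalizer.ι a b) = AddCommGrpCat.ofHom H.subtype :=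
    Fork.IsLimit.lift_ι _
  exact ⟨ℓ ⟨s, h⟩, congr($hℓ ⟨s, h⟩)⟩

lemma Modules.isIso_restrictFunctor_map_of_surjective {Z : Scheme.{u}} {M N : Z.Modules}
    {φ : M ⟶ N} [Mono φ] {U : Z.Opens}
    (h : ∀ V ≤ U, IsAffineOpen V → Function.Surjective (φ.app V)) :
    IsIso ((Modules.restrictFunctor U.ι).map φ) := by
  have hm : Mono ((Modules.restrictFunctor U.ι).map φ) :=
    Modules.mono_of_injective (𝔅 := fun _ ↦ True) (fun V x hx ↦ ⟨V, le_rfl, hx, trivial⟩)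
      fun V _ ↦ Modules.injective_of_mono φ (U.ι ''ᵁ V)
  exact Modules.isIso_of_surjective isOpensBasis_isAffineOpen fun V hV ↦
    h (U.ι ''ᵁ V) (by simpa using U.ι_image_le V) (hV.image_of_isOpenImmersion _)

lemma pushforwardSquare_hom_app_app {A B C D : Scheme.{u}} {a : A ⟶ B} {b : B ⟶ D} {c : A ⟶ C}
    {d : C ⟶ D} (h : a ≫ b = c ≫ d) (M : A.Modules) (V : D.Opens)
    (hV : c ⁻¹ᵁ d ⁻¹ᵁ V ≤ a ⁻¹ᵁ b ⁻¹ᵁ V) :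
    ((pushforwardSquare h).hom.app M).app V = M.presheaf.map (homOfLE hV).op := by
  simp [pushforwardSquare]
  rfl

/-- A derivation that preserves the kernel of a surjection induces one on the quotient. The section
`σ` chosen below is only a map of sets; `h'` makes the result independent of it. -/
lemma IsDer.exists_descend {K B S : Type*} [CommRing K] [CommRing B] [CommRing S] {κ : K →+* B}
    {D : B →+ B} (hD : IsDer κ (RingHom.id B) D) {φ : B →+* S} (hφ : Function.Surjective φ)
    (h : ∀ b, φ b = 0 → φ (D b) = 0) :
    ∃ e : S →+ S, IsDer (φ.comp κ) (RingHom.id S) e ∧ ∀ b, e (φ b) = φ (D b) := by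
  have h' (b b' : B) (hb : φ b = φ b') : φ (D b) = φ (D b') := by
    rw [← sub_eq_zero, ← map_sub, ← map_sub]
    exact h _ (by rw [map_sub, hb, sub_self])
  choose σ hσ using hφ
  have key (b : B) : φ (D (σ (φ b))) = φ (D b) := h' _ _ (hσ _)
  refine ⟨AddMonoidHom.mk' (fun s ↦ φ (D (σ s))) fun s t ↦ ?_, ⟨fun s t ↦ ?_, fun c ↦ ?_⟩, key⟩
  · rw [← map_add, ← map_add]
    exact h' _ _ (by simp only [map_add, hσ])
  · have : φ (D (σ (s * t))) = φ (D (σ s * σ t)) := h' _ _ (by simp only [map_mul, hσ])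
    simp only [AddMonoidHom.mk'_apply, this, hD.leibniz, map_add, map_mul, RingHom.id_apply, hσ]
  · simp only [AddMonoidHom.mk'_apply, RingHom.comp_apply, key, hD.map_const, map_zero]

end Sections

open DerivationAlong

variable {K : Type u} [Field K] {X Xb Y Yb : Scheme.{u}} (p : X ⟶ Spec (.of K)) (f : Xb ⟶ X)
  (j : Yb ⟶ Xb) (k : Y ⟶ X) (g : Yb ⟶ Y)

/-- Derivations on affine opens of `X` lift uniquely along `f`. -/
structure LiftsDerivations : Prop where
  injective {V : X.Opens} (hV : IsAffineOpen V) : Function.Injective (f.app V)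
  exists_extend {V : X.Opens} (hV : IsAffineOpen V) {d : Γ(X, V) →+ Γ(X, V)}
    (hd : IsDer (kmap p V) (RingHom.id _) d) :
    ∃ d' : Γ(Xb, f ⁻¹ᵁ V) →+ Γ(Xb, f ⁻¹ᵁ V), IsDer (kmap (f ≫ p) (f ⁻¹ᵁ V)) (RingHom.id _) d' ∧
      ∀ a, d' (f.app V a) = f.app V (d a)
  eq_zero {V : X.Opens} (hV : IsAffineOpen V) {d : Γ(Xb, f ⁻¹ᵁ V) →+ Γ(Xb, f ⁻¹ᵁ V)}
    (hd : IsDer (kmap (f ≫ p) (f ⁻¹ᵁ V)) (RingHom.id _) d) (h : ∀ a, d (f.app V a) = 0) (b) :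
    d b = 0

namespace LiftsDerivations

variable {p f} (H : LiftsDerivations p f)

include H in
lemma ext_evalSelf [IsAffineHom f] {V : X.Opens} (hV : IsAffineOpen V)
    {D E : DerivationAlong (f ≫ p) (𝟙 Xb) (f ⁻¹ᵁ V)}
    (h : ∀ a, evalSelf D (f.app V a) = evalSelf E (f.app V a)) : D = E := by
  refine SemiSmooth.ext_evalSelf (hV.preimage f) fun b ↦ ?_
  rw [← sub_eq_zero]
  exact H.eq_zero hV ((isDer_evalSelf D).sub (isDer_evalSelf E)) (fun a ↦ sub_eq_zero.mpr (h a)) b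

lemma eval_pushforward_precomp (V : X.Opens)
    (D : DerivationAlong (f ≫ p) (𝟙 Xb) (f ⁻¹ᵁ V)) (a : Γ(X, V)) :
    (show DerivationAlong p f (f ⁻¹ᵁ V) from
      ((Modules.pushforward f).map (precomp p f (f ≫ p) rfl)).app V D).eval (le_refl _) a =
      evalSelf D (f.app V a) := by
  rw [← comorph_self_eq_app]
  exact eval_precompSection (hq := rfl) (le_refl _) D a

lemma eval_postcomp_app (V : X.Opens) (D : DerivationAlong p (𝟙 X) V) (a : Γ(X, V)) :
    (show DerivationAlong p f (f ⁻¹ᵁ V) from (postcomp p f).app V D).eval (le_refl _) a =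
      f.app V (evalSelf D a) := by
  rw [← comorph_self_eq_app]
  exact eval_postcompSection D a

include H in
lemma mono_pushforward_precomp [IsAffineHom f] :
    Mono ((Modules.pushforward f).map (precomp p f (f ≫ p) rfl)) := by
  refine Modules.mono_of_injective isOpensBasis_isAffineOpen fun V hV D E hDE ↦ ?_
  refine H.ext_evalSelf hV (D := D) (E := E) fun a ↦ ?_
  refine (eval_pushforward_precomp V D a).symm.trans (Eq.trans ?_ (eval_pushforward_precomp V E a))
  exact congr(DerivationAlong.eval (p := p) (h := f) (le_refl _) $hDE a)

include H in
-- Uniqueness of extensions makes D ↦ D ∘ f^# a monomorphism on f_* T_X̄. It is then enough to lift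
-- f^# ∘ D on each affine open; compatibility with restriction is automatic.
lemma exists_isTangentLift [IsAffineHom f] : ∃ α, IsTangentLift p f α := by
  have := H.mono_pushforward_precomp
  refine Modules.exists_lift isOpensBasis_isAffineOpen _ _ fun V hV
    (D : DerivationAlong p (𝟙 X) V) ↦ ?_
  obtain ⟨d', hd', h⟩ := H.exists_extend hV (isDer_evalSelf D)
  obtain ⟨D', hD'⟩ := exists_evalSelf_eq (hV.preimage f) hd'
  refine ⟨D', ext_of_isAffineOpen hV (le_refl _) fun a ↦ ?_⟩
  exact (eval_pushforward_precomp V D' a).trans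
    ((by rw [hD', h] : _ = _).trans (eval_postcomp_app V D a).symm)

variable {α : tangentSheaf p ⟶ (Modules.pushforward f).obj (tangentSheaf (f ≫ p))}
  (hα : IsTangentLift p f α)

include hα

lemma evalSelf_app (V : X.Opens) (D : DerivationAlong p (𝟙 X) V) (a : Γ(X, V)) :
    evalSelf (show DerivationAlong (f ≫ p) (𝟙 Xb) (f ⁻¹ᵁ V) from α.app V D) (f.app V a) =
      f.app V (evalSelf D a) := by
  refine (eval_pushforward_precomp V _ a).symm.trans (Eq.trans ?_ (eval_postcomp_app V D a))
  exact congr(DerivationAlong.eval (p := p) (h := f) (le_refl _) (Modules.Hom.app $hα V D) a)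

include H

lemma eq_of_isTangentLift [IsAffineHom f]
    {α' : tangentSheaf p ⟶ (Modules.pushforward f).obj (tangentSheaf (f ≫ p))}
    (hα' : IsTangentLift p f α') : α' = α := by
  have := H.mono_pushforward_precomp
  exact (cancel_mono _).mp (Eq.trans hα' (Eq.symm hα))

lemma mono_of_isTangentLift [IsAffineHom f] : Mono α := by
  have : Mono (postcomp p f) := by
    refine Modules.mono_of_injective isOpensBasis_isAffineOpen fun V hV
      (D : DerivationAlong p (𝟙 X) V) (E : DerivationAlong p (𝟙 X) V) hDE ↦ ?_
    refine SemiSmooth.ext_evalSelf hV fun a ↦ H.injective hV ?_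
    refine (eval_postcomp_app V D a).symm.trans (Eq.trans ?_ (eval_postcomp_app V E a))
    exact congr(DerivationAlong.eval (p := p) (h := f) (le_refl _) $hDE a)
  have h2 : Mono (α ≫ (Modules.pushforward f).map (precomp p f (f ≫ p) rfl)) := by
    rw [show _ = _ from hα]; exact this
  exact mono_of_mono α ((Modules.pushforward f).map (precomp p f (f ≫ p) rfl))

/-- The image of `α` on an affine open consists of the derivations of B that map A into itself; such
a derivation restricts to A by injectivity of f^#. -/
lemma exists_app_eq [IsAffineHom f] {V : X.Opens} (hV : IsAffineOpen V)
    (E : DerivationAlong (f ≫ p) (𝟙 Xb) (f ⁻¹ᵁ V))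
    (hE : ∀ a, ∃ a', evalSelf E (f.app V a) = f.app V a') :
    ∃ D : DerivationAlong p (𝟙 X) V, α.app V D = E := by
  choose d hd using hE
  have hinj := H.injective hV
  have hdd : IsDer (kmap p V) (RingHom.id _) (AddMonoidHom.mk' d fun a b ↦ hinj (by
      rw [← hd, map_add, map_add, map_add, hd, hd])) := by
    refine ⟨fun a b ↦ hinj ?_, fun c ↦ hinj ?_⟩
    · simp only [AddMonoidHom.mk'_apply, ← hd, map_mul, map_add, (isDer_evalSelf E).leibniz,
        RingHom.id_apply]
    · simp only [AddMonoidHom.mk'_apply, ← hd, map_zero]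
      rw [← comorph_self_eq_app, comorph_kmap, (isDer_evalSelf E).map_const]
  obtain ⟨D, hD⟩ := exists_evalSelf_eq hV hdd
  refine ⟨D, H.ext_evalSelf hV (D := α.app V D) fun a ↦ ?_⟩
  rw [hd]
  exact (evalSelf_app hα V D a).trans (by rw [hD]; rfl)

/-- Where f^# is surjective, every derivation of B trivially maps the image of A into itself. -/
lemma isIso_restrictFunctor_map [IsAffineHom f] {U : X.Opens}
    (hU : ∀ V ≤ U, IsAffineOpen V → Function.Surjective (f.app V)) :
    IsIso ((Modules.restrictFunctor U.ι).map α) := by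
  have := H.mono_of_isTangentLift hα
  refine Modules.isIso_restrictFunctor_map_of_surjective fun V hVU hV E ↦ ?_
  refine H.exists_app_eq hα hV E fun a ↦ ?_
  obtain ⟨a', ha'⟩ := hU V hVU hV (evalSelf (p := f ≫ p) (W := Xb) (V := f ⁻¹ᵁ V) E (f.app V a))
  exact ⟨a', ha'.symm⟩

end LiftsDerivations
end SemiSmooth



/-! ### Restriction of derivations to Ȳ -/

namespace SemiSmooth

open DerivationAlong

lemma Modules.epi_pushforward_map {Z W : Scheme.{u}} (f : Z ⟶ W) {M N : Z.Modules} {φ : M ⟶ N}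
    (h : ∀ V : W.Opens, IsAffineOpen V → Function.Surjective (φ.app (f ⁻¹ᵁ V))) :
    Epi ((Modules.pushforward f).map φ) :=
  Modules.epi_of_surjective isOpensBasis_isAffineOpen h

variable {K : Type u} [Field K] {X Xb Y Yb : Scheme.{u}} (p : X ⟶ Spec (.of K)) (f : Xb ⟶ X)
  (j : Yb ⟶ Xb) (k : Y ⟶ X) (g : Yb ⟶ Y)

/-- The properties, on affine opens of `X`, of the conductor square of the normalization of a
semi-smooth variety. -/
structure IsConductorSquare : Prop extends LiftsDerivations p f where
  comm : j ≫ f = g ≫ k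
  preimage_le (V : X.Opens) : g ⁻¹ᵁ k ⁻¹ᵁ V ≤ j ⁻¹ᵁ f ⁻¹ᵁ V
  projective {V : X.Opens} (hV : IsAffineOpen V) :
    HasProjectiveDifferentials (kmap (f ≫ p) (f ⁻¹ᵁ V))
  app_eq_zero {V : X.Opens} (hV : IsAffineOpen V) {c : Γ(X, V)}
    (hc : c ∈ ringConductor (f.app V).hom) : k.app V c = 0
  exists_app_eq {V : X.Opens} (hV : IsAffineOpen V) {b : Γ(Xb, f ⁻¹ᵁ V)}
    (hb : comorph j (preimage_le V) b = 0) : ∃ c ∈ ringConductor (f.app V).hom, f.app V c = b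
  comorph_surjective {V : X.Opens} (hV : IsAffineOpen V) :
    Function.Surjective (comorph j (preimage_le V))
  eq_zero_of_app_app {V : X.Opens} (hV : IsAffineOpen V)
    {e : Γ(Yb, g ⁻¹ᵁ k ⁻¹ᵁ V) →+ Γ(Yb, g ⁻¹ᵁ k ⁻¹ᵁ V)}
    (he : IsDer (kmap (g ≫ k ≫ p) _) (RingHom.id _) e)
    (h : ∀ a, e (g.app (k ⁻¹ᵁ V) (k.app V a)) = 0) (b) : e b = 0

namespace IsConductorSquare

variable {p f j k g} (H : IsConductorSquare p f j k g)
include H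

lemma comorph_app (V : X.Opens) (a : Γ(X, V)) :
    comorph j (H.preimage_le V) (f.app V a) = g.app (k ⁻¹ᵁ V) (k.app V a) :=
  comorph_app_of_square H.comm _ a

/-- Preimages of affine opens of X need not form a basis of X̄. Their basic opens do, and
projectivity of Ω survives localization. -/
lemma isOpensBasis_projective [IsAffineHom f] :
    IsOpensBasis fun W : Xb.Opens ↦
      IsAffineOpen W ∧ HasProjectiveDifferentials (kmap (f ≫ p) W) := by
  intro U x hx
  obtain ⟨V, -, hxV, hV⟩ := isOpensBasis_isAffineOpen ⊤ (f x) trivial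
  obtain ⟨s, hs, hxs⟩ := (hV.preimage f).exists_basicOpen_le ⟨x, hx⟩ hxV
  refine ⟨_, hs, hxs, (hV.preimage f).basicOpen s, ?_⟩
  rw [kmap_basicOpen]
  exact (H.projective hV).of_formallyEtale (formallyEtale_res_basicOpen (hV.preimage f) s)

lemma isIso_pullbackTangent [IsAffineHom f] [IsClosedImmersion j] :
    IsIso (pullbackTangent (f ≫ p) j) :=
  SemiSmooth.isIso_pullbackTangent H.isOpensBasis_projective fun _ h ↦ h

end IsConductorSquare

/-- The restriction map `f_* T_X̄ → g_* ((j^* Ω_X̄)^∨)`. -/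
noncomputable def restrictTangent (h : j ≫ f = g ≫ k) :
    (Modules.pushforward f).obj (tangentSheaf (f ≫ p)) ⟶
      (Modules.pushforward k).obj ((Modules.pushforward g).obj (derivationSheaf (f ≫ p) j)) :=
  (Modules.pushforward f).map (postcomp (f ≫ p) j) ≫ (pushforwardSquare h).hom.app _

/-- The restriction map of the theorem is built from the adjunction unit. Through `pullbackTangent`
it becomes the explicit D ↦ j^# ∘ D. -/
lemma unit_comp_eq (h : j ≫ f = g ≫ k) :
    ((Modules.pushforward f).map ((Modules.pullbackPushforwardAdjunction j).unit.app
      (tangentSheaf (f ≫ p))) ≫ (pushforwardSquare h).hom.app _) ≫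
        (Modules.pushforward k).map ((Modules.pushforward g).map (pullbackTangent (f ≫ p) j)) =
      restrictTangent p f j k g h := by
  have h1 : (Modules.pullbackPushforwardAdjunction j).unit.app (tangentSheaf (f ≫ p)) ≫
      (Modules.pushforward j).map (pullbackTangent (f ≫ p) j) = postcomp (f ≫ p) j := by
    refine ((Modules.pullbackPushforwardAdjunction j).homEquiv_unit _ _ _).symm.trans ?_
    exact Equiv.apply_symm_apply _ _
  have h2 := (pushforwardSquare h).hom.naturality (pullbackTangent (f ≫ p) j)
  dsimp only [Functor.comp_map] at h2
  rw [restrictTangent, ← h1, Functor.map_comp, Category.assoc, Category.assoc, ← h2]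

variable {p f j k g}

lemma eval_restrictTangent (h : j ≫ f = g ≫ k) {V : X.Opens}
    (hV : g ⁻¹ᵁ k ⁻¹ᵁ V ≤ j ⁻¹ᵁ f ⁻¹ᵁ V) (D : DerivationAlong (f ≫ p) (𝟙 Xb) (f ⁻¹ᵁ V))
    (b : Γ(Xb, f ⁻¹ᵁ V)) :
    DerivationAlong.eval (p := f ≫ p) (h := j) (V := g ⁻¹ᵁ k ⁻¹ᵁ V) hV
      ((restrictTangent p f j k g h).app V D) b = comorph j hV (evalSelf D b) := by
  have h1 : (restrictTangent p f j k g h).app V D =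
      restrict hV (postcompSection (f ≫ p) j _ D) := by
    exact congr($(pushforwardSquare_hom_app_app h _ V hV) (postcompSection (f ≫ p) j _ D))
  rw [h1, eval_restrict (le_refl _) hV, eval_postcompSection]
  exact res_comorph _ _ _ _


namespace IsConductorSquare

variable (H : IsConductorSquare p f j k g)
  {α : tangentSheaf p ⟶ (Modules.pushforward f).obj (tangentSheaf (f ≫ p))}

include H

section

variable [IsAffineHom f]

lemma epi_restrictTangent [IsClosedImmersion j] : Epi (restrictTangent p f j k g H.comm) := by
  have h1 : Epi ((Modules.pushforward f).map (postcomp (f ≫ p) j)) :=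
    Modules.epi_pushforward_map f fun V hV ↦ postcomp_app_surjective (hV.preimage f) (H.projective hV)
  exact epi_comp _ _

lemma restrictTangent_app_ext {V : X.Opens} (hV : IsAffineOpen V)
    {s t : Γ((Modules.pushforward k).obj ((Modules.pushforward g).obj (derivationSheaf (f ≫ p) j)),
      V)}
    (h : ∀ b, DerivationAlong.eval (p := f ≫ p) (h := j) (V := g ⁻¹ᵁ k ⁻¹ᵁ V) (H.preimage_le V) s b =
      DerivationAlong.eval (p := f ≫ p) (h := j) (V := g ⁻¹ᵁ k ⁻¹ᵁ V) (H.preimage_le V) t b) :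
    s = t :=
  ext_of_isAffineOpen (hV.preimage f) (H.preimage_le V) h

/-- Functions on X̄ vanishing on Ȳ already come from X. Hence a derivation that preserves A modulo
the conductor preserves A. -/
lemma exists_app_eq_of_comorph_eq (hα : IsTangentLift p f α) {V : X.Opens} (hV : IsAffineOpen V)
    (E : DerivationAlong (f ≫ p) (𝟙 Xb) (f ⁻¹ᵁ V))
    (hE : ∀ a, ∃ a', comorph j (H.preimage_le V) (evalSelf E (f.app V a)) =
      comorph j (H.preimage_le V) (f.app V a')) :
    ∃ D : DerivationAlong p (𝟙 X) V, α.app V D = E := by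
  refine H.toLiftsDerivations.exists_app_eq hα hV E fun a ↦ ?_
  obtain ⟨a', ha'⟩ := hE a
  obtain ⟨c, -, hc⟩ := H.exists_app_eq hV (b := evalSelf E (f.app V a) - f.app V a')
    (by rw [map_sub, ha', sub_self])
  exact ⟨a' + c, by rw [map_add, hc]; abel⟩

/-- A derivation that restricts to zero on Ȳ preserves A modulo the conductor, with remainder 0, so
it lies in the image of `α` and dies in the cokernel. -/
lemma exists_restrictTangent_comp [IsClosedImmersion j] (hα : IsTangentLift p f α) :
    ∃ π, restrictTangent p f j k g H.comm ≫ π = cokernel.π α := by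
  have := H.epi_restrictTangent
  refine Modules.exists_desc isOpensBasis_isAffineOpen _ _ fun V hV
    (E : DerivationAlong (f ≫ p) (𝟙 Xb) (f ⁻¹ᵁ V)) hE ↦ ?_
  obtain ⟨D, rfl⟩ := H.exists_app_eq_of_comorph_eq hα hV E fun a ↦ ⟨0, by
    rw [← eval_restrictTangent H.comm, hE, map_zero, map_zero]
    exact congr($(eval_zero (p := f ≫ p) (j := j) (H.preimage_le V)) _)⟩
  exact congr(Modules.Hom.app $(cokernel.condition α) V D)

end

/-- The induced derivation preserves the ideal of `Ȳ`. -/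
lemma comorph_evalSelf_eq_zero [IsAffineHom f] (hα : IsTangentLift p f α) {V : X.Opens}
    (hV : IsAffineOpen V) (D : DerivationAlong p (𝟙 X) V) {b : Γ(Xb, f ⁻¹ᵁ V)}
    (hb : comorph j (H.preimage_le V) b = 0) :
    comorph j (H.preimage_le V)
      (evalSelf (p := f ≫ p) (W := Xb) (V := f ⁻¹ᵁ V) (α.app V D) b) = 0 := by
  obtain ⟨c, hc, rfl⟩ := H.exists_app_eq hV hb
  rw [LiftsDerivations.evalSelf_app hα, H.comorph_app, H.app_eq_zero hV, map_zero]
  -- It remains that D(c) is in the conductor: D(c)·b = D(cb) - c·D(b), where cb comes from A and is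
  -- sent into A by D, and c·D(b) is in A because c is in the conductor.
  intro b
  obtain ⟨a, ha⟩ := hc b
  obtain ⟨a', ha'⟩ := hc (evalSelf (p := f ≫ p) (W := Xb) (V := f ⁻¹ᵁ V) (α.app V D) b)
  have h1 := LiftsDerivations.evalSelf_app hα V D a
  have h2 := (isDer_evalSelf (p := f ≫ p) (W := Xb) (V := f ⁻¹ᵁ V) (α.app V D)).leibniz
    (f.app V c) b
  have h3 : f.app V (evalSelf D c) * b =
      f.app V (evalSelf D a) - f.app V a' := by
    rw [eq_sub_iff_add_eq, ← h1]
    refine Eq.trans ?_ (congrArg _ ha.symm)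
    refine Eq.trans ?_ h2.symm
    rw [LiftsDerivations.evalSelf_app hα, mul_comm _ b]
    exact (add_comm _ _).trans congr($ha' + _)
  exact ⟨evalSelf D a - a', by rw [map_sub]; exact h3.symm⟩

end IsConductorSquare

end SemiSmooth



namespace SemiSmooth

open DerivationAlong

/-! ### Invariance of derivations under the involution -/

section Invariant

variable {K : Type u} [Field K] {Y Yb : Scheme.{u}} {g : Yb ⟶ Y} {ι : Yb ⟶ Yb}

lemma le_preimage_of_comp_eq (hι : ι ≫ g = g) (U : Y.Opens) : g ⁻¹ᵁ U ≤ ι ⁻¹ᵁ g ⁻¹ᵁ U := by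
  rw [← Scheme.Hom.comp_preimage, hι]

lemma postcomp_comp_app (hι : ι ≫ g = g) (q : Yb ⟶ Spec (.of K)) (U : Y.Opens)
    (e : DerivationAlong q (𝟙 Yb) (g ⁻¹ᵁ U)) :
    ((Modules.pushforward g).map (postcomp q ι) ≫
      (Modules.pushforwardComp ι g).hom.app _ ≫ (Modules.pushforwardCongr hι).hom.app _).app U e =
      restrict (le_preimage_of_comp_eq hι U) (postcompSection q ι (g ⁻¹ᵁ U) e) := by
  have h1 : ((Modules.pushforwardComp ι g).hom.app (derivationSheaf q ι) ≫
      (Modules.pushforwardCongr hι).hom.app _).app U =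
        (derivationSheaf q ι).presheaf.map (homOfLE (le_preimage_of_comp_eq hι U)).op := by
    simp
    rfl
  exact congr($h1 (postcompSection q ι (g ⁻¹ᵁ U) e))

/-- The two arrows that define the invariant subsheaf become e ∘ σ and σ ∘ e on functions, where σ
is the comorphism of `ι`. -/
lemma app_eq_app_iff_commutes (hι : ι ≫ g = g) (s : Y ⟶ Spec (.of K)) {U : Y.Opens}
    (hU : IsAffineOpen (g ⁻¹ᵁ U)) (e : DerivationAlong (g ≫ s) (𝟙 Yb) (g ⁻¹ᵁ U)) :
    ((Modules.pushforward g).map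
        (precomp (g ≫ s) ι (g ≫ s) (by rw [← Category.assoc, hι]))).app U e =
      ((Modules.pushforward g).map (postcomp (g ≫ s) ι) ≫ (Modules.pushforwardComp ι g).hom.app _ ≫
        (Modules.pushforwardCongr hι).hom.app _).app U e ↔
    ∀ t, evalSelf e (comorph ι (le_preimage_of_comp_eq hι U) t) =
      comorph ι (le_preimage_of_comp_eq hι U) (evalSelf e t) := by
  rw [postcomp_comp_app]
  have h1 (t : Γ(Yb, g ⁻¹ᵁ U)) := eval_precompSection (p := g ≫ s) (q := g ≫ s)
    (hq := by rw [← Category.assoc, hι]) (le_preimage_of_comp_eq hι U) e t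
  have h2 (t : Γ(Yb, g ⁻¹ᵁ U)) : (restrict (le_preimage_of_comp_eq hι U)
      (postcompSection (g ≫ s) ι (g ⁻¹ᵁ U) e)).eval (le_preimage_of_comp_eq hι U) t =
      comorph ι (le_preimage_of_comp_eq hι U) (evalSelf e t) := by
    rw [eval_restrict (le_refl _), eval_postcompSection, res_comorph]
  constructor
  · intro h t
    rw [← h1, ← h2, ← h]
    rfl
  · intro h
    refine ext_of_isAffineOpen hU (le_preimage_of_comp_eq hι U) fun t ↦ ?_
    rw [h2, ← h, ← h1]
    rfl

end Invariant

/-! ### The image of α and the invariant derivations of Ȳ -/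

section MainSequence

variable {K : Type u} [Field K] {X Xb Y Yb : Scheme.{u}} {p : X ⟶ Spec (.of K)} {f : Xb ⟶ X}
  {j : Yb ⟶ Xb} {k : Y ⟶ X} {g : Yb ⟶ Y}

namespace IsConductorSquare

variable (H : IsConductorSquare p f j k g)
  {α : tangentSheaf p ⟶ (Modules.pushforward f).obj (tangentSheaf (f ≫ p))}
  (hα : IsTangentLift p f α) {ι : Yb ⟶ Yb} (hι : IsCoverInvolution g ι)

include H

lemma comm_over : j ≫ f ≫ p = g ≫ k ≫ p := by
  rw [← Category.assoc, H.comm, Category.assoc]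

lemma exists_unique_isTangentMap [IsAffineHom f] [IsClosedImmersion j] :
    ∃ τ, IsTangentMap (f ≫ p) j (g ≫ k ≫ p) H.comm_over τ ∧
      ∀ τ', IsTangentMap (f ≫ p) j (g ≫ k ≫ p) H.comm_over τ' → τ' = τ := by
  have := H.isIso_pullbackTangent
  refine ⟨precomp (f ≫ p) j (g ≫ k ≫ p) H.comm_over ≫ inv (pullbackTangent (f ≫ p) j),
    by rw [IsTangentMap, Category.assoc, IsIso.inv_hom_id, Category.comp_id], fun τ' h ↦ ?_⟩
  rw [← h, Category.assoc, IsIso.hom_inv_id, Category.comp_id]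

lemma evalSelf_app_app {V : X.Opens} (e : DerivationAlong (g ≫ k ≫ p) (𝟙 Yb) (g ⁻¹ᵁ k ⁻¹ᵁ V))
    (b : Γ(Xb, f ⁻¹ᵁ V)) :
    DerivationAlong.eval (p := f ≫ p) (h := j) (V := g ⁻¹ᵁ k ⁻¹ᵁ V) (H.preimage_le V)
      (((Modules.pushforward k).map ((Modules.pushforward g).map
        (precomp (f ≫ p) j (g ≫ k ≫ p) H.comm_over))).app V e) b =
      evalSelf e (comorph j (H.preimage_le V) b) :=
  eval_precompSection (hq := H.comm_over) (H.preimage_le V) e b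

include hα in
/-- A derivation of `𝒪_X` induces an invariant derivation of `𝒪_Ȳ`. -/
lemma exists_derivation [IsAffineHom f] [IsAffineHom k] [IsAffineHom g] {V : X.Opens}
    (hV : IsAffineOpen V) (D : DerivationAlong p (𝟙 X) V) :
    ∃ e : DerivationAlong (g ≫ k ≫ p) (𝟙 Yb) (g ⁻¹ᵁ k ⁻¹ᵁ V), ∀ b,
      evalSelf e (comorph j (H.preimage_le V) b) = comorph j (H.preimage_le V)
        (evalSelf (p := f ≫ p) (W := Xb) (V := f ⁻¹ᵁ V) (α.app V D) b) := by
  obtain ⟨e, he, h⟩ := (isDer_evalSelf (p := f ≫ p) (W := Xb) (V := f ⁻¹ᵁ V)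
    (α.app V D)).exists_descend (H.comorph_surjective hV) fun b hb ↦
      H.comorph_evalSelf_eq_zero hα hV D hb
  have hκ : (comorph j (H.preimage_le V)).comp (kmap (f ≫ p) (f ⁻¹ᵁ V)) = kmap (g ≫ k ≫ p) _ :=
    RingHom.ext fun c ↦ by
      rw [RingHom.comp_apply, comorph_kmap, H.comm_over]
  rw [hκ] at he
  obtain ⟨E, hE⟩ := exists_evalSelf_eq ((hV.preimage k).preimage g) he
  exact ⟨E, fun b ↦ by rw [hE, h]⟩

include hι in
-- The conjugate σeσ is a derivation. It agrees with e on functions from Y, because e maps these to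
-- functions from Y and σ fixes them. The difference vanishes on functions from Y, hence is zero.
lemma commutes_of_exists [IsAffineHom g] [IsClosedImmersion k] {V : X.Opens} (hV : IsAffineOpen V)
    (e : DerivationAlong (g ≫ k ≫ p) (𝟙 Yb) (g ⁻¹ᵁ k ⁻¹ᵁ V))
    (h : ∀ a, ∃ a', evalSelf e (g.app (k ⁻¹ᵁ V) (k.app V a)) = g.app (k ⁻¹ᵁ V) (k.app V a'))
    (t : Γ(Yb, g ⁻¹ᵁ k ⁻¹ᵁ V)) :
    evalSelf e (comorph ι (le_preimage_of_comp_eq hι.comp_eq (k ⁻¹ᵁ V)) t) =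
      comorph ι (le_preimage_of_comp_eq hι.comp_eq (k ⁻¹ᵁ V)) (evalSelf e t) := by
  set σ := comorph ι (le_preimage_of_comp_eq hι.comp_eq (k ⁻¹ᵁ V))
  have hσσ (t : Γ(Yb, g ⁻¹ᵁ k ⁻¹ᵁ V)) : σ (σ t) = t := by
    refine (comorph_comp _ _ _ _ t).trans ((comorph_congr hι.involutive _ le_rfl t).trans ?_)
    rw [comorph_id]
    exact res_self t
  have hσg (t : Γ(Y, k ⁻¹ᵁ V)) : σ (g.app _ t) = g.app _ t := by
    rw [← comorph_self_eq_app]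
    exact (comorph_comp _ _ _ _ t).trans (comorph_congr hι.comp_eq _ le_rfl t)
  have hσκ : σ.comp (kmap (g ≫ k ≫ p) _) = kmap (g ≫ k ≫ p) _ := RingHom.ext fun c ↦ by
    refine (comorph_kmap _ _ _ c).trans ?_
    rw [← Category.assoc, hι.comp_eq]
  have he := isDer_evalSelf e
  have h1 : IsDer (kmap (g ≫ k ≫ p) _) (RingHom.id _)
      (σ.toAddMonoidHom.comp ((evalSelf e).comp σ.toAddMonoidHom)) := by
    refine ⟨fun a b ↦ ?_, fun c ↦ ?_⟩
    · simp [he.leibniz, hσσ]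
    · have h2 : σ (kmap (g ≫ k ≫ p) _ c) = kmap (g ≫ k ≫ p) _ c := congr($hσκ c)
      simp [h2, he.map_const]
  have h2 := H.eq_zero_of_app_app hV (he.sub h1) (fun a ↦ by
    obtain ⟨a', ha'⟩ := h a
    simp [hσg, ha']) t
  have h3 : evalSelf e t = σ (evalSelf e (σ t)) := sub_eq_zero.mp h2
  rw [h3, hσσ]

/-- The inclusion of `(g_* T_Ȳ)^inv` into the direct image of `(j^* Ω_X̄)^∨`. -/
noncomputable abbrev invariantInclusion : (Modules.pushforward k).obj
    (invariantTangent hι.comp_eq (k ≫ p)) ⟶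
      (Modules.pushforward k).obj ((Modules.pushforward g).obj (derivationSheaf (f ≫ p) j)) :=
  (Modules.pushforward k).map (invariantTangentι hι.comp_eq (k ≫ p)) ≫
    (Modules.pushforward k).map ((Modules.pushforward g).map
      (precomp (f ≫ p) j (g ≫ k ≫ p) H.comm_over))

lemma mono_invariantInclusion [IsClosedImmersion j] : Mono (H.invariantInclusion hι) := by
  have h1 : Mono (invariantTangentι hι.comp_eq (k ≫ p)) := equalizer.ι_mono
  have h2 := precomp_mono_of_isClosedImmersion H.comm_over
  exact mono_comp _ _

lemma eval_invariantInclusion {V : X.Opens}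
    (n : Γ((Modules.pushforward k).obj (invariantTangent hι.comp_eq (k ≫ p)), V))
    (b : Γ(Xb, f ⁻¹ᵁ V)) :
    DerivationAlong.eval (p := f ≫ p) (h := j) (V := g ⁻¹ᵁ k ⁻¹ᵁ V) (H.preimage_le V)
      ((H.invariantInclusion hι).app V n) b =
      evalSelf (p := g ≫ k ≫ p) (W := Yb) (V := g ⁻¹ᵁ k ⁻¹ᵁ V)
        ((invariantTangentι hι.comp_eq (k ≫ p)).app (k ⁻¹ᵁ V) n) (comorph j (H.preimage_le V) b) :=
  H.evalSelf_app_app _ b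

include hα in
lemma exists_invariantInclusion_eq [IsAffineHom f] [IsAffineHom g] [IsClosedImmersion k]
    {V : X.Opens} (hV : IsAffineOpen V) (D : DerivationAlong p (𝟙 X) V) :
    ∃ n, (H.invariantInclusion hι).app V n =
      (restrictTangent p f j k g H.comm).app V (α.app V D) := by
  obtain ⟨e, he⟩ := H.exists_derivation hα hV D
  have h1 := H.commutes_of_exists hι hV e fun a ↦ ⟨evalSelf D a, by
    rw [← H.comorph_app, he, LiftsDerivations.evalSelf_app hα, H.comorph_app]⟩
  obtain ⟨n, hn⟩ := Modules.exists_equalizer_section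
    (M := (Modules.pushforward g).obj (tangentSheaf (g ≫ k ≫ p))) _ _ (k ⁻¹ᵁ V) e
    ((app_eq_app_iff_commutes hι.comp_eq (k ≫ p) ((hV.preimage k).preimage g) e).mpr h1)
  refine ⟨n, H.restrictTangent_app_ext hV fun b ↦ ?_⟩
  refine (H.eval_invariantInclusion hι n b).trans (Eq.trans ?_
    (eval_restrictTangent H.comm (H.preimage_le V) (α.app V D) b).symm)
  rw [← he]
  exact congr(evalSelf (p := g ≫ k ≫ p) (W := Yb) (V := g ⁻¹ᵁ k ⁻¹ᵁ V) $hn _)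

include hα in
-- An invariant derivation of S lifts to B by projectivity of Ω_B. The lift preserves A modulo the
-- conductor, so it comes from a derivation of X.
lemma exists_restrictTangent_eq [IsAffineHom f] [IsAffineHom g] [IsClosedImmersion k]
    {V : X.Opens} (hV : IsAffineOpen V)
    (n : Γ((Modules.pushforward k).obj (invariantTangent hι.comp_eq (k ≫ p)), V)) :
    ∃ D, (H.invariantInclusion hι).app V n =
      (restrictTangent p f j k g H.comm).app V (α.app V D) := by
  let e : DerivationAlong (g ≫ k ≫ p) (𝟙 Yb) (g ⁻¹ᵁ k ⁻¹ᵁ V) :=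
    (invariantTangentι hι.comp_eq (k ≫ p)).app (k ⁻¹ᵁ V) n
  have h1 := (app_eq_app_iff_commutes hι.comp_eq (k ≫ p) ((hV.preimage k).preimage g) e).mp
    congr(Modules.Hom.app $(equalizer.condition _ _) (k ⁻¹ᵁ V) n)
  have hκ : (comorph j (H.preimage_le V)).comp (kmap (f ≫ p) (f ⁻¹ᵁ V)) = kmap (g ≫ k ≫ p) _ :=
    RingHom.ext fun c ↦ by
      rw [RingHom.comp_apply, comorph_kmap]; simp only [H.comm_over]
  have he : IsDer (kmap (f ≫ p) (f ⁻¹ᵁ V)) (comorph j (H.preimage_le V))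
      ((evalSelf e).comp (comorph j (H.preimage_le V)).toAddMonoidHom) :=
    ⟨fun a b ↦ by simp [(isDer_evalSelf e).leibniz], fun c ↦ by
      have h2 : comorph j (H.preimage_le V) (kmap (f ≫ p) (f ⁻¹ᵁ V) c) = kmap (g ≫ k ≫ p) _ c :=
        congr($hκ c)
      simp [h2, (isDer_evalSelf e).map_const]⟩
  obtain ⟨d, hd, hde⟩ := (H.projective hV).exists_lift (H.comorph_surjective hV) he
  obtain ⟨E, rfl⟩ := exists_evalSelf_eq (hV.preimage f) hd
  obtain ⟨D, hD⟩ := H.exists_app_eq_of_comorph_eq hα hV E fun a ↦ by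
    rw [hde]
    simp only [AddMonoidHom.comp_apply, RingHom.toAddMonoidHom_eq_coe, AddMonoidHom.coe_coe,
      H.comorph_app]
    -- Since e commutes with σ, it maps functions from Y to σ-invariant functions. These come from
    -- Y, and on an affine open of X also from X.
    have h3 : comorph ι (le_preimage_of_comp_eq hι.comp_eq (k ⁻¹ᵁ V))
        (g.app (k ⁻¹ᵁ V) (k.app V a)) = g.app (k ⁻¹ᵁ V) (k.app V a) := by
      rw [← comorph_self_eq_app]
      exact (comorph_comp _ _ _ _ _).trans (comorph_congr hι.comp_eq _ le_rfl _)
    have h4 := h1 (g.app (k ⁻¹ᵁ V) (k.app V a))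
    rw [h3] at h4
    obtain ⟨t, ht, -⟩ := hι.existsUnique_of_invariant _ _ h4.symm
    obtain ⟨a', rfl⟩ := k.app_surjective V hV t
    exact ⟨a', ht.symm⟩
  refine ⟨D, H.restrictTangent_app_ext hV fun b ↦ ?_⟩
  rw [hD]
  refine (H.eval_invariantInclusion hι n b).trans (Eq.trans ?_
    (eval_restrictTangent H.comm (H.preimage_le V) E b).symm)
  exact (hde b).symm

include hα in
-- Restriction to Ȳ composed with `α` factors through the invariant part by a map `β`, which is
-- surjective on affine opens. This is the input of `shortExact_of_epi`. The argument runs in the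
-- sheaf of derivations; the isomorphism `θ` carries it to T_X̄|_Ȳ.
theorem exists_shortExact [IsAffineHom f] [IsAffineHom g] [IsClosedImmersion j]
    [IsClosedImmersion k] {τ : tangentSheaf (g ≫ k ≫ p) ⟶
      (Modules.pullback j).obj (tangentSheaf (f ≫ p))}
    (hτ : IsTangentMap (f ≫ p) j (g ≫ k ≫ p) H.comm_over τ) :
    ∃ π : (Modules.pushforward k).obj ((Modules.pushforward g).obj
        ((Modules.pullback j).obj (tangentSheaf (f ≫ p)))) ⟶ cokernel α,
      (Modules.pushforward f).map ((Modules.pullbackPushforwardAdjunction j).unit.app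
          (tangentSheaf (f ≫ p))) ≫ (pushforwardSquare H.comm).hom.app _ ≫ π = cokernel.π α ∧
      ∃ w : (Modules.pushforward k).map (invariantTangentι hι.comp_eq (k ≫ p) ≫
          (Modules.pushforward g).map τ) ≫ π = 0, (ShortComplex.mk _ π w).ShortExact := by
  have := H.isIso_pullbackTangent
  have := H.mono_invariantInclusion hι
  have := H.epi_restrictTangent
  obtain ⟨π, hπ⟩ := H.exists_restrictTangent_comp hα
  let θ := (Modules.pushforward k).map ((Modules.pushforward g).map (pullbackTangent (f ≫ p) j))
  have hr := unit_comp_eq p f j k g H.comm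
  have hrepi : Epi ((Modules.pushforward f).map ((Modules.pullbackPushforwardAdjunction j).unit.app
      (tangentSheaf (f ≫ p))) ≫ (pushforwardSquare H.comm).hom.app _) := by
    rw [← IsIso.eq_comp_inv] at hr
    rw [hr]
    exact epi_comp _ _
  have hi : (Modules.pushforward k).map (invariantTangentι hι.comp_eq (k ≫ p) ≫
      (Modules.pushforward g).map τ) ≫ θ = H.invariantInclusion hι := by
    rw [invariantInclusion, ← show _ = _ from hτ]
    simp only [Functor.map_comp, Category.assoc, θ]
  have hmono : Mono ((Modules.pushforward k).map (invariantTangentι hι.comp_eq (k ≫ p) ≫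
      (Modules.pushforward g).map τ)) := by
    have : Mono ((Modules.pushforward k).map (invariantTangentι hι.comp_eq (k ≫ p) ≫
      (Modules.pushforward g).map τ) ≫ θ) := by rw [hi]; assumption
    exact mono_of_mono _ θ
  obtain ⟨β, hβ⟩ := Modules.exists_lift isOpensBasis_isAffineOpen
    (α ≫ restrictTangent p f j k g H.comm) (H.invariantInclusion hι) fun V hV D ↦
      H.exists_invariantInclusion_eq hα hι hV D
  have hβepi : Epi β := Modules.epi_of_surjective isOpensBasis_isAffineOpen fun V hV n ↦ by
    obtain ⟨D, hD⟩ := H.exists_restrictTangent_eq hα hι hV n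
    exact ⟨D, Modules.injective_of_mono (H.invariantInclusion hι) V
      (Eq.trans congr(Modules.Hom.app $hβ V D) hD.symm)⟩
  have hπ' : ((Modules.pushforward f).map ((Modules.pullbackPushforwardAdjunction j).unit.app
      (tangentSheaf (f ≫ p))) ≫ (pushforwardSquare H.comm).hom.app _) ≫ θ ≫ π = cokernel.π α := by
    rw [← Category.assoc, hr, hπ]
  refine ⟨θ ≫ π, by rw [← hπ', Category.assoc], ?_⟩
  refine shortExact_of_epi α _ _ β ?_ _ hπ'
  rw [← cancel_mono θ, Category.assoc, hi, hβ, Category.assoc, hr]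

end IsConductorSquare

end MainSequence
end SemiSmooth



namespace SemiSmooth

/-! ### The normalization of the pinch point -/

open MvPolynomial

section PinchRing

variable (K : Type u) [Field K] (m : ℕ)

/-- The coordinate ring `K[x, y, t₁, …, tₘ]` of the normalization of the pinch point. -/
abbrev PinchCover : Type u := MvPolynomial (Fin 2 ⊕ Fin m) K

/-- The coordinate `x`. -/
noncomputable abbrev PinchCover.x : PinchCover K m := X (.inl 0)

/-- The coordinate `y`. -/
noncomputable abbrev PinchCover.y : PinchCover K m := X (.inl 1)

/-- The classes of the coordinates `u, v, w, t₁, …, tₘ`. -/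
noncomputable abbrev PinchRing.coord (i : Fin 3 ⊕ Fin m) : PinchRing K m := Ideal.Quotient.mk _ (X i)

open PinchCover PinchRing

lemma PinchRing.sq_eq : coord K m (.inl 0) ^ 2 = coord K m (.inl 1) ^ 2 * coord K m (.inl 2) := by
  rw [← sub_eq_zero, ← map_pow, ← map_pow, ← map_mul, ← map_sub]
  exact Ideal.Quotient.eq_zero_iff_mem.mpr (Ideal.subset_span rfl)

/-- The images of the coordinates of the pinch point. -/
noncomputable def PinchCover.coord : Fin 3 ⊕ Fin m → PinchCover K m :=
  Sum.elim ![x K m * y K m, x K m, y K m ^ 2] fun i ↦ X (.inr i)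

/-- The map `u ↦ x y`, `v ↦ x`, `w ↦ y²`. -/
noncomputable def pinchNormalization : PinchRing K m →ₐ[K] PinchCover K m :=
  Ideal.Quotient.liftₐ _ (aeval (PinchCover.coord K m)) fun a ha ↦ by
    have : Ideal.span {(X (.inl 0) ^ 2 - X (.inl 1) ^ 2 * X (.inl 2) :
        MvPolynomial (Fin 3 ⊕ Fin m) K)} ≤ RingHom.ker (aeval (R := K) (PinchCover.coord K m)) := by
      rw [Ideal.span_le, Set.singleton_subset_iff, SetLike.mem_coe, RingHom.mem_ker]
      simp [PinchCover.coord]; ring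
    exact this ha

noncomputable instance : Algebra (PinchRing K m) (PinchCover K m) :=
  (pinchNormalization K m).toRingHom.toAlgebra

instance : IsScalarTower K (PinchRing K m) (PinchCover K m) :=
  .of_algebraMap_eq' (pinchNormalization K m).comp_algebraMap.symm

variable {K m}

lemma algebraMap_coord (i) :
    algebraMap (PinchRing K m) (PinchCover K m) (PinchRing.coord K m i) = PinchCover.coord K m i :=
  (Ideal.Quotient.liftₐ_apply _ _ _ _).trans ((Ideal.Quotient.lift_mk _ _ _).trans (aeval_X _ _))

lemma algebraMap_coord_u : algebraMap (PinchRing K m) (PinchCover K m)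
    (PinchRing.coord K m (.inl 0)) = x K m * y K m := algebraMap_coord _

lemma algebraMap_coord_v : algebraMap (PinchRing K m) (PinchCover K m)
    (PinchRing.coord K m (.inl 1)) = x K m := algebraMap_coord _

lemma algebraMap_coord_w : algebraMap (PinchRing K m) (PinchCover K m)
    (PinchRing.coord K m (.inl 2)) = y K m ^ 2 := algebraMap_coord _

lemma algebraMap_coord_t (i : Fin m) : algebraMap (PinchRing K m) (PinchCover K m)
    (PinchRing.coord K m (.inr i)) = X (.inr i) := algebraMap_coord _

@[elab_as_elim]
lemma PinchRing.induction_on {motive : PinchRing K m → Prop} (a : PinchRing K m)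
    (C : ∀ c : K, motive (algebraMap K _ c)) (add : ∀ a b, motive a → motive b → motive (a + b))
    (mul : ∀ a i, motive a → motive (a * coord K m i)) : motive a := by
  obtain ⟨a, rfl⟩ := Ideal.Quotient.mk_surjective a
  induction a using MvPolynomial.induction_on with
  | C c => exact C c
  | add a b ha hb => rw [map_add]; exact add _ _ ha hb
  | mul_X a i ha => rw [map_mul]; exact mul _ _ ha

/-- The coordinate ring of the cover is A + Ay, since multiplication by y maps ay to aw. -/
lemma PinchCover.exists_eq_add (l : PinchCover K m) : ∃ a a' : PinchRing K m,
    l = algebraMap _ _ a + algebraMap _ _ a' * y K m := by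
  induction l using MvPolynomial.induction_on with
  | C c => exact ⟨algebraMap K _ c, 0, by
      rw [map_zero, zero_mul, add_zero, ← IsScalarTower.algebraMap_apply]; rfl⟩
  | add p q hp hq =>
    obtain ⟨a, a', rfl⟩ := hp
    obtain ⟨b, b', rfl⟩ := hq
    exact ⟨a + b, a' + b', by simp only [map_add]; ring⟩
  | mul_X p i hp =>
    obtain ⟨a, a', rfl⟩ := hp
    obtain (i | i) := i
    · fin_cases i
      · exact ⟨a * PinchRing.coord K m (.inl 1), a' * PinchRing.coord K m (.inl 1), by
          simp only [map_mul, algebraMap_coord_v]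
          change _ * x K m = _
          ring⟩
      · exact ⟨a' * PinchRing.coord K m (.inl 2), a, by
          simp only [map_mul, algebraMap_coord_w]
          change _ * y K m = _
          ring⟩
    · exact ⟨a * PinchRing.coord K m (.inr i), a' * PinchRing.coord K m (.inr i), by
        simp only [map_mul, algebraMap_coord_t]
        ring⟩

instance : Algebra.IsIntegral (PinchRing K m) (PinchCover K m) := by
  have hy : IsIntegral (PinchRing K m) (y K m) :=
    IsIntegral.of_pow two_pos (by rw [← algebraMap_coord_w]; exact isIntegral_algebraMap)
  refine ⟨fun l ↦ ?_⟩
  obtain ⟨a, a', rfl⟩ := l.exists_eq_add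
  exact isIntegral_algebraMap.add (isIntegral_algebraMap.mul hy)

/-- The polynomials in `v, w, t₁, …, tₘ`, as elements of the coordinate ring of the pinch point. -/
noncomputable def pinchBase : PinchCover K m →ₐ[K] PinchRing K m :=
  aeval (Sum.elim ![PinchRing.coord K m (.inl 1), PinchRing.coord K m (.inl 2)]
    fun i ↦ PinchRing.coord K m (.inr i))

lemma PinchRing.exists_eq_add (a : PinchRing K m) : ∃ p q : PinchCover K m,
    a = pinchBase p + pinchBase q * PinchRing.coord K m (.inl 0) := by
  induction a using PinchRing.induction_on with
  | C c => exact ⟨C c, 0, by simp [pinchBase]⟩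
  | add a b ha hb =>
    obtain ⟨p, p', rfl⟩ := ha
    obtain ⟨q, q', rfl⟩ := hb
    exact ⟨p + q, p' + q', by simp only [map_add]; ring⟩
  | mul a i ha =>
    obtain ⟨p, q, rfl⟩ := ha
    obtain (i | i) := i
    · fin_cases i
      · refine ⟨q * (x K m ^ 2 * y K m), p, ?_⟩
        have h1 : pinchBase (x K m ^ 2 * y K m) = PinchRing.coord K m (.inl 0) ^ 2 := by
          simp [pinchBase, sq_eq]
        rw [map_mul, h1]
        change _ * PinchRing.coord K m (.inl 0) = _
        ring
      · refine ⟨p * x K m, q * x K m, ?_⟩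
        have h1 : pinchBase (x K m) = PinchRing.coord K m (.inl 1) := by simp [pinchBase]
        rw [map_mul, map_mul, h1]
        change _ * PinchRing.coord K m (.inl 1) = _
        ring
      · refine ⟨p * y K m, q * y K m, ?_⟩
        have h1 : pinchBase (y K m) = PinchRing.coord K m (.inl 2) := by simp [pinchBase]
        rw [map_mul, map_mul, h1]
        change _ * PinchRing.coord K m (.inl 2) = _
        ring
    · refine ⟨p * X (.inr i), q * X (.inr i), ?_⟩
      have h1 : pinchBase (X (.inr i)) = PinchRing.coord K m (.inr i) := by simp [pinchBase]
      rw [map_mul, map_mul, h1]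
      ring

/-- The automorphism `y ↦ -y`. -/
noncomputable def PinchCover.invol : PinchCover K m →ₐ[K] PinchCover K m :=
  aeval (Sum.elim ![x K m, -y K m] fun i ↦ X (.inr i))

lemma PinchCover.invol_x : invol (x K m) = x K m := by simp [invol]
lemma PinchCover.invol_y : invol (y K m) = -y K m := by simp [invol]

lemma invol_algebraMap_pinchBase (p : PinchCover K m) :
    invol (algebraMap (PinchRing K m) (PinchCover K m) (pinchBase p)) =
      algebraMap _ _ (pinchBase p) := by
  have : (invol.comp ((IsScalarTower.toAlgHom K (PinchRing K m) (PinchCover K m)).comp pinchBase)) =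
      (IsScalarTower.toAlgHom K (PinchRing K m) (PinchCover K m)).comp pinchBase := by
    ext i : 1
    obtain (i | i) := i
    · fin_cases i
      · simp [pinchBase, algebraMap_coord_v, invol]
      · simp [pinchBase, algebraMap_coord_w, invol]
    · simp [pinchBase, algebraMap_coord_t, invol]
  exact congr($this p)

/-- The composite is x ↦ x, y ↦ y², t ↦ t. Squaring x and the t's afterwards makes it the
substitution of squares for all variables, which is known to be injective. -/
lemma pinchBase_injective :
    Function.Injective fun p ↦ algebraMap (PinchRing K m) (PinchCover K m) (pinchBase p) := by
  let s : PinchCover K m →ₐ[K] PinchCover K m :=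
    aeval (Sum.elim ![x K m ^ 2, y K m] fun i ↦ X (.inr i) ^ 2)
  have : s.comp ((IsScalarTower.toAlgHom K (PinchRing K m) (PinchCover K m)).comp pinchBase) =
      expand 2 := by
    ext i : 1
    obtain (i | i) := i
    · fin_cases i
      · simp [pinchBase, algebraMap_coord_v, s]
      · simp [pinchBase, algebraMap_coord_w, s]
    · simp [pinchBase, algebraMap_coord_t, s]
  intro p q h
  refine expand_injective two_pos (σ := Fin 2 ⊕ Fin m) (R := K) ?_
  rw [← this]
  exact congr(s $h)

/-- If p + q·xy = 0 with p, q polynomials in x, y², t, then y ↦ -y gives p - q·xy = 0. As 2 ≠ 0,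
both p and q vanish. -/
lemma PinchRing.algebraMap_injective (h2 : (2 : K) ≠ 0) :
    Function.Injective (algebraMap (PinchRing K m) (PinchCover K m)) := by
  rw [injective_iff_map_eq_zero]
  intro a ha
  obtain ⟨p, q, rfl⟩ := a.exists_eq_add
  have h2' : (2 : PinchCover K m) ≠ 0 := by
    intro h
    exact h2 (C_injective (Fin 2 ⊕ Fin m) K (by rw [map_ofNat, map_zero]; exact h))
  rw [map_add, map_mul, algebraMap_coord_u] at ha
  have h1 := congr(invol $ha)
  rw [map_add, map_mul, map_mul, invol_algebraMap_pinchBase, invol_algebraMap_pinchBase, invol_x,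
    invol_y, map_zero] at h1
  have hp : algebraMap (PinchRing K m) (PinchCover K m) (pinchBase p) = 0 := by
    refine (mul_eq_zero.mp ?_).resolve_left h2'
    linear_combination ha + h1
  have hq : algebraMap (PinchRing K m) (PinchCover K m) (pinchBase q) = 0 := by
    rw [hp, zero_add] at ha
    exact (mul_eq_zero.mp ha).resolve_right (mul_ne_zero (X_ne_zero _) (X_ne_zero _))
  have hp' : p = 0 := pinchBase_injective (by simpa using hp)
  have hq' : q = 0 := pinchBase_injective (by simpa using hq)
  rw [hp', hq', map_zero, zero_mul, add_zero]

/-- Modulo `x`, the automorphism `y ↦ -y` is linear over the coordinate ring of the pinch point. -/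
lemma x_dvd_invol_sub (a : PinchRing K m) :
    x K m ∣ invol (algebraMap (PinchRing K m) _ a) - algebraMap _ _ a := by
  obtain ⟨p, q, rfl⟩ := a.exists_eq_add
  rw [map_add, map_mul, algebraMap_coord_u, map_add, map_mul, map_mul, invol_algebraMap_pinchBase,
    invol_algebraMap_pinchBase, invol_x, invol_y]
  exact ⟨-2 * y K m * algebraMap (PinchRing K m) _ (pinchBase q), by ring⟩

end PinchRing
end SemiSmooth



namespace SemiSmooth

/-! ### Étale charts -/

open TensorProduct RingTheory.Sequence
open scoped Pointwise

section Regular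

/-- Stated as weak regularity, the divisibility conditions on x and y pass through flat base change.
-/
lemma isWeaklyRegular_pair_iff {R : Type*} [CommRing R] (r s : R) :
    IsWeaklyRegular R [r, s] ↔ (∀ c, r * c = 0 → c = 0) ∧ ∀ c, r ∣ s * c → r ∣ c := by
  have h1 (c : R) : Submodule.Quotient.mk (p := r • (⊤ : Submodule R R)) c = 0 ↔ r ∣ c := by
    rw [Submodule.Quotient.mk_eq_zero, Submodule.mem_smul_pointwise_iff_exists]
    simp only [Submodule.mem_top, true_and, smul_eq_mul, dvd_def, eq_comm]
  rw [isWeaklyRegular_cons_iff, isWeaklyRegular_cons_iff, isSMulRegular_iff_right_eq_zero_of_smul,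
    isSMulRegular_iff_right_eq_zero_of_smul]
  simp only [IsWeaklyRegular.nil, and_true, smul_eq_mul]
  refine and_congr_right fun _ ↦ ⟨fun h c hc ↦ ?_, fun h c ↦ ?_⟩
  · rw [← h1] at hc ⊢
    exact h _ hc
  · obtain ⟨c, rfl⟩ := Submodule.Quotient.mk_surjective _ c
    intro hc
    exact (h1 c).mpr (h c ((h1 _).mp hc))

end Regular

/-- The local properties of the normalization `A → B` of an étale neighbourhood of a pinch point,
with `v` a generator of the conductor ideal of `B` and `y` a generator of `B` over `A`. -/
structure IsPinchChart {K A B : Type*} [CommRing K] [CommRing A] [CommRing B] (κ : K →+* A)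
    (φ : A →+* B) (v : A) (y : B) : Prop where
  eq_zero_of_mul (b : B) : φ v * b = 0 → b = 0
  exists_conductor : ∃ u, φ u = φ v * y
  exists_sq : ∃ w, φ w = y ^ 2
  exists_eq_add (b : B) : ∃ a a', b = φ a + φ a' * y
  dvd_of_dvd_add (a a' : A) : φ v ∣ φ a + φ a' * y → φ v ∣ φ a
  dvd_of_dvd_mul (b : B) : φ v ∣ y * b → φ v ∣ b
  isUnit_two : IsUnit (2 : A)
  exists_extend (d : A →+ A) : IsDer κ (RingHom.id A) d →
    ∃ d' : B →+ B, IsDer (φ.comp κ) (RingHom.id B) d' ∧ ∀ a, d' (φ a) = φ (d a)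
  projective : HasProjectiveDifferentials (φ.comp κ)

lemma formallyEtale_ringEquiv {B B' : Type*} [CommRing B] [CommRing B'] (e : B ≃+* B') :
    (e : B →+* B').FormallyEtale := by
  algebraize [(e : B →+* B')]
  exact Algebra.FormallyEtale.of_equiv (A := B) (AlgEquiv.ofRingEquiv (f := e) fun _ ↦ rfl)

lemma IsPinchChart.of_equiv {K A B B' : Type*} [CommRing K] [CommRing A] [CommRing B] [CommRing B']
    {κ : K →+* A} {φ : A →+* B} {v : A} {y : B} (h : IsPinchChart κ φ v y) (e : B ≃+* B')
    {φ' : A →+* B'} (hφ' : ∀ a, φ' a = e (φ a)) : IsPinchChart κ φ' v (e y) := by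
  obtain rfl : φ' = (e : B →+* B').comp φ := RingHom.ext hφ'
  have hdvd (b b' : B) : e b ∣ e b' ↔ b ∣ b' :=
    ⟨fun ⟨c, hc⟩ ↦ ⟨e.symm c, e.injective (by rw [map_mul, e.apply_symm_apply, hc])⟩,
      fun ⟨c, hc⟩ ↦ ⟨e c, by rw [hc, map_mul]⟩⟩
  refine ⟨fun b hb ↦ ?_, ?_, ?_, fun b ↦ ?_, fun a a' haa ↦ ?_, fun b hb ↦ ?_, h.isUnit_two,
    fun d hd ↦ ?_, ?_⟩
  · obtain ⟨b, rfl⟩ := e.surjective b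
    rw [h.eq_zero_of_mul b (e.injective (by simpa using hb)), map_zero]
  · obtain ⟨u, hu⟩ := h.exists_conductor
    exact ⟨u, by simp [hu]⟩
  · obtain ⟨w, hw⟩ := h.exists_sq
    exact ⟨w, by simp [hw]⟩
  · obtain ⟨a, a', haa⟩ := h.exists_eq_add (e.symm b)
    exact ⟨a, a', by simpa using congr(e $haa)⟩
  · simp only [RingHom.comp_apply, RingHom.coe_coe, ← map_mul, ← map_add, hdvd] at haa ⊢
    exact h.dvd_of_dvd_add a a' haa
  · obtain ⟨b, rfl⟩ := e.surjective b
    simp only [RingHom.comp_apply, RingHom.coe_coe, ← map_mul, hdvd] at hb ⊢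
    exact h.dvd_of_dvd_mul b hb
  · obtain ⟨d', hd', hdd⟩ := h.exists_extend d hd
    refine ⟨(e : B →+ B').comp (d'.comp (e.symm : B' →+ B)), ⟨fun a b ↦ ?_, fun c ↦ ?_⟩,
      fun a ↦ ?_⟩
    · simp [hd'.leibniz]
    · simpa using hd'.map_const c
    · simp [hdd]
  · have he : (e : B →+* B').FormallyEtale :=
      formallyEtale_ringEquiv e
    rw [RingHom.comp_assoc]
    exact h.projective.of_formallyEtale he

lemma exists_isDer_mvPolynomial {K R σ : Type*} [CommRing K] [CommRing R]
    (ψ : MvPolynomial σ K →+* R) (f : σ → R) :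
    ∃ D : MvPolynomial σ K →+ R, IsDer (algebraMap K _) ψ D ∧ ∀ i, D (MvPolynomial.X i) = f i := by
  algebraize [ψ, ψ.comp (algebraMap K (MvPolynomial σ K))]
  have : IsScalarTower K (MvPolynomial σ K) R := .of_algebraMap_eq' rfl
  exact ⟨(MvPolynomial.mkDerivation K f : Derivation K _ _), .ofDerivation _,
    MvPolynomial.mkDerivation_X K f⟩

/-- The algebra structure rebuilt from the structure map equals the given one; generalizing over the
instance allows substitution. -/
lemma hasProjectiveDifferentials_algebraMap {K A : Type*} [CommRing K] [CommRing A]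
    [h : Algebra K A] : HasProjectiveDifferentials (algebraMap K A) ↔
      Module.Finite A Ω[A⁄K] ∧ Module.Projective A Ω[A⁄K] := by
  have key (p : Prop) (hp : p ↔ Module.Finite A Ω[A⁄K] ∧ Module.Projective A Ω[A⁄K])
      (i : Algebra K A) (hi : i = h) :
      (letI := i; Module.Finite A Ω[A⁄K] ∧ Module.Projective A Ω[A⁄K]) ↔ p := by
    subst hi; exact hp.symm
  exact key _ Iff.rfl (algebraMap K A).toAlgebra (Algebra.algebra_ext _ _ fun _ ↦ rfl)

lemma mvPolynomial_projective (K σ : Type*) [CommRing K] [Finite σ] :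
    HasProjectiveDifferentials (algebraMap K (MvPolynomial σ K)) := by
  rw [hasProjectiveDifferentials_algebraMap]
  exact ⟨inferInstance, inferInstance⟩

lemma X_dvd_of_X_dvd_X_mul {K σ : Type*} [Field K] {i j : σ} (hij : i ≠ j) (c : MvPolynomial σ K)
    (h : (MvPolynomial.X i : MvPolynomial σ K) ∣ MvPolynomial.X j * c) : MvPolynomial.X i ∣ c :=
  (((MvPolynomial.X_prime).dvd_mul).mp h).resolve_left fun h' ↦
    hij (by simpa using MvPolynomial.X_dvd_X.mp h')

/-! ### Flat and étale base change of the model -/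

section BaseChange

attribute [local instance] Algebra.TensorProduct.rightAlgebra

variable (P A L : Type*) [CommRing P] [CommRing A] [CommRing L] [Algebra P A] [Algebra P L]

lemma flat_rightAlgebra [Module.Flat P A] : Module.Flat L (A ⊗[P] L) :=
  .of_linearEquiv (Algebra.TensorProduct.commRight P L A).symm.toLinearEquiv

lemma formallyEtale_includeRight [Algebra.FormallyEtale P A] :
    (Algebra.TensorProduct.includeRight : L →ₐ[P] A ⊗[P] L).toRingHom.FormallyEtale :=
  Algebra.FormallyEtale.of_equiv (Algebra.TensorProduct.commRight P L A)

variable {P A L}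

lemma regular_includeRight [Module.Flat P A] {r s : L} (hr : ∀ c, r * c = 0 → c = 0)
    (h : ∀ c, r ∣ s * c → r ∣ c) :
    (∀ c : A ⊗[P] L, 1 ⊗ₜ r * c = 0 → c = 0) ∧
      ∀ c : A ⊗[P] L, 1 ⊗ₜ r ∣ 1 ⊗ₜ s * c → 1 ⊗ₜ r ∣ c := by
  have := flat_rightAlgebra P A L
  exact (isWeaklyRegular_pair_iff _ _).mp
    (IsWeaklyRegular.of_flat (S := A ⊗[P] L) ((isWeaklyRegular_pair_iff r s).mpr ⟨hr, h⟩))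

lemma algebraMap_tmul_one (a : P) :
    algebraMap P A a ⊗ₜ[P] (1 : L) = 1 ⊗ₜ[P] algebraMap P L a := by
  rw [Algebra.algebraMap_eq_smul_one, TensorProduct.smul_tmul, Algebra.algebraMap_eq_smul_one]

lemma tmul_exists_eq_add {y : L} (h : ∀ l : L, ∃ a a' : P, l = algebraMap P L a + algebraMap P L a' * y)
    (b : A ⊗[P] L) : ∃ a a' : A, b = a ⊗ₜ 1 + a' ⊗ₜ 1 * 1 ⊗ₜ y := by
  induction b using TensorProduct.induction_on with
  | zero => exact ⟨0, 0, by simp⟩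
  | tmul c l =>
    obtain ⟨a, a', rfl⟩ := h l
    refine ⟨c * algebraMap _ _ a, c * algebraMap _ _ a', ?_⟩
    rw [Algebra.TensorProduct.tmul_mul_tmul, tmul_add, mul_one, one_mul, mul_comm c, mul_comm c,
      ← Algebra.smul_def, ← Algebra.smul_def, ← Algebra.smul_def, TensorProduct.smul_tmul,
      TensorProduct.smul_tmul, Algebra.algebraMap_eq_smul_one]
  | add b b' hb hb' =>
    obtain ⟨a, a', rfl⟩ := hb
    obtain ⟨c, c', rfl⟩ := hb'
    exact ⟨a + c, a' + c', by simp only [add_tmul]; ring⟩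

/-- Modulo x the map σ is P-linear, so it extends A-linearly to A ⊗ L/x. There it fixes a and a' and
negates y. Adding a + a'y = 0 and its image a - a'y = 0 gives 2a = 0. -/
lemma tmul_dvd_of_dvd_add (h2 : IsUnit (2 : A)) {x y : L} (σ : L →+* L) (hx : σ x = x)
    (hy : σ y = -y) (hσ : ∀ a : P, x ∣ σ (algebraMap P L a) - algebraMap P L a) (a a' : A)
    (h : (1 ⊗ₜ x : A ⊗[P] L) ∣ a ⊗ₜ 1 + a' ⊗ₜ 1 * 1 ⊗ₜ y) :
    (1 ⊗ₜ x : A ⊗[P] L) ∣ a ⊗ₜ 1 := by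
  let J : Ideal L := Ideal.span {x}
  let q : L →ₐ[P] L ⧸ J := Ideal.Quotient.mkₐ P J
  have hJ : J ≤ J.comap σ := by
    rw [Ideal.span_le, Set.singleton_subset_iff, SetLike.mem_coe, Ideal.mem_comap, hx]
    exact Ideal.mem_span_singleton_self _
  let s : (L ⧸ J) →ₐ[P] (L ⧸ J) :=
    { Ideal.quotientMap J σ hJ with
      commutes' := fun a ↦ by
        change Ideal.Quotient.mk J (σ (algebraMap P L a)) = Ideal.Quotient.mk J (algebraMap P L a)
        exact Ideal.Quotient.eq.mpr (Ideal.mem_span_singleton.mpr (hσ a)) }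
  have hs (l : L) : s (q l) = q (σ l) := rfl
  let q' : A ⊗[P] L →ₐ[A] A ⊗[P] (L ⧸ J) := Algebra.TensorProduct.map (AlgHom.id A A) q
  let s' : A ⊗[P] (L ⧸ J) →ₐ[A] A ⊗[P] (L ⧸ J) := Algebra.TensorProduct.map (AlgHom.id A A) s
  have hq' (c : A) (l : L) : q' (c ⊗ₜ l) = c ⊗ₜ q l := Algebra.TensorProduct.map_tmul _ _ _ _
  have hs' (c : A) (l : L ⧸ J) : s' (c ⊗ₜ l) = c ⊗ₜ s l := Algebra.TensorProduct.map_tmul _ _ _ _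
  have hker (z : A ⊗[P] L) : q' z = 0 ↔ 1 ⊗ₜ x ∣ z := by
    have h1 := Algebra.TensorProduct.lTensor_ker (A := A) q (Ideal.Quotient.mkₐ_surjective P J)
    have h2 : RingHom.ker q = J := Ideal.Quotient.mkₐ_ker P J
    rw [h2, Ideal.map_span, Set.image_singleton] at h1
    rw [← Ideal.mem_span_singleton]
    exact (SetLike.ext_iff.mp h1 z)
  rw [← hker] at h ⊢
  rw [map_add, map_mul, hq', hq', hq', map_one] at h
  have h1 := congr(s' $h)
  rw [map_add, map_mul, hs', hs', hs', hs, hy, map_one, map_neg, tmul_neg, map_zero] at h1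
  obtain ⟨c, hc⟩ := h2.exists_left_inv
  have hc' : (c ⊗ₜ 1 : A ⊗[P] (L ⧸ J)) * 2 = 1 := by
    have : (2 : A ⊗[P] (L ⧸ J)) = 2 ⊗ₜ 1 := rfl
    rw [this, Algebra.TensorProduct.tmul_mul_tmul, hc, mul_one]; rfl
  rw [hq', map_one]
  linear_combination (c ⊗ₜ 1) * h + (c ⊗ₜ 1) * h1 - (a ⊗ₜ 1) * hc'

end BaseChange

/-- Derivations lift to the normalization of an étale neighbourhood of a pinch point. -/
lemma exists_extend_pinch {K P L A B ι : Type*} [CommRing K] [CommRing P] [CommRing L] [CommRing A]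
    [CommRing B] {κ : K →+* P} {μ : P →+* L} {π : P →+* A} {φ : A →+* B} {ψ : L →+* B}
    (hμ : ∀ a, φ (π a) = ψ (μ a)) (hπ : π.FormallyEtale) (hψ : ψ.FormallyEtale)
    {u v w : P} {t : ι → P} {x y : L} (hu : μ u = x * y) (hv : μ v = x) (hw : μ w = y ^ 2)
    (huv : u ^ 2 = v ^ 2 * w)
    (h2 : IsUnit (2 : B)) (hx : ∀ c, ψ x * c = 0 → c = 0) (hy : ∀ c, ψ y * c = 0 → c = 0)
    (hyx : ∀ c, ψ y ∣ ψ x * c → ψ y ∣ c)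
    (hL : ∀ (a b : B) (c : ι → B), ∃ D : L →+ B, IsDer (μ.comp κ) ψ D ∧ D x = a ∧ D y = b ∧
      ∀ i, D (μ (t i)) = c i)
    (hP : ∀ D E : P →+ B, IsDer κ (ψ.comp μ) D → IsDer κ (ψ.comp μ) E → D u = E u → D v = E v →
      D w = E w → (∀ i, D (t i) = E (t i)) → D = E)
    {d : A →+ A} (hd : IsDer (π.comp κ) (RingHom.id A) d) :
    ∃ d' : B →+ B, IsDer (φ.comp (π.comp κ)) (RingHom.id B) d' ∧ ∀ a, d' (φ a) = φ (d a) := by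
  obtain ⟨h, hh⟩ := h2.exists_left_inv
  have hdcu := congr(φ (d (π $huv)))
  have hu' : φ (π u) = ψ x * ψ y := by rw [hμ, hu, map_mul]
  have hv' : φ (π v) = ψ x := by rw [hμ, hv]
  have hw' : φ (π w) = ψ y ^ 2 := by rw [hμ, hw, map_pow]
  simp only [pow_two u, pow_two v, map_mul, hd.leibniz, RingHom.id_apply, map_add, hu', hv',
    hw'] at hdcu
  -- The derivative of u² = v²w, with one factor x cancelled.
  have h1 : 2 * ψ y * φ (d (π u)) = 2 * ψ y ^ 2 * φ (d (π v)) + ψ x * φ (d (π w)) := by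
    rw [← sub_eq_zero]
    refine hx _ ?_
    linear_combination hdcu
  -- By `h1`, y divides x·dw. Since x is regular modulo y, y divides dw. With h = 1/2, the value of
  -- the extension on y has to be h·e₀ = dw/(2y).
  obtain ⟨e₀, he₀⟩ := hyx (φ (d (π w)))
    ⟨2 * φ (d (π u)) - 2 * ψ y * φ (d (π v)), by linear_combination -h1⟩
  have he : φ (d (π w)) = 2 * ψ y * (h * e₀) := by
    linear_combination he₀ - ψ y * e₀ * hh
  have hdu' : φ (d (π u)) = ψ x * (h * e₀) + ψ y * φ (d (π v)) := by
    rw [← sub_eq_zero]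
    refine hy _ ?_
    linear_combination h * h1 + h * ψ x * he -
      (ψ y * φ (d (π u)) - ψ y ^ 2 * φ (d (π v)) - ψ y * ψ x * (h * e₀)) * hh
  obtain ⟨D, hD, hDx, hDy, hDt⟩ := hL (φ (d (π v))) (h * e₀) fun i ↦ φ (d (π (t i)))
  obtain ⟨E, hE, hED⟩ := IsDer.exists_extend (ψ := RingHom.id B) hψ hD
  have hEq : ψ.comp (μ.comp κ) = φ.comp (π.comp κ) := RingHom.ext fun c ↦ (hμ _).symm
  rw [hEq] at hE
  refine ⟨E, hE, fun a ↦ ?_⟩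
  -- Both E ∘ φ and φ ∘ d are derivations on A. As π is formally étale, they may be compared on P,
  -- and there on the coordinates.
  have hE1 : IsDer (π.comp κ) φ (E.comp φ.toAddMonoidHom) := hE.compLeft (ψ := RingHom.id B)
  have hE2 : IsDer (π.comp κ) φ (φ.toAddMonoidHom.comp d) := hd.compRight φ
  refine congr($(IsDer.eq_of_formallyEtale hπ hE1 hE2 fun a ↦ ?_) a)
  have hφπ : φ.comp π = ψ.comp μ := RingHom.ext hμ
  have hE3 := hE1.compLeft
  have hE4 := hE2.compLeft
  rw [hφπ] at hE3 hE4
  refine congr($(hP _ _ hE3 hE4 ?_ ?_ ?_ fun i ↦ ?_) a)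
  · change E (φ (π u)) = φ (d (π u))
    rw [hμ, hED, hu, hD.leibniz, hDx, hDy, hdu']
  · simp [hμ, hv, hED, hDx]
  · change E (φ (π w)) = φ (d (π w))
    rw [hμ, hED, hw, pow_two, hD.leibniz, hDy, he]
    ring
  · simp [hμ, hED, hDt]

/-- The chart obtained by étale base change. -/
lemma isPinchChart_tensorProduct {K P L A ι : Type*} [CommRing K] [CommRing P] [CommRing L]
    [CommRing A] [Algebra P A] [Algebra P L] [Module.Flat P A] [Algebra.FormallyEtale P A]
    {κ : K →+* P} {u v w : P} {t : ι → P} {x y : L} (hu : algebraMap P L u = x * y)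
    (hv : algebraMap P L v = x) (hw : algebraMap P L w = y ^ 2) (huv : u ^ 2 = v ^ 2 * w)
    (h2 : IsUnit (2 : A)) (hx : ∀ c, x * c = 0 → c = 0) (hy : ∀ c, y * c = 0 → c = 0)
    (hxy : ∀ c, x ∣ y * c → x ∣ c) (hyx : ∀ c, y ∣ x * c → y ∣ c)
    (hspan : ∀ l : L, ∃ a a' : P, l = algebraMap P L a + algebraMap P L a' * y)
    (σ : L →+* L) (hσx : σ x = x) (hσy : σ y = -y)
    (hσ : ∀ a : P, x ∣ σ (algebraMap P L a) - algebraMap P L a)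
    (hL : ∀ (a b : A ⊗[P] L) (c : ι → A ⊗[P] L), ∃ D : L →+ A ⊗[P] L,
      IsDer ((algebraMap P L).comp κ)
        (Algebra.TensorProduct.includeRight : L →ₐ[P] A ⊗[P] L).toRingHom D ∧ D x = a ∧ D y = b ∧
      ∀ i, D (algebraMap P L (t i)) = c i)
    (hP : ∀ (ψ : P →+* A ⊗[P] L) (D E : P →+ A ⊗[P] L), IsDer κ ψ D → IsDer κ ψ E →
      D u = E u → D v = E v → D w = E w → (∀ i, D (t i) = E (t i)) → D = E)
    (hproj : HasProjectiveDifferentials ((algebraMap P L).comp κ)) :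
    IsPinchChart ((algebraMap P A).comp κ) (algebraMap A (A ⊗[P] L)) (algebraMap P A v)
      (1 ⊗ₜ y) := by
  have hv' : algebraMap A (A ⊗[P] L) (algebraMap P A v) = 1 ⊗ₜ x := by
    rw [← hv]; exact algebraMap_tmul_one v
  obtain ⟨hx', hxy'⟩ := regular_includeRight (P := P) (A := A) hx hxy
  obtain ⟨hy', hyx'⟩ := regular_includeRight (P := P) (A := A) hy hyx
  have hψ := formallyEtale_includeRight P A L
  have h2' : IsUnit (2 : A ⊗[P] L) := h2.map (algebraMap A (A ⊗[P] L))
  have hμ (a : P) : algebraMap A (A ⊗[P] L) (algebraMap P A a) =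
      (Algebra.TensorProduct.includeRight : L →ₐ[P] A ⊗[P] L).toRingHom (algebraMap P L a) :=
    algebraMap_tmul_one a
  refine ⟨fun b hb ↦ hx' b (hv' ▸ hb), ⟨algebraMap P A u, ?_⟩, ⟨algebraMap P A w, ?_⟩,
    tmul_exists_eq_add hspan, fun a a' h ↦ ?_, fun b hb ↦ ?_, h2, fun d hd ↦ ?_, ?_⟩
  · rw [hv', Algebra.TensorProduct.tmul_mul_tmul, one_mul, ← hu]
    exact algebraMap_tmul_one u
  · rw [Algebra.TensorProduct.tmul_pow, one_pow, ← hw]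
    exact algebraMap_tmul_one w
  · rw [hv'] at h ⊢
    exact tmul_dvd_of_dvd_add h2 σ hσx hσy hσ a a' h
  · rw [hv'] at hb ⊢
    exact hxy' b hb
  · exact exists_extend_pinch (φ := algebraMap A (A ⊗[P] L)) (t := t) hμ
      (π := algebraMap P A) (κ := κ)
      (RingHom.formallyEtale_algebraMap.mpr ‹_›) hψ hu hv hw huv h2' hx' hy' hyx' hL
      (fun D E hD hE ↦ hP _ D E hD hE) hd
  · have h1 : (algebraMap A (A ⊗[P] L)).comp ((algebraMap P A).comp κ) =
        (Algebra.TensorProduct.includeRight : L →ₐ[P] A ⊗[P] L).toRingHom.comp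
          ((algebraMap P L).comp κ) := RingHom.ext fun c ↦ hμ _
    rw [h1]
    exact hproj.of_formallyEtale hψ

lemma isPinchChart_pinchCover {K : Type u} [Field K] (h2 : (2 : K) ≠ 0) {m : ℕ} {A : Type u}
    [CommRing A] [Algebra (PinchRing K m) A] [Module.Flat (PinchRing K m) A]
    [Algebra.FormallyEtale (PinchRing K m) A] :
    IsPinchChart ((algebraMap (PinchRing K m) A).comp (algebraMap K (PinchRing K m)))
      (algebraMap A (A ⊗[PinchRing K m] PinchCover K m))
      (algebraMap (PinchRing K m) A (PinchRing.coord K m (.inl 1))) (1 ⊗ₜ PinchCover.y K m) := by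
  have h2' : IsUnit (2 : A) := by
    have := (isUnit_iff_ne_zero.mpr h2).map
      ((algebraMap (PinchRing K m) A).comp (algebraMap K (PinchRing K m)))
    rwa [map_ofNat] at this
  have hK : (algebraMap (PinchRing K m) (PinchCover K m)).comp (algebraMap K (PinchRing K m)) =
      algebraMap K (PinchCover K m) := (IsScalarTower.algebraMap_eq _ _ _).symm
  have h0 {i} (c : PinchCover K m) (hc : MvPolynomial.X i * c = 0) : c = 0 :=
    (mul_eq_zero.mp hc).resolve_left (MvPolynomial.X_ne_zero _)
  refine isPinchChart_tensorProduct (P := PinchRing K m) (L := PinchCover K m)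
    (t := fun i : Fin m ↦ PinchRing.coord K m (.inr i)) (x := PinchCover.x K m)
    algebraMap_coord_u algebraMap_coord_v algebraMap_coord_w (PinchRing.sq_eq K m) h2'
    h0 h0 (X_dvd_of_X_dvd_X_mul (by simp)) (X_dvd_of_X_dvd_X_mul (by simp))
    PinchCover.exists_eq_add (PinchCover.invol : PinchCover K m →ₐ[K] PinchCover K m).toRingHom
    PinchCover.invol_x PinchCover.invol_y x_dvd_invol_sub (fun a b c ↦ ?_)
    (fun ψ D E hD hE hu hv hw ht ↦ ?_) ?_
  · obtain ⟨D, hD, hDX⟩ := exists_isDer_mvPolynomial (Algebra.TensorProduct.includeRight :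
      PinchCover K m →ₐ[PinchRing K m] A ⊗[PinchRing K m] PinchCover K m).toRingHom
        (Sum.elim ![a, b] c)
    rw [hK]
    exact ⟨D, hD, hDX (.inl 0), hDX (.inl 1), fun i ↦ by rw [algebraMap_coord_t]; exact hDX (.inr i)⟩
  · ext a
    induction a using PinchRing.induction_on with
    | C c => rw [hD.map_const, hE.map_const]
    | add a b ha hb => rw [map_add, map_add, ha, hb]
    | mul a i ha =>
      rw [hD.leibniz, hE.leibniz, ha]
      congr 2
      obtain (i | i) := i
      · fin_cases i
        exacts [hu, hv, hw]
      · exact ht i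
  · rw [hK]
    exact mvPolynomial_projective K _

end SemiSmooth



namespace SemiSmooth

/-! ### Étale base change of normalizations -/

open TensorProduct
open scoped nonZeroDivisors

/-- Nonunits are zero divisors, which in a reduced ring lie in the union of the minimal primes.
There are finitely many of these, so by prime avoidance every maximal ideal is minimal and the
dimension is zero. -/
lemma isArtinianRing_of_isReduced {Q : Type*} [CommRing Q] [IsNoetherianRing Q] [IsReduced Q]
    (hQ : ∀ q ∈ Q⁰, IsUnit q) : IsArtinianRing Q := by
  rw [isArtinianRing_iff_krullDimLE_zero, Ring.krullDimLE_zero_iff]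
  intro p hp
  obtain ⟨m, hm, hpm⟩ := p.exists_le_maximal hp.ne_top
  have hsub : (m : Set Q) ⊆ ⋃ q ∈ minimalPrimes Q, (q : Set Q) := by
    intro x hx
    by_contra hx'
    refine hm.ne_top (Ideal.eq_top_of_isUnit_mem _ hx (hQ x ?_))
    rw [mem_nonZeroDivisors_iff_right]
    intro y hy
    have : y ∈ sInf (minimalPrimes Q) := by
      rw [Submodule.mem_sInf]
      intro q hq
      exact ((hq.1.1 : Ideal.IsPrime q).mem_or_mem (hy ▸ q.zero_mem : y * x ∈ q)).resolve_right
        fun h ↦ hx' (Set.mem_biUnion hq h)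
    rw [minimalPrimes, Ideal.sInf_minimalPrimes] at this
    exact (nilradical_eq_zero Q).le this
  obtain ⟨q, hq, hmq⟩ := (Ideal.subset_union_prime_finite (minimalPrimes.finite_of_isNoetherianRing Q)
    ⊥ ⊥ fun i hi _ _ ↦ hi.1.1).mp hsub
  have hqp : q ≤ p := hq.2 ⟨hp, bot_le⟩ (hpm.trans hmq)
  rwa [le_antisymm hpm (hmq.trans hqp)]

lemma isArtinianRing_of_isFractionRing {A Q : Type u} [CommRing A] [CommRing Q] [Algebra A Q]
    [IsFractionRing A Q] [IsNoetherianRing A] [IsReduced A] : IsArtinianRing Q := by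
  have : IsNoetherianRing Q := IsLocalization.isNoetherianRing A⁰ Q inferInstance
  have : IsReduced Q := isReduced_localizationPreserves A⁰ Q inferInstance
  refine isArtinianRing_of_isReduced fun q hq ↦ ?_
  obtain ⟨a, b, rfl⟩ := IsLocalization.exists_mk'_eq A⁰ q
  have ha : a ∈ A⁰ := by
    rw [mem_nonZeroDivisors_iff_right]
    intro c hc
    refine IsFractionRing.injective A Q ?_
    rw [map_zero]
    refine (mem_nonZeroDivisors_iff_right.mp hq) _ ?_
    rw [← IsLocalization.mk'_one (M := A⁰), ← IsLocalization.mk'_mul, hc, IsLocalization.mk'_zero]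
  exact isUnit_of_mul_isUnit_left (y := algebraMap A Q b)
    (by rw [IsLocalization.mk'_spec]; exact IsLocalization.map_units Q ⟨a, ha⟩)

/-- A' ⊗ Q is quasi-finite over the Artinian ring Q, so it is finite over Q and Artinian, and its
nonzerodivisors are units. Inverting the nonzerodivisors of A thus inverts all nonzerodivisors of
A'. -/
lemma isFractionRing_tensorProduct (A Q A' : Type*) [CommRing A] [CommRing Q] [CommRing A']
    [Algebra A Q] [Algebra A A'] [IsFractionRing A Q] [IsArtinianRing Q] [Algebra.Etale A A'] :
    IsFractionRing A' (A' ⊗[A] Q) := by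
  have hQ : IsArtinianRing (A' ⊗[A] Q) := by
    have : Module.Finite Q (Q ⊗[A] A') := Module.Finite.of_quasiFinite
    have : IsArtinianRing (Q ⊗[A] A') := .of_finite Q _
    exact (Algebra.TensorProduct.comm A Q A').toRingEquiv.surjective.isArtinianRing
  refine IsLocalization.of_le (Algebra.algebraMapSubmonoid A' A⁰) A'⁰ ?_ fun r hr ↦ ?_
  · rintro _ ⟨a, ha, rfl⟩
    rw [mem_nonZeroDivisors_iff_right]
    intro c hc
    refine Module.Flat.isSMulRegular_of_nonZeroDivisors (M := A') ha ?_
    simpa [Algebra.smul_def, mul_comm] using hc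
  · refine IsArtinianRing.isUnit_of_mem_nonZeroDivisors ?_
    exact IsLocalization.map_nonZeroDivisors_le (Algebra.algebraMapSubmonoid A' A⁰) _ ⟨r, hr, rfl⟩

/-- Integral closure commutes with smooth base change. -/
lemma exists_equiv_integralClosure_tensorProduct (A Q A' B : Type*) [CommRing A] [CommRing Q]
    [CommRing A'] [CommRing B] [Algebra A Q] [Algebra A A'] [Algebra A B] [Algebra B Q]
    [IsScalarTower A B Q] [IsIntegralClosure B A Q] [Algebra.Etale A A'] :
    Nonempty (A' ⊗[A] B ≃ₐ[A'] integralClosure A' (A' ⊗[A] Q)) :=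
  ⟨(Algebra.TensorProduct.congr AlgEquiv.refl
    (IsIntegralClosure.equiv A B Q (integralClosure A Q))).trans
    (AlgEquiv.ofBijective _ TensorProduct.toIntegralClosure_bijective_of_smooth)⟩

/-- Étale base changes of normalizations agree. -/
lemma nonempty_tensorProduct_algEquiv (A Q B P F L A' : Type*) [CommRing A] [CommRing Q]
    [CommRing A'] [CommRing B] [Algebra A Q] [Algebra A A'] [Algebra A B] [Algebra B Q]
    [IsScalarTower A B Q] [IsIntegralClosure B A Q] [Algebra.Etale A A'] [IsFractionRing A Q]
    [IsArtinianRing Q] [CommRing P] [CommRing F]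
    [CommRing L] [Algebra P F] [Algebra P A'] [Algebra P L] [Algebra L F]
    [IsScalarTower P L F] [IsIntegralClosure L P F] [Algebra.Etale P A'] [IsFractionRing P F]
    [IsArtinianRing F] : Nonempty (A' ⊗[A] B ≃ₐ[A'] A' ⊗[P] L) := by
  obtain ⟨e⟩ := exists_equiv_integralClosure_tensorProduct A Q A' B
  obtain ⟨e'⟩ := exists_equiv_integralClosure_tensorProduct P F A' L
  have := isFractionRing_tensorProduct A Q A'
  have := isFractionRing_tensorProduct P F A'
  exact ⟨(e.trans (IsLocalization.algEquiv A'⁰ (A' ⊗[A] Q) (A' ⊗[P] F)).mapIntegralClosure).trans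
    e'.symm⟩

section Conductor

variable {A B : Type*} [CommRing A] [CommRing B] [Algebra A B]
  (hAB : Function.Injective (algebraMap A B)) {s : A} (hs : ∀ b : B, s • b = 0 → b = 0)
  (hsB : ∀ b : B, ∃ a : A, algebraMap A B a = s • b)
include hAB hs hsB

/-- A fraction b/c over B equals sb/sc, where numerator and denominator come from A. -/
lemma isFractionRing_of_conductor (Q : Type*) [CommRing Q] [Algebra A Q]
    [Algebra B Q] [IsScalarTower A B Q] [IsFractionRing B Q] : IsFractionRing A Q := by
  have hsm : s ∈ A⁰ := mem_nonZeroDivisors_iff_right.mpr fun a ha ↦ hAB (by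
    rw [map_zero]; exact hs _ (by rw [Algebra.smul_def, ← map_mul, mul_comm, ha, map_zero]))
  have hB {a : A} (ha : a ∈ A⁰) : algebraMap A B a ∈ B⁰ := by
    rw [mem_nonZeroDivisors_iff_right]
    intro b hb
    obtain ⟨c, hc⟩ := hsB b
    have : c = 0 := mem_nonZeroDivisors_iff_right.mp ha _ (hAB (by
      rw [map_mul, hc, Algebra.smul_mul_assoc, hb, smul_zero, map_zero]))
    exact hs b (by rw [← hc, this, map_zero])
  refine ⟨fun a ↦ ?_, fun q ↦ ?_, fun {a a'} h ↦ ⟨1, ?_⟩⟩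
  · rw [IsScalarTower.algebraMap_apply A B Q]
    exact IsLocalization.map_units Q (⟨_, hB a.2⟩ : B⁰)
  · obtain ⟨⟨b, c, hc⟩, h⟩ := IsLocalization.surj B⁰ q
    obtain ⟨b', hb'⟩ := hsB b
    obtain ⟨c', hc'⟩ := hsB c
    refine ⟨⟨b', c', ?_⟩, ?_⟩
    · rw [mem_nonZeroDivisors_iff_right]
      intro a ha
      refine hAB ?_
      rw [map_zero]
      refine mem_nonZeroDivisors_iff_right.mp hc _ (hs _ ?_)
      rw [← Algebra.mul_smul_comm, ← hc', ← map_mul, ha, map_zero]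
    · rw [IsScalarTower.algebraMap_apply A B Q, IsScalarTower.algebraMap_apply A B Q, hb', hc',
        Algebra.smul_def, Algebra.smul_def, map_mul, map_mul, ← h]
      ring
  · rw [IsScalarTower.algebraMap_apply A B Q, IsScalarTower.algebraMap_apply A B Q] at h
    rw [hAB (IsFractionRing.injective B Q h)]

end Conductor

section Pinch

variable (K : Type u) [Field K] (m : ℕ)

lemma PinchRing.exists_algebraMap_eq_smul (b : PinchCover K m) :
    ∃ a : PinchRing K m, algebraMap _ (PinchCover K m) a = coord K m (.inl 1) • b := by
  obtain ⟨a, a', rfl⟩ := b.exists_eq_add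
  refine ⟨coord K m (.inl 1) * a + coord K m (.inl 0) * a', ?_⟩
  simp only [map_add, map_mul, algebraMap_coord_v, algebraMap_coord_u, Algebra.smul_def]
  ring

lemma PinchRing.eq_zero_of_smul (b : PinchCover K m) (hb : coord K m (.inl 1) • b = 0) : b = 0 := by
  rw [Algebra.smul_def, algebraMap_coord_v] at hb
  exact (mul_eq_zero.mp hb).resolve_left (MvPolynomial.X_ne_zero _)

variable {K}

/-- The base change of `B` to an étale chart. -/
lemma exists_isPinchChart (h2 : (2 : K) ≠ 0) {A B A' : Type u} [CommRing A] [CommRing B]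
    [CommRing A'] [Algebra A B] [Algebra A A'] [Algebra.Etale A A'] [Algebra (PinchRing K m) A']
    [Algebra.Etale (PinchRing K m) A'] [IsNoetherianRing A] [IsReduced A] [Algebra.IsIntegral A B]
    [IsIntegrallyClosed B] (hAB : Function.Injective (algebraMap A B)) {s : A}
    (hs : ∀ b : B, s • b = 0 → b = 0) (hsB : ∀ b : B, ∃ a : A, algebraMap A B a = s • b) :
    ∃ (v : A') (y : A' ⊗[A] B),
      IsPinchChart ((algebraMap (PinchRing K m) A').comp (algebraMap K (PinchRing K m)))
        (algebraMap A' (A' ⊗[A] B)) v y := by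
  let Q := FractionRing B
  let F := FractionRing (PinchCover K m)
  have : IsFractionRing A Q := isFractionRing_of_conductor hAB hs hsB Q
  have : IsArtinianRing Q := isArtinianRing_of_isFractionRing (A := A)
  have : IsFractionRing (PinchRing K m) F := isFractionRing_of_conductor
    (PinchRing.algebraMap_injective h2) (PinchRing.eq_zero_of_smul K m)
    (PinchRing.exists_algebraMap_eq_smul K m) F
  have : IsArtinianRing F := inferInstance
  have : IsIntegralClosure B A Q := inferInstance
  have : IsIntegralClosure (PinchCover K m) (PinchRing K m) F := inferInstance
  obtain ⟨e⟩ := nonempty_tensorProduct_algEquiv A Q B (PinchRing K m) F (PinchCover K m) A'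
  exact ⟨_, _, (isPinchChart_pinchCover h2 (A := A')).of_equiv e.symm.toRingEquiv
    fun a ↦ (e.symm.commutes a).symm⟩

end Pinch

end SemiSmooth



namespace SemiSmooth

/-! ### Faithfully flat descent of charts -/

open TensorProduct

section Descent

variable {A A' M N : Type*} [CommRing A] [CommRing A'] [Algebra A A'] [AddCommGroup M] [Module A M]
  [AddCommGroup N] [Module A N]

/-- Lying in the range is vanishing in the cokernel, which faithfully flat base change detects. -/
lemma mem_range_of_tmul_mem_range [Module.FaithfullyFlat A A'] (L : M →ₗ[A] N) {n : N}
    (h : (1 : A') ⊗ₜ[A] n ∈ LinearMap.range (L.lTensor A')) : n ∈ LinearMap.range L := by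
  rw [← Submodule.ker_mkQ (LinearMap.range L), LinearMap.mem_ker]
  refine (Module.FaithfullyFlat.one_tmul_eq_zero_iff A _ (A := A') _).mp ?_
  obtain ⟨x, hx⟩ := h
  rw [← LinearMap.lTensor_tmul, ← hx, ← LinearMap.comp_apply, ← LinearMap.lTensor_comp,
    LinearMap.range_mkQ_comp, LinearMap.lTensor_zero, LinearMap.zero_apply]

variable {ι : Type*} [Finite ι] (L : ι → M →ₗ[A] N)

omit [Finite ι] in
lemma piRight_lTensor_pi [Fintype ι] [DecidableEq ι] (x : A' ⊗[A] M) (i : ι) :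
    TensorProduct.piRight A A A' (fun _ : ι ↦ N) ((LinearMap.pi L).lTensor A' x) i =
      (L i).lTensor A' x := by
  induction x using TensorProduct.induction_on with
  | zero => simp
  | tmul a m => simp
  | add x y hx hy => simp only [map_add, Pi.add_apply, hx, hy]

/-- A finite system of linear equations over A that is solvable after faithfully flat base change is
solvable over A. -/
lemma exists_of_lTensor_eq [Module.FaithfullyFlat A A'] (t : ι → N) (x : A' ⊗[A] M)
    (hx : ∀ i, (L i).lTensor A' x = 1 ⊗ₜ t i) : ∃ m, ∀ i, L i m = t i := by
  classical
  have := Fintype.ofFinite ι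
  obtain ⟨m, hm⟩ := mem_range_of_tmul_mem_range (A' := A') (LinearMap.pi L) (n := t)
    ⟨x, (TensorProduct.piRight A A A' (fun _ : ι ↦ N)).injective (funext fun i ↦ by
      rw [piRight_lTensor_pi, hx, TensorProduct.piRight_apply]; rfl)⟩
  exact ⟨m, fun i ↦ congr_fun hm i⟩

lemma mem_range_lTensor_of_lTensor_eq_zero [Module.Flat A A'] (p : Submodule A M)
    (hp : ∀ m, (∀ i, L i m = 0) → m ∈ p) (x : A' ⊗[A] M) (hx : ∀ i, (L i).lTensor A' x = 0) :
    x ∈ LinearMap.range (p.subtype.lTensor A') := by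
  classical
  have := Fintype.ofFinite ι
  have h0 : (LinearMap.pi L).lTensor A' x = 0 :=
    (TensorProduct.piRight A A A' (fun _ : ι ↦ N)).injective (funext fun i ↦ by
      rw [piRight_lTensor_pi, hx, map_zero]; rfl)
  have hx' : x ∈ LinearMap.ker (AlgebraTensorModule.lTensor A A' (LinearMap.pi L)) := h0
  rw [Module.Flat.ker_lTensor_eq] at hx'
  obtain ⟨z, rfl⟩ := hx'
  have hle : LinearMap.ker (LinearMap.pi L) ≤ p := fun m hm ↦ hp m fun i ↦ congr_fun hm i
  refine ⟨(Submodule.inclusion hle).lTensor A' z, ?_⟩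
  rw [← LinearMap.comp_apply, ← LinearMap.lTensor_comp, Submodule.subtype_comp_inclusion]
  rfl

end Descent

section

attribute [local instance] Algebra.TensorProduct.rightAlgebra

variable {K A B A' : Type*} [CommRing K] [CommRing A] [CommRing B] [CommRing A'] [Algebra A B]
  [Algebra A A']

omit [CommRing K] in
lemma faithfullyFlat_rightAlgebra [Module.FaithfullyFlat A A'] :
    Module.FaithfullyFlat B (A' ⊗[A] B) :=
  .of_linearEquiv _ _ (Algebra.TensorProduct.commRight A B A').symm.toLinearEquiv

omit [CommRing K] in
lemma includeRight_injective_of_faithfullyFlat [Module.FaithfullyFlat A A'] :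
    Function.Injective (Algebra.TensorProduct.includeRight : B →ₐ[A] A' ⊗[A] B) :=
  Module.FaithfullyFlat.tensorProduct_mk_injective (A := A) (B := A') B

omit [CommRing K] in
lemma eq_zero_of_smul_tensorProduct [Module.Flat A A'] {s : A} (hs : ∀ b : B, s • b = 0 → b = 0)
    (b : A' ⊗[A] B) (hb : s • b = 0) : b = 0 := by
  have h1 : Function.Injective (LinearMap.lsmul A B s) :=
    (injective_iff_map_eq_zero _).mpr hs
  refine Module.Flat.lTensor_preserves_injective_linearMap (M := A') _ h1 ?_
  rw [map_zero, ← hb]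
  induction b using TensorProduct.induction_on with
  | zero => simp
  | tmul a b => simp
  | add b b' h h' =>
    have e (c : A' ⊗[A] B) : (LinearMap.lsmul A B s).lTensor A' c = s • c := by
      induction c using TensorProduct.induction_on with
      | zero => simp
      | tmul a b => simp
      | add c c' h h' => rw [map_add, h, h', smul_add]
    exact e _

/-- Let E extend d to A' ⊗ B. By the Leibniz rule s·E(b) = d(sb) - b·d(s) lies in B. Divisibility by
s descends, and s is a nonzerodivisor on A' ⊗ B, so E(b) itself lies in B. -/
lemma exists_extend_of_faithfullyFlat [Module.FaithfullyFlat A A'] [Algebra.FormallyEtale A A']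
    {κ : K →+* A}
    (h : ∀ d : A' →+ A', IsDer ((algebraMap A A').comp κ) (RingHom.id A') d →
      ∃ d' : A' ⊗[A] B →+ A' ⊗[A] B,
        IsDer ((algebraMap A' (A' ⊗[A] B)).comp ((algebraMap A A').comp κ)) (RingHom.id _) d' ∧
        ∀ a, d' (algebraMap A' _ a) = algebraMap A' _ (d a))
    {s : A} (hs : ∀ b : B, s • b = 0 → b = 0) (hsB : ∀ b : B, ∃ a : A, algebraMap A B a = s • b)
    {d : A →+ A} (hd : IsDer κ (RingHom.id A) d) :
    ∃ D : B →+ B, IsDer ((algebraMap A B).comp κ) (RingHom.id B) D ∧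
      ∀ a, D (algebraMap A B a) = algebraMap A B (d a) := by
  let ρ : B →ₐ[A] A' ⊗[A] B := Algebra.TensorProduct.includeRight
  have hρ : Function.Injective ρ := includeRight_injective_of_faithfullyFlat
  have hρa (a : A) : ρ (algebraMap A B a) = algebraMap A' (A' ⊗[A] B) (algebraMap A A' a) := by
    rw [AlgHom.commutes, ← IsScalarTower.algebraMap_apply]
  obtain ⟨e, he, hed⟩ := IsDer.exists_extend (ψ := RingHom.id A') (f := algebraMap A A')
    (RingHom.formallyEtale_algebraMap.mpr ‹_›) (hd.compRight (algebraMap A A'))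
  obtain ⟨E, hE, hEe⟩ := h e he
  have hEA (a : A) : E (ρ (algebraMap A B a)) = ρ (algebraMap A B (d a)) := by
    rw [hρa, hρa, hEe, hed]; rfl
  have key (b : B) : ∃ c, ρ c = E (ρ b) := by
    obtain ⟨a, ha⟩ := hsB b
    have h1 : E (ρ (algebraMap A B a)) = s • E (ρ b) + ρ b * ρ (algebraMap A B (d s)) := by
      rw [ha, map_smul, Algebra.smul_def, ← AlgHom.commutes ρ, hE.leibniz, hEA,
        AlgHom.commutes, RingHom.id_apply, RingHom.id_apply, Algebra.smul_def]
    have hlin (z : A' ⊗[A] B) : (LinearMap.lsmul A B s).lTensor A' z = s • z := by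
      induction z using TensorProduct.induction_on with
      | zero => simp
      | tmul a b => simp
      | add c c' h h' => rw [map_add, h, h', smul_add]
    obtain ⟨c, hc⟩ := mem_range_of_tmul_mem_range (A' := A') (LinearMap.lsmul A B s)
      (n := algebraMap A B (d a) - b * algebraMap A B (d s)) ⟨E (ρ b), by
        rw [hlin]
        change _ = ρ _
        rw [map_sub, map_mul, ← hEA, h1, add_sub_cancel_right]⟩
    refine ⟨c, ?_⟩
    rw [← sub_eq_zero]
    refine eq_zero_of_smul_tensorProduct hs _ ?_
    have hc' : s • c = algebraMap A B (d a) - b * algebraMap A B (d s) := hc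
    rw [smul_sub, ← map_smul, hc', map_sub, map_mul, ← hEA, h1, add_sub_cancel_right, sub_self]
  choose D hD using key
  refine ⟨AddMonoidHom.mk' D fun b b' ↦ hρ ?_, ⟨fun b b' ↦ hρ ?_, fun c ↦ hρ ?_⟩, fun a ↦ hρ ?_⟩
  · simp only [hD, map_add]
  · simp only [AddMonoidHom.mk'_apply, hD, map_mul, map_add, hE.leibniz, RingHom.id_apply]
  · rw [AddMonoidHom.mk'_apply, hD, map_zero]
    change E (ρ (algebraMap A B (κ c))) = 0
    rw [hρa]
    exact hE.map_const c
  · rw [AddMonoidHom.mk'_apply, hD, hEA]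

/-- Flatness descends, and a flat module that is finitely presented is projective. -/
lemma hasProjectiveDifferentials_of_faithfullyFlat {R S : Type*} [CommRing R] [CommRing S]
    [Algebra R S] [Module.FaithfullyFlat R S] [Algebra.FormallyEtale R S] [IsNoetherianRing R]
    {κ : K →+* R} (hκ : κ.FiniteType)
    (h : HasProjectiveDifferentials ((algebraMap R S).comp κ)) :
    HasProjectiveDifferentials κ := by
  algebraize [κ, (algebraMap R S).comp κ]
  obtain ⟨-, hp⟩ := h
  have hfin : Module.Finite R Ω[R⁄K] := inferInstance
  refine ⟨hfin, ?_⟩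
  have : IsScalarTower K R S := .of_algebraMap_eq' rfl
  have : Module.Flat S (S ⊗[R] Ω[R⁄K]) :=
    .of_linearEquiv (KaehlerDifferential.tensorKaehlerEquivOfFormallyEtale K R S)
  have : Module.Flat R Ω[R⁄K] := .of_flat_tensorProduct R _ S
  have : Module.FinitePresentation R Ω[R⁄K] := Module.finitePresentation_of_finite R _
  exact Module.Flat.projective_of_finitePresentation

lemma hasProjectiveDifferentials_of_faithfullyFlat_tensorProduct [Module.FaithfullyFlat A A']
    [Algebra.FormallyEtale A A'] [IsNoetherianRing B] {κ : K →+* A}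
    (hκ : ((algebraMap A B).comp κ).FiniteType)
    (h : HasProjectiveDifferentials ((algebraMap A' (A' ⊗[A] B)).comp ((algebraMap A A').comp κ))) :
    HasProjectiveDifferentials ((algebraMap A B).comp κ) := by
  have : Module.FaithfullyFlat B (A' ⊗[A] B) := faithfullyFlat_rightAlgebra
  have : Algebra.FormallyEtale B (A' ⊗[A] B) :=
    RingHom.formallyEtale_algebraMap.mp (formallyEtale_includeRight A A' B)
  refine hasProjectiveDifferentials_of_faithfullyFlat (S := A' ⊗[A] B) hκ ?_
  have : (algebraMap B (A' ⊗[A] B)).comp ((algebraMap A B).comp κ) =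
      (algebraMap A' (A' ⊗[A] B)).comp ((algebraMap A A').comp κ) :=
    RingHom.ext fun c ↦ (algebraMap_tmul_one (κ c)).symm
  rwa [this]

end

/-! ### The conductor after base change to a chart -/

section Conductor

variable {K A B A' : Type*} [CommRing K] [CommRing A] [CommRing B] [CommRing A'] [Algebra A B]
  [Algebra A A'] {κ : K →+* A'} {v : A'} {y : A' ⊗[A] B}
  (h : IsPinchChart κ (algebraMap A' (A' ⊗[A] B)) v y)

include h

/-- If c is in the conductor, then cy = a for some a in A'. From -a + cy = 0 independence of 1 and y
modulo v gives v ∣ a = cy, and then v ∣ c. -/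
lemma IsPinchChart.dvd_of_mem_ringConductor {c : A} (hc : c ∈ ringConductor (algebraMap A B)) :
    algebraMap A' (A' ⊗[A] B) v ∣ 1 ⊗ₜ algebraMap A B c := by
  have key (b : A' ⊗[A] B) : ∃ a : A', algebraMap A' _ a = 1 ⊗ₜ algebraMap A B c * b := by
    induction b using TensorProduct.induction_on with
    | zero => exact ⟨0, by simp⟩
    | tmul a b =>
      obtain ⟨a', ha'⟩ := hc b
      refine ⟨algebraMap A A' a' * a, ?_⟩
      rw [Algebra.TensorProduct.tmul_mul_tmul, ← ha', one_mul, map_mul]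
      change algebraMap A A' a' ⊗ₜ 1 * a ⊗ₜ 1 = _
      rw [algebraMap_tmul_one, Algebra.TensorProduct.tmul_mul_tmul, one_mul, mul_one]
    | add b b' hb hb' =>
      obtain ⟨a, ha⟩ := hb
      obtain ⟨a', ha'⟩ := hb'
      exact ⟨a + a', by rw [map_add, ha, ha', mul_add]⟩
  obtain ⟨a, ha⟩ := key y
  have h1 : algebraMap A' (A' ⊗[A] B) v ∣ algebraMap A' _ (-a) := by
    refine h.dvd_of_dvd_add _ (algebraMap A A' c) ?_
    have h2 : algebraMap A' (A' ⊗[A] B) (algebraMap A A' c) = 1 ⊗ₜ algebraMap A B c :=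
      algebraMap_tmul_one c
    rw [map_neg, ha, h2]
    simp
  refine h.dvd_of_dvd_mul _ ?_
  rw [mul_comm, ← ha]
  rwa [map_neg, dvd_neg] at h1

/-- The conductor is the kernel of a ↦ (a·bᵢ) from A to (B/A)ⁿ, for generators bᵢ of B, and kernels
commute with flat base change. Over A' the element v is in that kernel, because A' ⊗ B = A' + A'y
and vy = u comes from A'. -/
lemma IsPinchChart.mem_map_ringConductor [Module.Flat A A'] [Module.Finite A B] :
    v ∈ (ringConductor (algebraMap A B)).map (algebraMap A A') := by
  obtain ⟨n, b, hb⟩ := Module.Finite.exists_fin (R := A) (M := B)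
  let N := B ⧸ LinearMap.range (Algebra.linearMap A B)
  let L (i : Fin n) : A →ₗ[A] N :=
    (LinearMap.range (Algebra.linearMap A B)).mkQ ∘ₗ LinearMap.toSpanSingleton A B (b i)
  have hL (a : A) (ha : ∀ i, L i a = 0) : a ∈ ringConductor (algebraMap A B) := by
    intro c
    have hc : c ∈ Submodule.span A (Set.range b) := hb ▸ trivial
    induction hc using Submodule.span_induction with
    | mem x hx =>
      obtain ⟨i, rfl⟩ := hx
      obtain ⟨a', ha'⟩ := (Submodule.Quotient.mk_eq_zero _).mp (ha i)
      exact ⟨a', ha'.trans (Algebra.smul_def _ _)⟩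
    | zero => simp
    | add x y _ _ hx hy => rw [mul_add]; exact (algebraMap A B).range.add_mem hx hy
    | smul c x _ hx =>
      rw [Algebra.smul_def, mul_left_comm]
      exact (algebraMap A B).range.mul_mem ⟨c, rfl⟩ hx
  obtain ⟨u, hu⟩ := h.exists_conductor
  obtain ⟨z, hz⟩ := mem_range_lTensor_of_lTensor_eq_zero L (ringConductor (algebraMap A B)) hL
    (v ⊗ₜ 1 : A' ⊗[A] A) fun i ↦ by
      obtain ⟨a, a', haa⟩ := h.exists_eq_add (1 ⊗ₜ b i)
      have h1 : v ⊗ₜ b i = algebraMap A' (A' ⊗[A] B) (v * a + u * a') := by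
        rw [map_add, map_mul, map_mul, hu]
        have : v ⊗ₜ[A] b i = algebraMap A' (A' ⊗[A] B) v * 1 ⊗ₜ b i := by
          simp
        rw [this, haa]; ring
      have h2 : algebraMap A' (A' ⊗[A] B) (v * a + u * a') =
          (Algebra.linearMap A B).lTensor A' ((v * a + u * a') ⊗ₜ 1) := by simp
      rw [LinearMap.lTensor_tmul]
      change v ⊗ₜ (LinearMap.range (Algebra.linearMap A B)).mkQ ((1 : A) • b i) = 0
      rw [one_smul, ← LinearMap.lTensor_tmul, h1, h2, ← LinearMap.comp_apply,
        ← LinearMap.lTensor_comp, LinearMap.range_mkQ_comp, LinearMap.lTensor_zero,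
        LinearMap.zero_apply]
  have key (z : A' ⊗[A] (ringConductor (algebraMap A B))) :
      TensorProduct.rid A A' ((ringConductor (algebraMap A B)).subtype.lTensor A' z) ∈
        (ringConductor (algebraMap A B)).map (algebraMap A A') := by
    induction z using TensorProduct.induction_on with
    | zero => simp
    | tmul a c =>
      rw [LinearMap.lTensor_tmul, TensorProduct.rid_tmul, Algebra.smul_def, mul_comm]
      exact Ideal.mul_mem_left _ _ (Ideal.mem_map_of_mem _ c.2)
    | add z z' h h' => rw [map_add, map_add]; exact add_mem h h'
  have := key z
  rwa [hz, TensorProduct.rid_tmul, one_smul] at this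

end Conductor

end SemiSmooth



namespace SemiSmooth

/-! ### Double covers and their involutions -/

open TensorProduct

/-- The `R`-algebra `S` is generated by a nonzerodivisor `y` with `y² ∈ R`, and `1`, `y` are
independent over the image of `R`. -/
structure IsDoubleCover {R S : Type*} [CommRing R] [CommRing S] (φ : R →+* S) (y : S) : Prop where
  isUnit_two : IsUnit (2 : S)
  exists_sq : ∃ w, φ w = y ^ 2
  exists_eq_add (b : S) : ∃ a a', b = φ a + φ a' * y
  eq_zero_of_add (a a' : R) : φ a + φ a' * y = 0 → φ a = 0
  eq_zero_of_mul (b : S) : y * b = 0 → b = 0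

namespace IsDoubleCover

section

variable {R S : Type*} [CommRing R] [CommRing S] {φ : R →+* S} {y : S} (h : IsDoubleCover φ y)
include h

lemma eq_zero_of_two_mul {b : S} (hb : 2 * b = 0) : b = 0 :=
  h.isUnit_two.mul_right_eq_zero.mp hb

lemma eq_of_add_eq {a a' c c' : R} (hac : φ a + φ a' * y = φ c + φ c' * y) :
    φ a = φ c ∧ φ a' = φ c' := by
  have h1 : φ (a - c) = 0 := h.eq_zero_of_add _ (a' - c') (by
    rw [map_sub, map_sub]; linear_combination hac)
  have h2 : φ (a' - c') = 0 := h.eq_zero_of_mul _ (by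
    rw [map_sub] at h1 ⊢; linear_combination hac - h1)
  rw [map_sub, sub_eq_zero] at h1 h2
  exact ⟨h1, h2⟩

/-- The map a + a'y ↦ a - a'y is well defined since the images of a and a' in S are determined; it
is multiplicative since y² comes from R. -/
lemma exists_involution : ∃ σ : S →+* S, (∀ a, σ (φ a) = φ a) ∧ σ y = -y := by
  choose c c' hc using h.exists_eq_add
  obtain ⟨w, hw⟩ := h.exists_sq
  have key (a a' : R) : φ (c (φ a + φ a' * y)) - φ (c' (φ a + φ a' * y)) * y = φ a - φ a' * y := by
    obtain ⟨h1, h2⟩ := h.eq_of_add_eq (hc (φ a + φ a' * y))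
    rw [← h1, ← h2]
  let σ (b : S) : S := φ (c b) - φ (c' b) * y
  have hσ (a a' : R) : σ (φ a + φ a' * y) = φ a - φ a' * y := key a a'
  have hφ (a : R) : σ (φ a) = φ a := by simpa using hσ a 0
  refine ⟨⟨⟨⟨σ, by simpa using hφ 1⟩, fun b b' ↦ ?_⟩, by simpa using hφ 0, fun b b' ↦ ?_⟩, hφ,
    by simpa using hσ 0 1⟩
  · obtain ⟨a, a', rfl⟩ := h.exists_eq_add b
    obtain ⟨d, d', rfl⟩ := h.exists_eq_add b'
    have : (φ a + φ a' * y) * (φ d + φ d' * y) =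
        φ (a * d + a' * d' * w) + φ (a * d' + a' * d) * y := by
      simp only [map_add, map_mul, hw]; ring
    dsimp only
    rw [this, hσ, hσ, hσ]
    simp only [map_add, map_mul, hw]; ring
  · obtain ⟨a, a', rfl⟩ := h.exists_eq_add b
    obtain ⟨d, d', rfl⟩ := h.exists_eq_add b'
    have : (φ a + φ a' * y) + (φ d + φ d' * y) = φ (a + d) + φ (a' + d') * y := by
      simp only [map_add]; ring
    dsimp only
    rw [this, hσ, hσ, hσ]
    simp only [map_add]; ring

/-- The element r = y + τ(y) is invariant, so it comes from R. From τ(y)² = y² follows r² - 2ry = 0.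
Independence of 1 and y gives r² = 0, then 2r = 0, hence r = 0. -/
lemma map_eq_neg {τ : S →+* S} (hτφ : ∀ a, τ (φ a) = φ a) (hτ : τ (τ y) = y)
    (hinv : ∀ b, τ b = b → ∃ a, φ a = b) : τ y = -y := by
  obtain ⟨r, hr⟩ := hinv (y + τ y) (by rw [map_add, hτ, add_comm])
  obtain ⟨w, hw⟩ := h.exists_sq
  have h1 : τ y ^ 2 = y ^ 2 := by rw [← map_pow, ← hw, hτφ]
  have h2 : φ (r ^ 2) + φ (-(2 * r)) * y = 0 := by
    rw [map_pow, map_neg, map_mul, map_ofNat, hr]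
    linear_combination h1
  have h3 := h.eq_zero_of_add _ _ h2
  rw [h3, zero_add, map_neg, neg_mul, neg_eq_zero, mul_comm] at h2
  have h4 := h.eq_zero_of_mul _ h2
  rw [map_mul, map_ofNat] at h4
  have h5 := h.eq_zero_of_two_mul h4
  rw [hr] at h5
  exact eq_neg_of_add_eq_zero_right h5

lemma eq_of_map_y {σ τ : S →+* S} (hσ : ∀ a, σ (φ a) = φ a) (hτ : ∀ a, τ (φ a) = φ a)
    (hy : σ y = τ y) : σ = τ := by
  ext b
  obtain ⟨a, a', rfl⟩ := h.exists_eq_add b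
  rw [map_add, map_add, map_mul, map_mul, hσ, hσ, hτ, hτ, hy]

lemma exists_eq_of_map_eq {σ : S →+* S} (hσ : ∀ a, σ (φ a) = φ a) (hy : σ y = -y) {b : S}
    (hb : σ b = b) : ∃ a, φ a = b := by
  obtain ⟨a, a', rfl⟩ := h.exists_eq_add b
  rw [map_add, map_mul, hσ, hσ, hy] at hb
  have h1 : φ a' * y = 0 := h.eq_zero_of_two_mul (by linear_combination -hb)
  exact ⟨a, by rw [h1, add_zero]⟩

end

section

variable {R S : Type*} [CommRing R] [CommRing S] [Algebra R S] {y : S}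
  (h : IsDoubleCover (algebraMap R S) y) {σ : S →ₐ[R] S} (hy : σ y = -y)
include h hy

/-- This characterizes σ(b) by linear equations in which neither σ nor y occurs on the known side,
so they make sense before base change. Expanding b and z in 1 and y, the identity rests only on y² ⊗
1 = 1 ⊗ y². -/
lemma tmul_sub_tmul (b z : S) :
    σ b ⊗ₜ[R] z - (σ b * z) ⊗ₜ 1 = 1 ⊗ₜ (b * z) - z ⊗ₜ b := by
  let l : S →ₐ[R] S ⊗[R] S := Algebra.TensorProduct.includeLeft
  let r : S →ₐ[R] S ⊗[R] S := Algebra.TensorProduct.includeRight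
  have hlr (s s' : S) : s ⊗ₜ[R] s' = l s * r s' := by
    simp [l, r]
  have h1 : (1 : S ⊗[R] S) = l 1 := rfl
  obtain ⟨w, hw⟩ := h.exists_sq
  have hw' : l y ^ 2 = r y ^ 2 := by
    rw [← map_pow, ← map_pow, ← hw, AlgHom.commutes, AlgHom.commutes]
  obtain ⟨a, a', rfl⟩ := h.exists_eq_add b
  obtain ⟨c, c', rfl⟩ := h.exists_eq_add z
  simp only [hlr, map_add, map_mul, AlgHom.commutes, hy, map_neg, map_one]
  linear_combination algebraMap R (S ⊗[R] S) a' * algebraMap R (S ⊗[R] S) c' * hw'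

/-- Applying s ⊗ s' ↦ s·σ(s') to the equation for z = y gives -2sy = -2y·σ(b), and 2 and y can be
cancelled. -/
lemma eq_of_tmul_sub_tmul {b s : S}
    (hs : s ⊗ₜ[R] y - (s * y) ⊗ₜ 1 = 1 ⊗ₜ (b * y) - y ⊗ₜ b) : s = σ b := by
  have h1 := congr(Algebra.TensorProduct.lift (AlgHom.id R S) σ (fun _ _ ↦ Commute.all _ _) $hs)
  simp only [map_sub, Algebra.TensorProduct.lift_tmul, AlgHom.coe_id, id_eq, map_mul, hy,
    map_one] at h1
  rw [← sub_eq_zero]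
  exact h.eq_zero_of_mul _ (h.eq_zero_of_two_mul (by linear_combination -h1))

end

section Descent

variable {A A' S : Type*} [CommRing A] [CommRing A'] [CommRing S] [Algebra A A'] [Algebra A S]
  [Module.FaithfullyFlat A A'] {y : A' ⊗[A] S}
  (h : IsDoubleCover (algebraMap A' (A' ⊗[A] S)) y)
include h

/-- For z running through module generators of S, the equations of `tmul_sub_tmul` form a finite
linear system over A with right-hand side from A. It is solved over A' by σ(1 ⊗ b), so it has a
solution over A, and this equals σ(1 ⊗ b) by uniqueness. -/
lemma exists_includeRight_eq [Module.Finite A S] {σ : A' ⊗[A] S →ₐ[A'] A' ⊗[A] S} (hy : σ y = -y)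
    (b : S) : ∃ s, (1 : A') ⊗ₜ[A] s = σ (1 ⊗ₜ b) := by
  obtain ⟨n, z, hz⟩ := Module.Finite.exists_fin (R := A) (M := S)
  let D := AlgebraTensorModule.distribBaseChange A A' S S
  let L (z : S) : S →ₗ[A] S ⊗[A] S := (TensorProduct.mk A S S).flip z -
    (TensorProduct.mk A S S).flip 1 ∘ₗ LinearMap.mulRight A z
  have hL (z s : S) : L z s = s ⊗ₜ z - (s * z) ⊗ₜ 1 := rfl
  let t (z : S) : S ⊗[A] S := 1 ⊗ₜ (b * z) - z ⊗ₜ b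
  have hD (z : S) (x : A' ⊗[A] S) :
      D ((L z).lTensor A' x) = x ⊗ₜ (1 ⊗ₜ z) - (x * 1 ⊗ₜ z) ⊗ₜ 1 := by
    induction x using TensorProduct.induction_on with
    | zero => simp
    | tmul a s =>
      rw [LinearMap.lTensor_tmul, hL, tmul_sub, map_sub,
        AlgebraTensorModule.distribBaseChange_tmul, AlgebraTensorModule.distribBaseChange_tmul,
        Algebra.TensorProduct.tmul_mul_tmul, mul_one]
      rfl
    | add x x' hx hx' =>
      rw [map_add, map_add, hx, hx', add_mul, add_tmul, add_tmul]
      abel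
  have ht (z : S) : D (1 ⊗ₜ t z) =
      1 ⊗ₜ (1 ⊗ₜ b * 1 ⊗ₜ z) - (1 ⊗ₜ z) ⊗ₜ (1 ⊗ₜ b) := by
    rw [tmul_sub, map_sub,
      AlgebraTensorModule.distribBaseChange_tmul, AlgebraTensorModule.distribBaseChange_tmul,
      Algebra.TensorProduct.tmul_mul_tmul, mul_one]
    rfl
  obtain ⟨s, hs⟩ := exists_of_lTensor_eq (A' := A') (fun i ↦ L (z i)) (fun i ↦ t (z i))
    (σ (1 ⊗ₜ b)) fun i ↦ D.injective (by rw [hD, ht, h.tmul_sub_tmul hy])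
  have hs' (z' : S) : L z' s = t z' := by
    have hz' : z' ∈ Submodule.span A (Set.range z) := hz ▸ trivial
    simp only [hL, t] at hs ⊢
    induction hz' using Submodule.span_induction with
    | mem x hx =>
      obtain ⟨i, rfl⟩ := hx
      exact hs i
    | zero => simp
    | add x x' _ _ hx hx' =>
      simp only [tmul_add, mul_add, add_tmul]
      linear_combination (exp := 1) hx + hx'
    | smul c x _ hx =>
      simp only [tmul_smul, mul_smul_comm, ← smul_tmul', ← smul_sub, hx]
  have key (x : A' ⊗[A] S) : (1 ⊗ₜ s) ⊗ₜ[A'] x - (1 ⊗ₜ s * x) ⊗ₜ 1 = 1 ⊗ₜ (1 ⊗ₜ b * x) - x ⊗ₜ (1 ⊗ₜ b) := by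
    induction x using TensorProduct.induction_on with
    | zero => simp
    | tmul a z =>
      have h1 : a ⊗ₜ[A] z = a • (1 ⊗ₜ z) := by rw [smul_tmul', smul_eq_mul, mul_one]
      have h2 := congr(D (1 ⊗ₜ $(hs' z)))
      rw [ht, ← LinearMap.lTensor_tmul, hD] at h2
      have h3 := congr(a • $h2)
      rw [smul_sub, smul_sub] at h3
      simp only [h1, tmul_smul, mul_smul_comm, ← smul_tmul']
      exact h3
    | add x x' hx hx' =>
      simp only [tmul_add, mul_add, add_tmul]
      linear_combination (exp := 1) hx + hx'
  exact ⟨s, h.eq_of_tmul_sub_tmul hy (key y)⟩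

/-- The model involution descends by `exists_includeRight_eq`. For any competitor τ, the base change
has invariants A', so `map_eq_neg` forces y ↦ -y. -/
lemma exists_unique_involution [Module.Finite A S] :
    ∃ σ : S →ₐ[A] S, (∀ b, σ (σ b) = b) ∧ (∀ b, σ b = b → ∃ a, algebraMap A S a = b) ∧
      ∀ τ : S →ₐ[A] S, (∀ b, τ (τ b) = b) → (∀ b, τ b = b → ∃ a, algebraMap A S a = b) → τ = σ := by
  obtain ⟨σ₀, hσ₀, hy₀⟩ := h.exists_involution
  let σ' : A' ⊗[A] S →ₐ[A'] A' ⊗[A] S := ⟨σ₀, hσ₀⟩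
  have hy : σ' y = -y := hy₀
  let ρ : S →ₐ[A] A' ⊗[A] S := Algebra.TensorProduct.includeRight
  have hρ : Function.Injective ρ := includeRight_injective_of_faithfullyFlat
  have hρA (a : A) : ρ (algebraMap A S a) = algebraMap A' _ (algebraMap A A' a) :=
    (algebraMap_tmul_one a).symm
  choose σ hσ using h.exists_includeRight_eq hy
  replace hσ (b : S) : ρ (σ b) = σ' (ρ b) := hσ b
  have hσσ : σ₀.comp σ₀ = RingHom.id _ := h.eq_of_map_y
    (fun a ↦ by rw [RingHom.comp_apply, hσ₀, hσ₀]) (fun a ↦ rfl)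
    (by rw [RingHom.comp_apply, hy₀, map_neg, hy₀, neg_neg, RingHom.id_apply])
  have hdesc (b : S) (hb : ∃ a, algebraMap A' _ a = ρ b) : ∃ a, algebraMap A S a = b := by
    obtain ⟨a, ha⟩ := hb
    exact mem_range_of_tmul_mem_range (A' := A') (Algebra.linearMap A S)
      ⟨a ⊗ₜ 1, by rw [LinearMap.lTensor_tmul, Algebra.linearMap_apply, map_one]; exact ha⟩
  let σS : S →ₐ[A] S :=
    { toFun := σ
      map_one' := hρ (by simp [hσ])
      map_mul' := fun b b' ↦ hρ (by simp [hσ])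
      map_zero' := hρ (by simp [hσ])
      map_add' := fun b b' ↦ hρ (by simp [hσ])
      commutes' := fun a ↦ hρ (by rw [hσ, hρA, AlgHom.commutes]) }
  refine ⟨σS, fun b ↦ hρ ?_, fun b hb ↦ hdesc b ?_, fun τ hτ hτinv ↦ ?_⟩
  · change ρ (σ (σ b)) = ρ b
    rw [hσ, hσ]
    exact congr($hσσ (ρ b))
  · refine h.exists_eq_of_map_eq hσ₀ hy₀ ?_
    change σ' (ρ b) = ρ b
    rw [← hσ]
    exact congr(ρ $hb)
  · let τ' : A' ⊗[A] S →ₐ[A'] A' ⊗[A] S := Algebra.TensorProduct.map (AlgHom.id A' A') τ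
    have hττ : τ'.comp τ' = AlgHom.id _ _ := by
      ext b
      change (1 : A') ⊗ₜ[A] τ (τ b) = 1 ⊗ₜ b
      rw [hτ]
    have hinv (b : A' ⊗[A] S) (hb : τ' b = b) : ∃ a, algebraMap A' _ a = b := by
      -- The invariants of τ are the kernel of τ - 1, and kernels commute with flat base change.
      have h1 (z : A' ⊗[A] S) :
          (τ.toLinearMap - LinearMap.id).lTensor A' z = τ' z - z := by
        rw [LinearMap.lTensor_sub, LinearMap.lTensor_id]; rfl
      obtain ⟨z, rfl⟩ := mem_range_lTensor_of_lTensor_eq_zero (A' := A')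
        (fun _ : Unit ↦ τ.toLinearMap - LinearMap.id) (LinearMap.range (Algebra.linearMap A S))
        (fun b hb ↦ hτinv b (sub_eq_zero.mp (hb ()))) b (fun _ ↦ by rw [h1, hb, sub_self])
      clear hb h1
      induction z using TensorProduct.induction_on with
      | zero => exact ⟨0, by simp⟩
      | tmul a b =>
        obtain ⟨_, c, rfl⟩ := b
        refine ⟨algebraMap A A' c * a, ?_⟩
        rw [LinearMap.lTensor_tmul, ← Algebra.smul_def]
        change (c • a) ⊗ₜ 1 = a ⊗ₜ algebraMap A S c
        rw [smul_tmul, Algebra.algebraMap_eq_smul_one]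
      | add z z' hz hz' =>
        obtain ⟨a, ha⟩ := hz
        obtain ⟨a', ha'⟩ := hz'
        exact ⟨a + a', by rw [map_add, map_add, ha, ha']⟩
    have hτy : τ' y = -y := h.map_eq_neg (τ := τ'.toRingHom) τ'.commutes congr($hττ y) hinv
    have hτσ : τ'.toRingHom = σ₀ := h.eq_of_map_y τ'.commutes hσ₀ (hτy.trans hy₀.symm)
    ext b
    exact hρ ((congr($hτσ (ρ b)) : τ' (ρ b) = σ' (ρ b)).trans (hσ b).symm)

/-- The extension E of e to A' ⊗ S vanishes on A' by étaleness. As y² comes from A', 2y·E(y) = 0, so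
E(y) = 0 and E = 0. -/
lemma isDer_eq_zero [Algebra.FormallyEtale A A'] {K : Type*} [CommRing K] {κ : K →+* A}
    {e : S →+ S} (he : IsDer ((algebraMap A S).comp κ) (RingHom.id S) e)
    (heA : ∀ a, e (algebraMap A S a) = 0) : e = 0 := by
  let ρ : S →+* A' ⊗[A] S := (Algebra.TensorProduct.includeRight : S →ₐ[A] A' ⊗[A] S).toRingHom
  have hρ : Function.Injective ρ := includeRight_injective_of_faithfullyFlat
  have hρA : ρ.comp (algebraMap A S) = (algebraMap A' _).comp (algebraMap A A') :=
    RingHom.ext fun a ↦ (algebraMap_tmul_one a).symm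
  obtain ⟨E, hE, hEe⟩ := IsDer.exists_extend (ψ := RingHom.id _)
    (formallyEtale_includeRight A A' S) (he.compRight ρ)
  have hE' : IsDer ((algebraMap A' _).comp ((algebraMap A A').comp κ))
      (RingHom.id (A' ⊗[A] S)) E := by
    rw [← RingHom.comp_assoc, ← hρA]; exact hE
  have h0 : IsDer ((algebraMap A A').comp κ) (algebraMap A' (A' ⊗[A] S)) (0 : A' →+ A' ⊗[A] S) :=
    ⟨by simp, by simp⟩
  have hEA' : E.comp (algebraMap A' (A' ⊗[A] S)).toAddMonoidHom = 0 :=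
    IsDer.eq_of_formallyEtale (RingHom.formallyEtale_algebraMap.mpr ‹_›)
      (hE'.compLeft (ψ := RingHom.id _)) h0 fun a ↦ by
        change E (algebraMap A' _ (algebraMap A A' a)) = 0
        have h1 : algebraMap A' _ (algebraMap A A' a) = ρ (algebraMap A S a) :=
          algebraMap_tmul_one a
        rw [h1]
        refine (hEe _).trans ?_
        rw [AddMonoidHom.comp_apply, heA, map_zero]
  have hEA (a : A') : E (algebraMap A' _ a) = 0 := congr($hEA' a)
  obtain ⟨w, hw⟩ := h.exists_sq
  have hEy : E y = 0 := by
    have h1 := hEA w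
    rw [hw, pow_two, hE.leibniz, RingHom.id_apply] at h1
    exact h.eq_zero_of_mul _ (h.eq_zero_of_two_mul (by linear_combination h1))
  have hE0 (z : A' ⊗[A] S) : E z = 0 := by
    obtain ⟨a, a', rfl⟩ := h.exists_eq_add z
    rw [map_add, hE.leibniz, hEA, hEA, hEy, mul_zero, mul_zero, add_zero, add_zero]
  ext b
  refine hρ ?_
  rw [AddMonoidHom.zero_apply, map_zero, ← hE0 (ρ b)]
  exact (hEe b).symm

end Descent

end IsDoubleCover

lemma lTensor_surjective_and_ker {A B S : Type*} (A' : Type*) [CommRing A] [CommRing B]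
    [CommRing A'] [CommRing S] [Algebra A B] [Algebra A A'] [Algebra A S] {q : B →ₐ[A] S}
    (hq : Function.Surjective q) :
    Function.Surjective (Algebra.TensorProduct.map (AlgHom.id A' A') q) ∧
      ∀ z, Algebra.TensorProduct.map (AlgHom.id A' A') q z = 0 ↔
        z ∈ (RingHom.ker q).map (Algebra.TensorProduct.includeRight : B →ₐ[A] A' ⊗[A] B) := by
  refine ⟨LinearMap.lTensor_surjective A' (g := q.toLinearMap) hq, fun z ↦ ?_⟩
  exact SetLike.ext_iff.mp (Algebra.TensorProduct.lTensor_ker (A := A') q hq) z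

/-- The two comparisons of the conductor with v show that the kernel of B' → S' is generated by v,
where B' = A' ⊗ B and S' = A' ⊗ S. The chart properties modulo v are then those of a double cover.
-/
lemma IsPinchChart.isDoubleCover {K A B A' S : Type*} [CommRing K] [CommRing A] [CommRing B]
    [CommRing A'] [CommRing S] [Algebra A B] [Algebra A A'] [Algebra A S] [Module.Flat A A']
    [Module.Finite A B] {κ : K →+* A'}
    {v : A'} {y : A' ⊗[A] B} (h : IsPinchChart κ (algebraMap A' (A' ⊗[A] B)) v y)
    {q : B →ₐ[A] S} (hq : Function.Surjective q)
    (hker : ∀ b, q b = 0 ↔ ∃ c ∈ ringConductor (algebraMap A B), algebraMap A B c = b) :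
    IsDoubleCover (algebraMap A' (A' ⊗[A] S))
      (Algebra.TensorProduct.map (AlgHom.id A' A') q y) := by
  obtain ⟨hq's, hq'⟩ := lTensor_surjective_and_ker A' hq
  generalize Algebra.TensorProduct.map (AlgHom.id A' A') q = q' at hq's hq' ⊢
  replace hq' (z : A' ⊗[A] B) : q' z = 0 ↔ algebraMap A' _ v ∣ z := by
    refine (hq' z).trans ?_
    rw [← Ideal.mem_span_singleton]
    refine ⟨fun h2 ↦ (Ideal.map_le_iff_le_comap.mpr fun b hb ↦ ?_) h2, fun h2 ↦
      (Ideal.span_le.mpr (Set.singleton_subset_iff.mpr ?_)) h2⟩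
    · obtain ⟨c, hc, rfl⟩ := (hker b).mp hb
      exact Ideal.mem_span_singleton.mpr (h.dvd_of_mem_ringConductor hc)
    · have h3 : (ringConductor (algebraMap A B)).map (algebraMap A A') ≤
          ((RingHom.ker q).map (Algebra.TensorProduct.includeRight : B →ₐ[A] A' ⊗[A] B)).comap
            (algebraMap A' (A' ⊗[A] B)) := by
        refine Ideal.map_le_iff_le_comap.mpr fun c hc ↦ ?_
        have h4 : algebraMap A' (A' ⊗[A] B) (algebraMap A A' c) =
          (Algebra.TensorProduct.includeRight : B →ₐ[A] A' ⊗[A] B) (algebraMap A B c) :=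
            algebraMap_tmul_one c
        rw [Ideal.mem_comap, Ideal.mem_comap, h4]
        exact Ideal.mem_map_of_mem _ ((hker _).mpr ⟨c, hc, rfl⟩)
      exact h3 h.mem_map_ringConductor
  refine ⟨?_, ?_, fun b ↦ ?_, fun a a' haa ↦ ?_, fun b hb ↦ ?_⟩
  · have := h.isUnit_two.map (algebraMap A' (A' ⊗[A] S))
    rwa [map_ofNat] at this
  · obtain ⟨w, hw⟩ := h.exists_sq
    exact ⟨w, by rw [← map_pow, ← hw, AlgHom.commutes]⟩
  · obtain ⟨b, rfl⟩ := hq's b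
    obtain ⟨a, a', rfl⟩ := h.exists_eq_add b
    exact ⟨a, a', by rw [map_add, map_mul, AlgHom.commutes, AlgHom.commutes]⟩
  · rw [← AlgHom.commutes q', ← AlgHom.commutes q', ← map_mul, ← map_add, hq'] at haa
    rw [← AlgHom.commutes q', hq']
    exact h.dvd_of_dvd_add _ _ haa
  · obtain ⟨b, rfl⟩ := hq's b
    rw [← map_mul, hq'] at hb
    exact (hq' _).mpr (h.dvd_of_dvd_mul _ hb)

end SemiSmooth



namespace SemiSmooth

/-! ### Integrally closed rings -/

open TensorProduct
open scoped nonZeroDivisors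

/-- The integral closure of A in A ⊗ Frac P is A ⊗ P = A, and A ⊗ Frac P is the total fraction ring
of A. -/
lemma isIntegrallyClosed_of_etale (P A : Type u) [CommRing P] [IsDomain P] [IsIntegrallyClosed P]
    [CommRing A] [Algebra P A] [Algebra.Etale P A] : IsIntegrallyClosed A := by
  have := isFractionRing_tensorProduct P (FractionRing P) A
  obtain ⟨e⟩ := exists_equiv_integralClosure_tensorProduct P (FractionRing P) A P
  refine (isIntegrallyClosed_iff (A ⊗[P] FractionRing P)).mpr fun {x} hx ↦ ?_
  obtain ⟨z, hz⟩ := e.surjective ⟨x, hx⟩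
  have hs : Function.Surjective (algebraMap A (A ⊗[P] P)) :=
    (Algebra.TensorProduct.rid P A A).symm.surjective
  obtain ⟨a, rfl⟩ := hs z
  rw [e.commutes] at hz
  exact ⟨a, congr(($hz : A ⊗[P] FractionRing P))⟩

lemma algebraMap_surjective_of_isIntegrallyClosed {A B : Type*} [CommRing A] [CommRing B]
    [Algebra A B] [IsIntegrallyClosed A] [Algebra.IsIntegral A B]
    (hAB : Function.Injective (algebraMap A B)) {s : A} (hs : ∀ b : B, s • b = 0 → b = 0)
    (hsB : ∀ b : B, ∃ a : A, algebraMap A B a = s • b) :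
    Function.Surjective (algebraMap A B) := by
  have := isFractionRing_of_conductor hAB hs hsB (FractionRing B)
  intro b
  obtain ⟨a, ha⟩ := (isIntegrallyClosed_iff (FractionRing B)).mp ‹IsIntegrallyClosed A›
    ((Algebra.IsIntegral.isIntegral (R := A) b).map (IsScalarTower.toAlgHom A B (FractionRing B)))
  refine ⟨a, IsFractionRing.injective B (FractionRing B) ?_⟩
  rw [← IsScalarTower.algebraMap_apply]
  exact ha

/-- If b is not from A, the ideal of all a with ab in A lies in a maximal ideal m. Near m the ring A
is étale over affine space, so some A_f with f outside m is integrally closed and b becomes an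
element of A_f. Then a power of f lies in the ideal, hence in m, a contradiction. -/
lemma algebraMap_surjective_of_smooth (K : Type u) {A B : Type u} [Field K] [CommRing A]
    [CommRing B] [Algebra K A] [Algebra.Smooth K A] [Algebra A B] [Algebra.IsIntegral A B]
    (hAB : Function.Injective (algebraMap A B)) {s : A} (hs : ∀ b : B, s • b = 0 → b = 0)
    (hsB : ∀ b : B, ∃ a : A, algebraMap A B a = s • b) :
    Function.Surjective (algebraMap A B) := by
  intro b
  let L := Algebra.linearMap A B
  let I : Ideal A := (LinearMap.range L).comap (LinearMap.toSpanSingleton A B b)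
  suffices h : I = ⊤ by
    have h1 : (1 : A) ∈ I := h ▸ trivial
    obtain ⟨a, ha⟩ := h1
    exact ⟨a, ha.trans (one_smul _ _)⟩
  by_contra hI
  obtain ⟨m, hm, hIm⟩ := I.exists_le_maximal hI
  obtain ⟨f, hf, n, _, _, _⟩ := Algebra.IsSmoothAt.exists_isStandardEtale_mvPolynomial
    (R := K) (p := m)
  let Af := Localization.Away f
  have : IsIntegrallyClosed Af := isIntegrallyClosed_of_etale (MvPolynomial (Fin n) K) Af
  have hAB' : Function.Injective (algebraMap Af (Af ⊗[A] B)) := by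
    refine (injective_iff_map_eq_zero _).mpr fun a ha ↦ ?_
    have h1 := Module.Flat.lTensor_preserves_injective_linearMap (M := Af) L hAB
    have h2 : a ⊗ₜ[A] (1 : A) = 0 := h1 (by
      rw [LinearMap.lTensor_tmul, map_zero, Algebra.linearMap_apply, map_one]; exact ha)
    have h3 := congr(TensorProduct.rid A Af $h2)
    rwa [TensorProduct.rid_tmul, one_smul, map_zero] at h3
  have hsB' (z : Af ⊗[A] B) : ∃ a : Af, algebraMap Af (Af ⊗[A] B) a = algebraMap A Af s • z := by
    induction z using TensorProduct.induction_on with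
    | zero => exact ⟨0, by simp⟩
    | tmul a b =>
      obtain ⟨c, hc⟩ := hsB b
      refine ⟨c • a, ?_⟩
      rw [algebraMap_smul, ← tmul_smul, ← hc, Algebra.algebraMap_eq_smul_one (A := B), ← smul_tmul]
      rfl
    | add z z' hz hz' =>
      obtain ⟨a, ha⟩ := hz
      obtain ⟨a', ha'⟩ := hz'
      exact ⟨a + a', by rw [map_add, ha, ha', smul_add]⟩
  have hsurj := algebraMap_surjective_of_isIntegrallyClosed hAB'
    (fun z hz ↦ eq_zero_of_smul_tensorProduct hs z (by rwa [algebraMap_smul] at hz)) hsB'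
  obtain ⟨a, ha⟩ := hsurj (1 ⊗ₜ b)
  have h0 : TensorProduct.mk A Af (B ⧸ LinearMap.range L) 1 ((LinearMap.range L).mkQ b) = 0 := by
    have h1 : (1 : Af) ⊗ₜ[A] b = L.lTensor Af (a ⊗ₜ 1) := by
      rw [LinearMap.lTensor_tmul, Algebra.linearMap_apply, map_one, ← ha]; rfl
    rw [TensorProduct.mk_apply, ← LinearMap.lTensor_tmul, h1, ← LinearMap.comp_apply,
      ← LinearMap.lTensor_comp, LinearMap.range_mkQ_comp, LinearMap.lTensor_zero,
      LinearMap.zero_apply]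
  obtain ⟨⟨_, k, rfl⟩, hk⟩ := (IsLocalizedModule.eq_zero_iff (Submonoid.powers f) _).mp h0
  rw [Submonoid.smul_def, ← map_smul, Submodule.mkQ_apply, Submodule.Quotient.mk_eq_zero] at hk
  exact hf (Ideal.IsPrime.mem_of_pow_mem inferInstance k (hIm hk))

/-- B need not be a domain; the closure is taken in the total fraction ring. If the denominators of
an integral fraction q lay in a maximal ideal m, then q would map into Frac of the local ring at m
(nonzerodivisors stay nonzero by flatness), hence into that ring, producing a denominator outside m.
-/
lemma isIntegrallyClosed_of_isLocalization_atPrime {B : Type u} [CommRing B]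
    (h : ∀ P : PrimeSpectrum B, ∃ (C : Type u) (_ : CommRing C) (_ : Algebra B C),
      IsLocalization.AtPrime C P.asIdeal ∧ IsDomain C ∧ IsIntegrallyClosed C) :
    IsIntegrallyClosed B := by
  let Q := FractionRing B
  refine (isIntegrallyClosed_iff Q).mpr fun {q} hq ↦ ?_
  let I : Ideal B := (LinearMap.range (Algebra.linearMap B Q)).comap (LinearMap.toSpanSingleton B Q q)
  suffices hI : I = ⊤ by
    have h1 : (1 : B) ∈ I := hI ▸ trivial
    obtain ⟨a, ha⟩ := h1
    exact ⟨a, ha.trans (one_smul _ _)⟩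
  by_contra hI
  obtain ⟨m, hm, hIm⟩ := I.exists_le_maximal hI
  obtain ⟨C, _, _, _, _, _⟩ := h ⟨m, inferInstance⟩
  have : Module.Flat B C := IsLocalization.flat C m.primeCompl
  have hB (b : B⁰) : IsUnit (algebraMap C (FractionRing C) (algebraMap B C b)) := by
    refine IsLocalization.map_units (M := C⁰) _ ⟨_, mem_nonZeroDivisors_of_ne_zero fun hb ↦ ?_⟩
    have h1 := Module.Flat.isSMulRegular_of_nonZeroDivisors (M := C) b.2
    exact one_ne_zero (h1 (show (b : B) • (1 : C) = (b : B) • 0 by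
      rw [smul_zero, Algebra.smul_def, hb, zero_mul]))
  let g : Q →ₐ[B] FractionRing C := IsLocalization.liftAlgHom (M := B⁰)
    (f := Algebra.ofId B (FractionRing C)) fun b ↦ by
      rw [Algebra.ofId_apply, IsScalarTower.algebraMap_apply B C]; exact hB b
  obtain ⟨c, hc⟩ := (isIntegrallyClosed_iff (FractionRing C)).mp ‹IsIntegrallyClosed C›
    ((hq.map g).tower_top (A := C))
  obtain ⟨⟨b, t⟩, rfl⟩ := IsLocalization.mk'_surjective B⁰ q
  obtain ⟨⟨b', t'⟩, rfl⟩ := IsLocalization.mk'_surjective m.primeCompl c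
  have h1 : algebraMap B C (t' * b) = algebraMap B C (b' * t) := by
    refine IsFractionRing.injective C (FractionRing C) ?_
    have h2 : g (IsLocalization.mk' Q b t) * algebraMap B _ (t : B) = algebraMap B _ b := by
      rw [← AlgHom.commutes g, ← map_mul, IsLocalization.mk'_spec, AlgHom.commutes]
    have h3 : algebraMap C (FractionRing C) (IsLocalization.mk' C b' t') * algebraMap B _ (t' : B) =
        algebraMap B _ b' := by
      rw [IsScalarTower.algebraMap_apply B C, ← map_mul, IsLocalization.mk'_spec,
        ← IsScalarTower.algebraMap_apply]
    rw [← IsScalarTower.algebraMap_apply, ← IsScalarTower.algebraMap_apply, map_mul, map_mul,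
      ← h2, ← h3, hc]
    ring
  obtain ⟨r, hr⟩ := (IsLocalization.eq_iff_exists m.primeCompl C).mp h1
  refine (m.primeCompl.mul_mem r.2 t'.2 : (r * t' : B) ∉ m) (hIm ⟨r * b', ?_⟩)
  rw [Algebra.linearMap_apply, LinearMap.toSpanSingleton_apply, Algebra.smul_def]
  refine (IsLocalization.map_units Q t).mul_left_injective ?_
  dsimp only
  rw [mul_assoc, IsLocalization.mk'_spec, ← map_mul, ← map_mul, mul_assoc, mul_assoc, hr]

/-! ### Jointly surjective étale charts -/

/-- The product of finitely many étale charts is étale over both bases, and it is faithfully flat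
over A when the charts cover Spec A. -/
lemma exists_etale_faithfullyFlat {ι : Type u} [Finite ι] {A P : Type u} [CommRing A] [CommRing P]
    (C : ι → Type u) [∀ i, CommRing (C i)] (α : ∀ i, A →+* C i) (β : ∀ i, P →+* C i)
    (hα : ∀ i, (α i).Etale) (hβ : ∀ i, (β i).Etale)
    (hsurj : ∀ 𝔭 : PrimeSpectrum A, ∃ i, ∃ 𝔮 : PrimeSpectrum (C i), 𝔮.comap (α i) = 𝔭) :
    ∃ (A' : Type u) (_ : CommRing A') (_ : Algebra A A') (_ : Algebra P A'),
      Algebra.Etale A A' ∧ Algebra.Etale P A' ∧ Module.FaithfullyFlat A A' ∧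
      ∀ a c, (∀ i, α i a = β i c) → algebraMap A A' a = algebraMap P A' c := by
  let _ (i : ι) : Algebra A (C i) := (α i).toAlgebra
  let _ (i : ι) : Algebra P (C i) := (β i).toAlgebra
  have (i : ι) : Algebra.Etale A (C i) := hα i
  have (i : ι) : Algebra.Etale P (C i) := hβ i
  have : Algebra.Etale A (Π i, C i) := inferInstance
  refine ⟨Π i, C i, inferInstance, inferInstance, inferInstance, this, inferInstance,
    .of_comap_surjective fun 𝔭 ↦ ?_, fun a c h ↦ funext h⟩
  obtain ⟨i, 𝔮, rfl⟩ := hsurj 𝔭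
  exact ⟨𝔮.comap (Pi.evalRingHom C i), rfl⟩

lemma exists_nonZeroDivisor_of_noetherian {A : Type*} [CommRing A] [IsNoetherianRing A]
    (J : Ideal A) (hJ : ∀ a, (∀ s ∈ J, s * a = 0) → a = 0) : ∃ s ∈ J, s ∈ A⁰ := by
  by_contra! h
  have h1 := Ideal.bot_lt_annihilator_of_disjoint_nonZeroDivisors (I := J) (Set.disjoint_left.mpr h)
  refine h1.ne' ((Submodule.eq_bot_iff _).mpr fun a ha ↦ hJ a fun s hs ↦ ?_)
  rw [mul_comm]
  exact Submodule.mem_annihilator.mp ha s hs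

lemma exists_pow_smul_mem_range {A B : Type*} [CommRing A] [CommRing B] [Algebra A B]
    [Module.Finite A B] (s : A) (h : ∀ b : B, ∃ n : ℕ, ∃ a, algebraMap A B a = s ^ n • b) :
    ∃ n : ℕ, ∀ b : B, ∃ a, algebraMap A B a = s ^ n • b := by
  obtain ⟨S, hS⟩ := (inferInstance : Module.Finite A B).fg_top
  choose N hN using h
  refine ⟨∑ b ∈ S, N b, fun b ↦ ?_⟩
  have hb : b ∈ Submodule.span A (S : Set B) := hS ▸ trivial
  change s ^ (∑ b ∈ S, N b) • b ∈ LinearMap.range (Algebra.linearMap A B)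
  induction hb using Submodule.span_induction with
  | mem x hx =>
    obtain ⟨d, hd⟩ := Nat.exists_eq_add_of_le
      (Finset.single_le_sum (f := N) (fun _ _ ↦ Nat.zero_le _) hx)
    rw [hd, add_comm, pow_add, mul_smul]
    exact Submodule.smul_mem _ _ (hN x)
  | zero => simp
  | add x y _ _ hx hy => rw [smul_add]; exact add_mem hx hy
  | smul c x _ hx => rw [smul_comm]; exact Submodule.smul_mem _ _ hx

end SemiSmooth



namespace SemiSmooth

/-! ### Normalizations with étale pinch point charts -/

open TensorProduct

/-- `σ` is an involution of `S` whose ring of invariants is the image of `θ`. -/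
structure IsInvolution {R S : Type*} [CommRing R] [CommRing S] (θ : R →+* S) (σ : S →+* S) :
    Prop where
  map_base (a : R) : σ (θ a) = θ a
  involutive (b : S) : σ (σ b) = b
  exists_eq (b : S) : σ b = b → ∃ a, θ a = b

/-- The map `φ : A → B` is finite birational, and étale locally on `A` the normalization of a
pinch point. -/
structure IsPinchNormalization {K A B : Type u} [CommRing K] [CommRing A] [CommRing B]
    (κ : K →+* A) (φ : A →+* B) : Prop where
  isNoetherianRing : IsNoetherianRing A
  finiteType : κ.FiniteType
  injective : Function.Injective φ
  finite : φ.Finite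
  exists_conductor : ∃ s, (∀ b, φ s * b = 0 → b = 0) ∧ ∀ b, ∃ a, φ a = φ s * b
  exists_chart : letI := φ.toAlgebra
    ∃ (A' : Type u) (_ : CommRing A') (_ : Algebra A A') (v : A') (y : A' ⊗[A] B),
      Module.FaithfullyFlat A A' ∧ Algebra.FormallyEtale A A' ∧
      IsPinchChart ((algebraMap A A').comp κ) (algebraMap A' (A' ⊗[A] B)) v y

namespace IsPinchNormalization

variable {K A B : Type u} [CommRing K] [CommRing A] [CommRing B] {κ : K →+* A} {φ : A →+* B}
  (h : IsPinchNormalization κ φ)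
include h

lemma exists_extend {d : A →+ A} (hd : IsDer κ (RingHom.id A) d) :
    ∃ D : B →+ B, IsDer (φ.comp κ) (RingHom.id B) D ∧ ∀ a, D (φ a) = φ (d a) := by
  algebraize [φ]
  obtain ⟨A', _, _, v, y, _, _, hc⟩ := h.exists_chart
  obtain ⟨s, hs, hsB⟩ := h.exists_conductor
  exact exists_extend_of_faithfullyFlat (A' := A') hc.exists_extend (s := s)
    (fun b hb ↦ hs b hb) (fun b ↦ hsB b) hd

lemma eq_zero {D : B →+ B} (hD : IsDer (φ.comp κ) (RingHom.id B) D) (hDA : ∀ a, D (φ a) = 0)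
    (b : B) : D b = 0 := by
  obtain ⟨s, hs, hsB⟩ := h.exists_conductor
  obtain ⟨a, ha⟩ := hsB b
  refine hs _ ?_
  have h1 := hDA a
  rwa [ha, hD.leibniz, hDA, mul_zero, add_zero] at h1

lemma projective : HasProjectiveDifferentials (φ.comp κ) := by
  have hfin := h.finite
  algebraize [φ]
  obtain ⟨A', _, _, v, y, _, _, hc⟩ := h.exists_chart
  have := h.isNoetherianRing
  have : IsNoetherianRing B := IsNoetherianRing.of_finite A B
  exact hasProjectiveDifferentials_of_faithfullyFlat_tensorProduct (A' := A')
    (hfin.finiteType.comp h.finiteType) hc.projective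

variable {S : Type u} [CommRing S] {q : B →+* S} (hq : Function.Surjective q)
  (hker : ∀ b, q b = 0 ↔ ∃ c ∈ ringConductor φ, φ c = b)
include hq hker

lemma isDer_eq_zero {e : S →+ S} (he : IsDer ((q.comp φ).comp κ) (RingHom.id S) e)
    (heA : ∀ a, e (q (φ a)) = 0) : e = 0 := by
  have hfin := h.finite
  algebraize [φ, q.comp φ]
  obtain ⟨A', _, _, v, y, _, _, hc⟩ := h.exists_chart
  let qA : B →ₐ[A] S := ⟨q, fun _ ↦ rfl⟩
  exact (hc.isDoubleCover (q := qA) hq hker).isDer_eq_zero he heA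

lemma exists_unique_involution : ∃ σ : S →+* S, IsInvolution (q.comp φ) σ ∧
    ∀ τ : S →+* S, IsInvolution (q.comp φ) τ → τ = σ := by
  have hfin := h.finite
  algebraize [φ, q.comp φ]
  obtain ⟨A', _, _, v, y, _, _, hc⟩ := h.exists_chart
  let qA : B →ₐ[A] S := ⟨q, fun _ ↦ rfl⟩
  have : Module.Finite A S := Module.Finite.of_surjective qA.toLinearMap hq
  obtain ⟨σ, hσ, hσA, huniq⟩ := (hc.isDoubleCover (q := qA) hq hker).exists_unique_involution
  refine ⟨σ.toRingHom, ⟨σ.commutes, hσ, hσA⟩, fun τ hτ ↦ ?_⟩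
  have := huniq ⟨τ, hτ.map_base⟩ hτ.involutive hτ.exists_eq
  exact congr(AlgHom.toRingHom $this)

end IsPinchNormalization

lemma isPinchNormalization_of_chart {K : Type u} [Field K] (h2 : (2 : K) ≠ 0) {m : ℕ}
    {A B A' : Type u} [CommRing A] [CommRing B] [CommRing A'] {κ : K →+* A} {φ : A →+* B}
    [IsReduced A] [IsIntegrallyClosed B] (hκ : κ.FiniteType) (hφ : Function.Injective φ)
    (hfin : φ.Finite) {s : A} (hs : ∀ b, φ s * b = 0 → b = 0) (hsB : ∀ b, ∃ a, φ a = φ s * b)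
    [Algebra A A'] [Algebra.Etale A A'] [Module.FaithfullyFlat A A'] [Algebra (PinchRing K m) A']
    [Algebra.Etale (PinchRing K m) A']
    (hA' : ∀ c, algebraMap A A' (κ c) = algebraMap (PinchRing K m) A' (algebraMap K _ c)) :
    IsPinchNormalization κ φ := by
  have hnoeth : IsNoetherianRing A := by
    algebraize [κ]
    exact Algebra.FiniteType.isNoetherianRing K A
  refine ⟨hnoeth, hκ, hφ, hfin, ⟨s, hs, hsB⟩, ?_⟩
  algebraize [φ]
  obtain ⟨v, y, hc⟩ := exists_isPinchChart (m := m) h2 (A' := A') hφ hs hsB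
  refine ⟨A', inferInstance, inferInstance, v, y, inferInstance, inferInstance, ?_⟩
  have : (algebraMap A A').comp κ = (algebraMap (PinchRing K m) A').comp (algebraMap K _) :=
    RingHom.ext hA'
  rwa [this]

/-- Involutions are compatible with localization. -/
lemma IsInvolution.comp_eq_of_isLocalization {R R' S S' : Type*} [CommRing R] [CommRing R']
    [CommRing S] [CommRing S'] {θ : R →+* S} {θ' : R' →+* S'} {ρ : R →+* R'} {r : S →+* S'} (t : R)
    (hR : @IsLocalization.Away R _ t R' _ ρ.toAlgebra)
    (hS : @IsLocalization.Away S _ (θ t) S' _ r.toAlgebra) (hc : ∀ a, θ' (ρ a) = r (θ a))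
    {σ : S →+* S} (hσ : IsInvolution θ σ) {σ' : S' →+* S'}
    (hσ' : ∀ τ : S' →+* S', IsInvolution θ' τ → τ = σ') (b : S) : σ' (r b) = r (σ b) := by
  algebraize [ρ, r]
  have hr : algebraMap S S' = r := rfl
  have hρ : algebraMap R R' = ρ := rfl
  have hu : IsUnit ((algebraMap S S').comp σ (θ t)) := by
    rw [RingHom.comp_apply, hσ.map_base]
    exact IsLocalization.Away.algebraMap_isUnit _
  let τ : S' →+* S' := IsLocalization.Away.lift (θ t) hu
  have hτ (b : S) : τ (r b) = r (σ b) := IsLocalization.Away.lift_eq (θ t) hu b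
  have hunit (n : ℕ) : IsUnit (r (θ t) ^ n) := (IsLocalization.Away.algebraMap_isUnit (θ t)).pow n
  have hρunit (n : ℕ) : IsUnit (ρ t ^ n) := (IsLocalization.Away.algebraMap_isUnit t).pow n
  suffices h : IsInvolution θ' τ by rw [← hσ' τ h, hτ]
  have hb (a : R') : τ (θ' a) = θ' a := by
    obtain ⟨n, a', ha⟩ := IsLocalization.Away.surj t a
    rw [hρ, ← map_pow] at ha
    have h1 := congr(θ' $ha)
    rw [map_mul, hc, hc] at h1
    have h2 := congr(τ $h1)
    rw [map_mul, hτ, hτ, hσ.map_base, hσ.map_base, ← h1, map_pow θ, map_pow r] at h2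
    exact (hunit n).mul_left_injective h2
  refine ⟨hb, fun b ↦ ?_, fun b hτb ↦ ?_⟩
  · obtain ⟨n, b', hb'⟩ := IsLocalization.Away.surj (θ t) b
    rw [hr, ← map_pow] at hb'
    have h2 := congr(τ (τ $hb'))
    rw [map_mul, map_mul, hτ, hτ, hτ, hτ, hσ.involutive, hσ.involutive, ← hb', map_pow r] at h2
    exact (hunit n).mul_left_injective h2
  · obtain ⟨n, b', hb'⟩ := IsLocalization.Away.surj (θ t) b
    rw [hr, ← map_pow] at hb'
    have h2 := congr(τ $hb')
    rw [map_mul, hτ, hτ, hτb, ← map_pow θ, hσ.map_base, map_pow θ, hb'] at h2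
    obtain ⟨⟨_, k, rfl⟩, hk⟩ :=
      (IsLocalization.eq_iff_exists (Submonoid.powers (θ t)) S').mp h2
    dsimp only at hk
    obtain ⟨a, ha⟩ := hσ.exists_eq (θ t ^ k * b') (by
      rw [map_mul, map_pow, hσ.map_base, hk])
    obtain ⟨w, hw⟩ := hρunit (n + k)
    refine ⟨↑w⁻¹ * ρ a, (hunit (n + k)).mul_left_cancel ?_⟩
    have h3 : r (θ t) ^ (n + k) * θ' ↑w⁻¹ = 1 := by
      rw [← hc, ← map_pow, ← hw, ← map_mul, Units.mul_inv, map_one]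
    rw [map_mul, ← mul_assoc, h3, one_mul, hc, ha, map_mul, ← hb', pow_add]
    simp only [map_pow]
    ring

end SemiSmooth



namespace SemiSmooth

/-! ### The normalization of a semi-smooth variety -/

section Birational

variable {X Xb : Scheme.{u}} {f : Xb ⟶ X} {U : X.Opens}

lemma isIso_app_of_isIso_morphismRestrict (hU : IsIso (f ∣_ U)) {D : X.Opens} (hD : D ≤ U) :
    IsIso (f.app D) := by
  have h1 : IsIso ((f ∣_ U).app (U.ι ⁻¹ᵁ D)) := inferInstance
  rw [morphismRestrict_app] at h1
  have he {A B : Xb.Opensᵒᵖ} (e : A ⟶ B) [IsIso e] : IsIso (Xb.presheaf.map e) := inferInstance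
  have h2 : IsIso (f.app (U.ι ''ᵁ U.ι ⁻¹ᵁ D)) := @IsIso.of_isIso_comp_right _ _ _ _ _ _ _ (he _) h1
  have h3 : U.ι ''ᵁ U.ι ⁻¹ᵁ D = D := by
    rw [Scheme.Hom.image_preimage_eq_opensRange_inf, Scheme.Opens.opensRange_ι, inf_eq_right.mpr hD]
  rwa [h3] at h2

lemma app_bijective_of_isIso_morphismRestrict (hU : IsIso (f ∣_ U)) {D : X.Opens} (hD : D ≤ U) :
    Function.Bijective (f.app D) := by
  have := isIso_app_of_isIso_morphismRestrict hU hD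
  exact ConcreteCategory.bijective_of_isIso (f.app D)

lemma eq_bot_of_inf_eq_bot {Z : Scheme.{u}} {U O : Z.Opens} (hU : Dense (U : Set Z))
    (h : O ⊓ U = ⊥) : O = ⊥ := by
  by_contra hO
  obtain ⟨x, hx, hxU⟩ := hU.inter_open_nonempty O O.isOpen
    ((TopologicalSpace.Opens.ne_bot_iff_nonempty O).mp hO)
  have : x ∈ O ⊓ U := ⟨hx, hxU⟩
  rw [h] at this
  exact this

lemma eq_bot_of_preimage_eq_bot (hU : IsIso (f ∣_ U)) {D : X.Opens} (hD : D ≤ U)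
    (h : f ⁻¹ᵁ D = ⊥) : D = ⊥ := by
  have h1 : (1 : Γ(X, D)) = 0 := by
    refine (app_bijective_of_isIso_morphismRestrict hU hD).1 ?_
    have : Subsingleton Γ(Xb, f ⁻¹ᵁ D) := by rw [h]; infer_instance
    exact Subsingleton.elim _ _
  rw [← X.basicOpen_of_isUnit (isUnit_one : IsUnit (1 : Γ(X, D))), h1, X.basicOpen_zero]

lemma app_injective_of_dense [IsReduced X] (hU : IsIso (f ∣_ U)) (hd : Dense (U : Set X))
    (V : X.Opens) : Function.Injective (f.app V) := by
  refine (injective_iff_map_eq_zero (f.app V).hom).mpr fun a ha ↦ ?_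
  rw [← basicOpen_eq_bot_iff]
  refine eq_bot_of_inf_eq_bot hd (eq_bot_of_preimage_eq_bot hU inf_le_right ?_)
  rw [Scheme.Hom.preimage_inf, Scheme.preimage_basicOpen]
  change Xb.basicOpen ((f.app V).hom a) ⊓ _ = _
  rw [ha, Scheme.basicOpen_zero, bot_inf_eq]

/-- The functions on V whose nonvanishing locus lies in U form an ideal with zero annihilator,
because U is dense. In a Noetherian ring it contains a nonzerodivisor s. On D(s) the map f is an
isomorphism, so some power of s maps B into A, by finiteness. -/
lemma exists_conductor_element [IsFinite f] [IsReduced X] [IsReduced Xb] (hU : IsIso (f ∣_ U))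
    (hd : Dense (U : Set X)) (hd' : Dense ((f ⁻¹ᵁ U : Xb.Opens) : Set Xb)) {V : X.Opens}
    (hV : IsAffineOpen V) (hN : IsNoetherianRing Γ(X, V)) :
    ∃ s : Γ(X, V), (∀ b, f.app V s * b = 0 → b = 0) ∧ ∀ b, ∃ a, f.app V a = f.app V s * b := by
  let J : Ideal Γ(X, V) :=
    { carrier := {s | X.basicOpen s ≤ U}
      zero_mem' := by
        change X.basicOpen (0 : Γ(X, V)) ≤ U
        rw [X.basicOpen_zero]; exact bot_le
      add_mem' := fun ha hb ↦ (X.basicOpen_add_le _ _).trans (sup_le ha hb)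
      smul_mem' := fun c a ha ↦ by
        change X.basicOpen (c * a) ≤ U
        rw [X.basicOpen_mul]; exact inf_le_right.trans ha }
  obtain ⟨s, hsJ, hs⟩ := exists_nonZeroDivisor_of_noetherian J fun a ha ↦ by
    rw [← basicOpen_eq_bot_iff]
    refine eq_bot_of_inf_eq_bot hd (eq_bot_iff.mpr fun x hx ↦ ?_)
    obtain ⟨s, hs, hxs⟩ := hV.exists_basicOpen_le (V := U) ⟨x, hx.2⟩ (X.basicOpen_le a hx.1)
    rw [← X.basicOpen_zero V, ← ha s hs, X.basicOpen_mul]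
    exact ⟨hxs, hx.1⟩
  have hsU : X.basicOpen s ≤ U := hsJ
  have hsd (O : X.Opens) (hO : O ≤ V) (h : O ⊓ X.basicOpen s = ⊥) : O = ⊥ := by
    refine eq_bot_iff.mpr fun x hx ↦ ?_
    obtain ⟨t, ht, hxt⟩ := hV.exists_basicOpen_le (V := O) ⟨x, hx⟩ (hO hx)
    have h1 : t * s = 0 := by
      rw [← basicOpen_eq_bot_iff, X.basicOpen_mul, eq_bot_iff, ← h]
      exact inf_le_inf_right _ ht
    rw [mem_nonZeroDivisors_iff_right.mp hs t h1, X.basicOpen_zero] at hxt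
    exact hxt
  -- That s is a nonzerodivisor on B is checked over f⁻¹(U), which is dense in X̄; there functions
  -- on X̄ come from X.
  have hsB (b : Γ(Xb, f ⁻¹ᵁ V)) (hb : f.app V s * b = 0) : b = 0 := by
    rw [← basicOpen_eq_bot_iff]
    refine eq_bot_of_inf_eq_bot hd' (eq_bot_iff.mpr fun x hx ↦ ?_)
    obtain ⟨t, ht, hxt⟩ := hV.exists_basicOpen_le (V := U) ⟨f x, hx.2⟩ (Xb.basicOpen_le b hx.1)
    have htV : X.basicOpen t ≤ V := X.basicOpen_le t
    obtain ⟨hinj, hsurj⟩ := app_bijective_of_isIso_morphismRestrict hU ht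
    obtain ⟨c, hc⟩ := hsurj (res (f.preimage_mono htV) b)
    have h1 : f.app (X.basicOpen t) (res htV s) = res (f.preimage_mono htV) (f.app V s) := by
      rw [← comorph_self_eq_app, ← comorph_self_eq_app, comorph_res, res_comorph]
    have h2 : res htV s * c = 0 := hinj (by rw [map_mul, map_zero, h1, hc, ← map_mul, hb, map_zero])
    have h3 : c = 0 := by
      rw [← basicOpen_eq_bot_iff]
      refine hsd _ ((X.basicOpen_le c).trans htV) (eq_bot_iff.mpr ?_)
      have h4 := congr(X.basicOpen $h2)
      rw [X.basicOpen_mul, X.basicOpen_zero] at h4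
      rw [← h4, res, Scheme.basicOpen_res]
      exact le_inf (le_inf (inf_le_left.trans (X.basicOpen_le c)) inf_le_right) inf_le_left
    have h4 : x ∈ Xb.basicOpen (res (f.preimage_mono htV) b) := by
      rw [res, Scheme.basicOpen_res]
      exact ⟨hxt, hx.1⟩
    rw [← hc, h3, map_zero, Scheme.basicOpen_zero] at h4
    exact h4
  have hfin := f.finite_app V hV
  algebraize [(f.app V).hom]
  obtain ⟨n, hn⟩ := exists_pow_smul_mem_range (B := Γ(Xb, f ⁻¹ᵁ V)) s fun b ↦ by
    have hsV : X.basicOpen s ≤ V := X.basicOpen_le s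
    obtain ⟨c, hc⟩ := (app_bijective_of_isIso_morphismRestrict hU hsU).2 (res (f.preimage_mono hsV) b)
    have := hV.isLocalization_basicOpen s
    obtain ⟨n, a, ha⟩ := IsLocalization.Away.surj s c
    refine ⟨n, a, ?_⟩
    change f.app V a = f.app V (s ^ n) * b
    have h1 (a : Γ(X, V)) : f.app (X.basicOpen s) (res hsV a) = res (f.preimage_mono hsV) (f.app V a) := by
      rw [← comorph_self_eq_app, ← comorph_self_eq_app, comorph_res, res_comorph]
    have ha' : c * res hsV s ^ n = res hsV a := ha
    have h2 := congr(f.app (X.basicOpen s) $ha')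
    rw [map_mul, hc, ← map_pow, h1, h1] at h2
    rw [← sub_eq_zero]
    refine hsB _ ?_
    rw [← basicOpen_eq_bot_iff, Scheme.basicOpen_mul, ← Scheme.preimage_basicOpen, eq_bot_iff,
      ← Scheme.basicOpen_zero Xb (f ⁻¹ᵁ X.basicOpen s)]
    have h3 : res (f.preimage_mono hsV) (f.app V a - f.app V (s ^ n) * b) = 0 := by
      rw [map_sub, map_mul, ← h2]; ring
    rw [← h3, res, Scheme.basicOpen_res]
  refine ⟨s ^ n, fun b hb ↦ ?_, hn⟩
  clear hn
  induction n with
  | zero => simpa using hb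
  | succ n ih =>
    refine ih (hsB _ ?_)
    rw [pow_succ, map_mul] at hb
    rw [← hb]; ring

end Birational

lemma isReduced_of_isNormalization {X Xb : Scheme.{u}} (f : Xb ⟶ X) [IsNormalization f] :
    IsReduced Xb := by
  have (x : Xb) : _root_.IsReduced (Xb.presheaf.stalk x) := by
    have := (IsNormalization.normal (f := f) x).1
    infer_instance
  exact isReduced_of_isReduced_stalk Xb

lemma primeIdealOf_surjective {Z : Scheme.{u}} {V : Z.Opens} (hV : IsAffineOpen V) :
    Function.Surjective hV.primeIdealOf := by
  intro P
  have hP : hV.fromSpec P ∈ V := by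
    have : hV.fromSpec P ∈ hV.fromSpec.opensRange := ⟨P, rfl⟩
    rwa [hV.opensRange_fromSpec] at this
  exact ⟨⟨_, hP⟩, hV.fromSpec.isOpenEmbedding.injective (hV.fromSpec_primeIdealOf ⟨_, hP⟩)⟩

lemma isIntegrallyClosed_of_isAffineOpen {Z : Scheme.{u}}
    (hZ : ∀ x : Z, IsDomain (Z.presheaf.stalk x) ∧ IsIntegrallyClosed (Z.presheaf.stalk x))
    {V : Z.Opens} (hV : IsAffineOpen V) : IsIntegrallyClosed Γ(Z, V) := by
  refine isIntegrallyClosed_of_isLocalization_atPrime fun P ↦ ?_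
  obtain ⟨x, rfl⟩ := primeIdealOf_surjective hV P
  exact ⟨_, _, _, hV.isLocalization_stalk x, hZ _⟩

variable {K : Type u} [Field K]

lemma kmap_comp_eq {X Xb : Scheme.{u}} (p : X ⟶ Spec (.of K)) (f : Xb ⟶ X) (V : X.Opens) :
    kmap (f ≫ p) (f ⁻¹ᵁ V) = (f.app V).hom.comp (kmap p V) :=
  RingHom.ext fun c ↦ by
    rw [← comorph_kmap p f le_rfl, comorph_self_eq_app]; rfl

lemma finiteType_kmap {X : Scheme.{u}} (p : X ⟶ Spec (.of K)) [LocallyOfFiniteType p]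
    {V : X.Opens} (hV : IsAffineOpen V) : (kmap p V).FiniteType :=
  (p.finiteType_appLE (isAffineOpen_top _) hV le_top).comp
    (.of_surjective _ (ConcreteCategory.bijective_of_isIso (ΓSpecIso (.of K)).inv).2)

lemma kmap_pinch (m : ℕ) (c : K) :
    kmap (pinch K m) ⊤ c = (ΓSpecIso (.of (PinchRing K m))).inv (algebraMap K (PinchRing K m) c) := by
  have h := ConcreteCategory.congr_hom
    (ΓSpecIso_inv_naturality (CommRingCat.ofHom (algebraMap K (PinchRing K m)))) c
  refine Eq.trans ?_ h.symm
  exact comorph_self_eq_app (j := pinch K m) ⊤ _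

/-- Étale charts near a point of a semi-smooth variety, in terms of rings of functions. -/
lemma exists_etale_chart {X U : Scheme.{u}} {p : X ⟶ Spec (.of K)} {m : ℕ} {φ : U ⟶ X}
    {ψ : U ⟶ Spec (.of (PinchRing K m))} [Etale φ] [Etale ψ] (h : φ ≫ p = ψ ≫ pinch K m)
    {V : X.Opens} (hV : IsAffineOpen V) (z : U) (hz : φ z ∈ V) :
    ∃ (C : Type u) (_ : CommRing C) (α : Γ(X, V) →+* C) (β : PinchRing K m →+* C) (N : X.Opens),
      α.Etale ∧ β.Etale ∧ (∀ c, α (kmap p V c) = β (algebraMap K _ c)) ∧ φ z ∈ N ∧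
      ∀ x (hx : x ∈ V), x ∈ N → ∃ 𝔮 : PrimeSpectrum C, 𝔮.comap α = hV.primeIdealOf ⟨x, hx⟩ := by
  obtain ⟨W, hWV, hzW, hW⟩ := isOpensBasis_isAffineOpen (φ ⁻¹ᵁ V) z hz
  refine ⟨Γ(U, W), inferInstance, (φ.appLE V W hWV).hom,
    (ψ.appLE ⊤ W le_top).hom.comp (ΓSpecIso (.of (PinchRing K m))).inv.hom,
    ⟨φ '' W, φ.isOpenMap _ W.isOpen⟩, φ.etale_appLE hV hW hWV,
    RingHom.Etale.stableUnderComposition _ _ (.of_bijective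
      (ConcreteCategory.bijective_of_isIso (ΓSpecIso (.of (PinchRing K m))).inv))
      (ψ.etale_appLE (isAffineOpen_top _) hW le_top), fun c ↦ ?_, ⟨z, hzW, rfl⟩, ?_⟩
  · refine (comorph_kmap p φ hWV c).trans ?_
    rw [h]
    refine (comorph_kmap (pinch K m) ψ (U := ⊤) le_top c).symm.trans ?_
    rw [kmap_pinch]
    rfl
  · rintro _ hx ⟨w, hw, rfl⟩
    exact ⟨hW.primeIdealOf ⟨w, hw⟩, hV.comap_primeIdealOf_appLE _ W hW hWV hw⟩

/-- V is quasi-compact, so finitely many étale charts cover it. Their product is the faithfully flat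
A' required. -/
lemma isPinchNormalization_app (h2 : (2 : K) ≠ 0) {X Xb : Scheme.{u}} (p : X ⟶ Spec (.of K))
    [IsSemiSmooth p] (f : Xb ⟶ X) [IsNormalization f] {V : X.Opens} (hV : IsAffineOpen V) :
    IsPinchNormalization (kmap p V) (f.app V).hom := by
  have : IsReduced X := IsVariety.reduced p
  have : LocallyOfFiniteType p := IsVariety.locallyOfFiniteType
  have : IsReduced Xb := isReduced_of_isNormalization f
  obtain ⟨U, hd, hd', hU⟩ := IsNormalization.birational (f := f)
  obtain ⟨m, -, hm⟩ := IsSemiSmooth.etaleLocally (p := p)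
  have hκ := finiteType_kmap p hV
  have hN : IsNoetherianRing Γ(X, V) := by
    algebraize [kmap p V]
    exact Algebra.FiniteType.isNoetherianRing K _
  obtain ⟨s, hs, hsB⟩ := exists_conductor_element hU hd hd' hV hN
  have hic := isIntegrallyClosed_of_isAffineOpen (IsNormalization.normal (f := f)) (hV.preimage f)
  have hchart (x : V) : ∃ (C : Type u) (_ : CommRing C) (α : Γ(X, V) →+* C)
      (β : PinchRing K m →+* C) (N : X.Opens),
      α.Etale ∧ β.Etale ∧ (∀ c, α (kmap p V c) = β (algebraMap K _ c)) ∧ x.1 ∈ N ∧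
      ∀ x (hx : x ∈ V), x ∈ N → ∃ 𝔮 : PrimeSpectrum C, 𝔮.comap α = hV.primeIdealOf ⟨x, hx⟩ := by
    obtain ⟨W, φ, ψ, _, _, h, z, hz⟩ := hm x
    have := exists_etale_chart h hV z (hz ▸ x.2)
    rwa [hz] at this
  choose C hC α β N hα hβ hαβ hxN hN' using hchart
  obtain ⟨t, ht⟩ := hV.isCompact.elim_nhds_subcover' (fun x hx ↦ (N ⟨x, hx⟩ : Set X))
    fun x hx ↦ (N ⟨x, hx⟩).isOpen.mem_nhds (hxN ⟨x, hx⟩)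
  have hsurj (𝔭 : PrimeSpectrum Γ(X, V)) :
      ∃ i : t, ∃ 𝔮 : PrimeSpectrum (C i.1), 𝔮.comap (α i.1) = 𝔭 := by
    obtain ⟨x, rfl⟩ := primeIdealOf_surjective hV 𝔭
    obtain ⟨i, hi, hxi⟩ := Set.mem_iUnion₂.mp (ht x.2)
    exact ⟨⟨i, hi⟩, hN' i x x.2 hxi⟩
  obtain ⟨A', _, _, _, _, _, _, hA'⟩ := exists_etale_faithfullyFlat (fun i : t ↦ C i.1)
    (fun i ↦ α i.1) (fun i ↦ β i.1) (fun i ↦ hα i.1) (fun i ↦ hβ i.1) hsurj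
  exact isPinchNormalization_of_chart h2 hκ (app_injective_of_dense hU hd V) (f.finite_app V hV)
    hs hsB (A' := A') fun c ↦ hA' _ _ fun i ↦ hαβ i.1 c

end SemiSmooth



namespace SemiSmooth

/-! ### The conductor square of a semi-smooth variety -/

section Square

variable {K : Type u} [Field K] {X Xb Y Yb : Scheme.{u}} {p : X ⟶ Spec (.of K)} {f : Xb ⟶ X}
  {j : Yb ⟶ Xb} {k : Y ⟶ X} {g : Yb ⟶ Y}

lemma isConductorSquare_of_isPinchNormalization (comm : j ≫ f = g ≫ k)
    (hle : ∀ V : X.Opens, g ⁻¹ᵁ k ⁻¹ᵁ V ≤ j ⁻¹ᵁ f ⁻¹ᵁ V)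
    (hN : ∀ V : X.Opens, IsAffineOpen V → IsPinchNormalization (kmap p V) (f.app V).hom)
    (h0 : ∀ V : X.Opens, IsAffineOpen V → ∀ c ∈ ringConductor (f.app V).hom, k.app V c = 0)
    (hex : ∀ V : X.Opens, IsAffineOpen V → ∀ b : Γ(Xb, f ⁻¹ᵁ V), comorph j (hle V) b = 0 →
      ∃ c ∈ ringConductor (f.app V).hom, f.app V c = b)
    (hsurj : ∀ V : X.Opens, IsAffineOpen V → Function.Surjective (comorph j (hle V))) :
    IsConductorSquare p f j k g where
  injective hV := (hN _ hV).injective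
  exists_extend hV _ hd := by
    rw [kmap_comp_eq]
    exact (hN _ hV).exists_extend hd
  eq_zero hV _ hd h b := (hN _ hV).eq_zero (by rwa [← kmap_comp_eq]) h b
  comm := comm
  preimage_le := hle
  projective hV := by
    rw [kmap_comp_eq]
    exact (hN _ hV).projective
  app_eq_zero hV c hc := h0 _ hV c hc
  exists_app_eq hV b hb := hex _ hV b hb
  comorph_surjective hV := hsurj _ hV
  eq_zero_of_app_app {V} hV e he h b := by
    have hg (a : Γ(X, V)) : comorph j (hle V) (f.app V a) = g.app (k ⁻¹ᵁ V) (k.app V a) :=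
      comorph_app_of_square comm _ a
    have hκ : kmap (g ≫ k ≫ p) (g ⁻¹ᵁ k ⁻¹ᵁ V) =
        ((comorph j (hle V)).comp (f.app V).hom).comp (kmap p V) := RingHom.ext fun c ↦ by
      rw [kmap_comp_eq (k ≫ p), kmap_comp_eq p k]
      exact (hg _).symm
    rw [hκ] at he
    exact congr($((hN V hV).isDer_eq_zero (hsurj V hV) (fun b ↦ ⟨fun hb ↦ hex V hV b hb, by
      rintro ⟨c, hc, rfl⟩
      exact (hg c).trans (by rw [h0 V hV c hc, map_zero])⟩) he
      fun a ↦ (congrArg e (hg a)).trans (h a)) b)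

namespace IsConductorSquare

variable (H : IsConductorSquare p f j k g)
include H

lemma comorph_eq_zero_iff {V : X.Opens} (hV : IsAffineOpen V) (b : Γ(Xb, f ⁻¹ᵁ V)) :
    comorph j (H.preimage_le V) b = 0 ↔ ∃ c ∈ ringConductor (f.app V).hom, f.app V c = b := by
  refine ⟨H.exists_app_eq hV, ?_⟩
  rintro ⟨c, hc, rfl⟩
  rw [H.comorph_app, H.app_eq_zero hV hc, map_zero]

lemma app_injective [IsClosedImmersion k] {V : X.Opens} (hV : IsAffineOpen V) :
    Function.Injective (g.app (k ⁻¹ᵁ V)) := by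
  refine (injective_iff_map_eq_zero (g.app (k ⁻¹ᵁ V)).hom).mpr fun a ha ↦ ?_
  obtain ⟨a, rfl⟩ := k.app_surjective V hV a
  obtain ⟨c, hc, hca⟩ := H.exists_app_eq hV ((H.comorph_app V a).trans ha)
  rw [← H.injective hV hca]
  exact H.app_eq_zero hV hc

lemma exists_unique_isInvolution [IsClosedImmersion k] {V : X.Opens} (hV : IsAffineOpen V)
    (hN : IsPinchNormalization (kmap p V) (f.app V).hom) :
    ∃ σ : Γ(Yb, g ⁻¹ᵁ k ⁻¹ᵁ V) →+* Γ(Yb, g ⁻¹ᵁ k ⁻¹ᵁ V),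
      IsInvolution (g.app (k ⁻¹ᵁ V)).hom σ ∧
      ∀ τ, IsInvolution (g.app (k ⁻¹ᵁ V)).hom τ → τ = σ := by
  have key (σ : Γ(Yb, g ⁻¹ᵁ k ⁻¹ᵁ V) →+* Γ(Yb, g ⁻¹ᵁ k ⁻¹ᵁ V)) :
      IsInvolution ((comorph j (H.preimage_le V)).comp (f.app V).hom) σ ↔
        IsInvolution (g.app (k ⁻¹ᵁ V)).hom σ := by
    have h1 (a : Γ(X, V)) : ((comorph j (H.preimage_le V)).comp (f.app V).hom) a =
      g.app (k ⁻¹ᵁ V) (k.app V a) := H.comorph_app V a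
    refine ⟨fun h ↦ ⟨fun a ↦ ?_, h.involutive, fun b hb ↦ ?_⟩, fun h ↦ ⟨fun a ↦ ?_, h.involutive,
      fun b hb ↦ ?_⟩⟩
    · obtain ⟨a, rfl⟩ := k.app_surjective V hV a
      have := h.map_base a
      rwa [h1] at this
    · obtain ⟨a, ha⟩ := h.exists_eq b hb
      exact ⟨k.app V a, (h1 a).symm.trans ha⟩
    · rw [h1]
      exact h.map_base _
    · obtain ⟨a, ha⟩ := h.exists_eq b hb
      obtain ⟨a, rfl⟩ := k.app_surjective V hV a
      exact ⟨a, (h1 a).trans ha⟩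
  obtain ⟨σ, hσ, huniq⟩ := hN.exists_unique_involution (H.comorph_surjective hV)
    (H.comorph_eq_zero_iff hV)
  exact ⟨σ, (key σ).mp hσ, fun τ hτ ↦ huniq τ ((key τ).mpr hτ)⟩

end IsConductorSquare

end Square

/-! ### The smooth locus -/

section SmoothLocus

variable {K : Type u} [Field K] {X Xb : Scheme.{u}}

lemma smooth_kmap {p : X ⟶ Spec (.of K)} [LocallyOfFinitePresentation p] {V : X.Opens}
    (hV : IsAffineOpen V) (hVp : V ≤ p.smoothLocus) : (kmap p V).Smooth := by
  have h1 : (V.ι ≫ p).smoothLocus = ⊤ := by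
    rw [← Scheme.Hom.preimage_smoothLocus_eq, eq_top_iff]
    intro x _
    exact hVp x.2
  have h2 : Smooth (V.ι ≫ p) := Scheme.Hom.smoothLocus_eq_top_iff.mp h1
  have : IsAffine V := hV
  have h3 := (V.ι ≫ p).smooth_appLE (U := ⊤) (V := ⊤) (isAffineOpen_top _)
    (isAffineOpen_top V.toScheme) (le_of_eq rfl)
  have h4 : p.appLE ⊤ V (le_of_le_of_eq le_top rfl) ≫ V.ι.appLE V ⊤ V.ι_preimage_self.ge =
      (V.ι ≫ p).appLE ⊤ ⊤ (le_of_eq rfl) := Scheme.Hom.appLE_comp_appLE _ _ _ _ _ _ _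
  rw [← h4] at h3
  have h6 := (RingHom.Smooth.respectsIso.cancel_right_isIso _ _).mp h3
  exact (RingHom.Smooth.respectsIso.cancel_left_isIso (ΓSpecIso (.of K)).inv _).mpr h6

lemma app_surjective_of_le_smoothLocus {p : X ⟶ Spec (.of K)} [LocallyOfFinitePresentation p]
    {f : Xb ⟶ X} {V : X.Opens} (hV : IsAffineOpen V)
    (hN : IsPinchNormalization (kmap p V) (f.app V).hom) (hVp : V ≤ p.smoothLocus) :
    Function.Surjective (f.app V) := by
  have h1 := smooth_kmap hV hVp
  have h2 := hN.finite.to_isIntegral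
  obtain ⟨s, hs, hsB⟩ := hN.exists_conductor
  have hinj := hN.injective
  algebraize [kmap p V, (f.app V).hom]
  have : Algebra.IsIntegral Γ(X, V) Γ(Xb, f ⁻¹ᵁ V) := ⟨h2⟩
  exact algebraMap_surjective_of_smooth K (A := Γ(X, V)) (B := Γ(Xb, f ⁻¹ᵁ V)) hinj (s := s) hs hsB

end SmoothLocus

lemma isConductorSquare_conductor {K : Type u} [Field K] [IsAlgClosed K] (h2 : (2 : K) ≠ 0)
    {X Xb : Scheme.{u}} (p : X ⟶ Spec (.of K)) [IsSemiSmooth p] (f : Xb ⟶ X) [IsNormalization f] :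
    IsConductorSquare p f (conductorBarι f) (conductorι f) (conductorMap f) :=
  isConductorSquare_of_isPinchNormalization (conductor_square f) (conductorMap_preimage_le f)
    (fun _ hV ↦ isPinchNormalization_app h2 p f hV)
    (fun _ hV c hc ↦ (conductorι_app_eq_zero_iff hV c).mpr hc)
    (fun _ hV _ hb ↦ exists_mem_ringConductor_of_barRes_eq_zero hV hb)
    (fun _ hV ↦ barRes_surjective hV)

end SemiSmooth



namespace SemiSmooth

/-! ### Gluing involutions -/

section Glue

variable {Y Yb Z T : Scheme.{u}}

/-- Morphisms glue as soon as they agree near each point of the overlaps. -/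
lemma exists_hom_of_opens {I : Type u} (W : I → Z.Opens) (hW : ∀ z : Z, ∃ i, z ∈ W i)
    (φ : ∀ i, (W i).toScheme ⟶ T)
    (H : ∀ i j z, z ∈ W i → z ∈ W j → ∃ (O : Z.Opens) (hi : O ≤ W i) (hj : O ≤ W j), z ∈ O ∧
      Z.homOfLE hi ≫ φ i = Z.homOfLE hj ≫ φ j) :
    ∃ ι : Z ⟶ T, ∀ i, (W i).ι ≫ ι = φ i := by
  have key (i j : I) : pullback.fst (W i).ι (W j).ι ≫ φ i = pullback.snd (W i).ι (W j).ι ≫ φ j := by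
    refine hom_ext_of_forall _ _ fun x ↦ ?_
    generalize ha : pullback.fst (W i).ι (W j).ι = a
    generalize hb : pullback.snd (W i).ι (W j).ι = b
    have hab : a ≫ (W i).ι = b ≫ (W j).ι := by rw [← ha, ← hb, pullback.condition]
    have hz : (W i).ι (a x) = (W j).ι (b x) := congr($hab x)
    obtain ⟨O, hi, hj, hO, h⟩ := H i j ((W i).ι (a x)) (a x).2 (by rw [hz]; exact (b x).2)
    refine ⟨(a ≫ (W i).ι) ⁻¹ᵁ O, hO, ?_⟩
    have ha : ((a ≫ (W i).ι) ⁻¹ᵁ O).ι ≫ a = ((a ≫ (W i).ι) ∣_ O) ≫ Z.homOfLE hi := by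
      rw [← cancel_mono (W i).ι, Category.assoc, Category.assoc, Z.homOfLE_ι, morphismRestrict_ι]
    have hb : ((a ≫ (W i).ι) ⁻¹ᵁ O).ι ≫ b = ((a ≫ (W i).ι) ∣_ O) ≫ Z.homOfLE hj := by
      rw [← cancel_mono (W j).ι, Category.assoc, Category.assoc, Z.homOfLE_ι, morphismRestrict_ι,
        hab]
    rw [reassoc_of% ha, reassoc_of% hb, h]
  let 𝒰 : Z.OpenCover := Z.openCoverOfIsOpenCover W (.mk (eq_top_iff.mpr fun z _ ↦
    TopologicalSpace.Opens.mem_iSup.mpr (hW z)))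
  exact ⟨𝒰.glueMorphisms φ key, fun i ↦ 𝒰.ι_glueMorphisms φ key i⟩

lemma le_preimage_and_appLE_eq {ι : Z ⟶ T} {W : Z.Opens} {W' : T.Opens} (hW : IsAffineOpen W)
    (hW' : IsAffineOpen W') {σ : Γ(T, W') ⟶ Γ(Z, W)}
    (h : hW.fromSpec ≫ ι = Spec.map σ ≫ hW'.fromSpec) :
    ∃ hι : W ≤ ι ⁻¹ᵁ W', ι.appLE W' W hι = σ := by
  have hι : W ≤ ι ⁻¹ᵁ W' := fun z hz ↦ by
    obtain ⟨y, rfl⟩ : z ∈ Set.range hW.fromSpec := by rwa [hW.range_fromSpec]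
    have h1 : ι (hW.fromSpec y) = hW'.fromSpec (Spec.map σ y) := congr($h y)
    have h2 : hW'.fromSpec (Spec.map σ y) ∈ (W' : Set T) := by
      rw [← hW'.range_fromSpec]
      exact ⟨_, rfl⟩
    change ι (hW.fromSpec y) ∈ (W' : Set T)
    rwa [h1]
  refine ⟨hι, Spec.map_injective ?_⟩
  rw [← cancel_mono hW'.fromSpec, IsAffineOpen.SpecMap_appLE_fromSpec _ hW' hW, h]

lemma section_ext {U : Z.Opens} {s t : Γ(Z, U)}
    (h : ∀ x ∈ U, ∃ (V : Z.Opens) (hV : V ≤ U), x ∈ V ∧ res hV s = res hV t) : s = t := by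
  choose V hV hx hs using fun x : U ↦ h x.1 x.2
  exact Z.sheaf.eq_of_locally_eq' V U (fun x ↦ homOfLE (hV x))
    (fun x hxU ↦ TopologicalSpace.Opens.mem_iSup.mpr ⟨⟨x, hxU⟩, hx _⟩) s t hs

lemma app_res (g : Yb ⟶ Y) {U V : Y.Opens} (hV : V ≤ U) (t : Γ(Y, U)) :
    g.app V (res hV t) = res (g.preimage_mono hV) (g.app U t) := by
  rw [← comorph_self_eq_app, ← comorph_self_eq_app, comorph_res, res_comorph]

lemma app_injective_of_basis {g : Yb ⟶ Y} {𝔅 : Y.Opens → Prop} (h𝔅 : IsOpensBasis 𝔅)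
    (hinj : ∀ V, 𝔅 V → Function.Injective (g.app V)) (U : Y.Opens) :
    Function.Injective (g.app U) := fun s t hst ↦ section_ext fun x hx ↦ by
  obtain ⟨V, hV, hxV, hB⟩ := h𝔅 U x hx
  refine ⟨V, hV, hxV, hinj V hB ?_⟩
  rw [app_res, app_res, hst]

lemma existsUnique_app_eq_of_basis {g : Yb ⟶ Y} {𝔅 : Y.Opens → Prop} (h𝔅 : IsOpensBasis 𝔅)
    (hinj : ∀ V, 𝔅 V → Function.Injective (g.app V)) {U : Y.Opens} {s : Γ(Yb, g ⁻¹ᵁ U)}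
    (hs : ∀ V, 𝔅 V → ∀ hV : V ≤ U, ∃ t, g.app V t = res (g.preimage_mono hV) s) :
    ∃! t : Γ(Y, U), g.app U t = s := by
  have hinj' := app_injective_of_basis h𝔅 hinj
  choose V hV hx hB using fun x : U ↦ h𝔅 U x.1 x.2
  choose t ht using fun x : U ↦ hs (V x) (hB x) (hV x)
  have hU : U ≤ iSup V := fun x hxU ↦ TopologicalSpace.Opens.mem_iSup.mpr ⟨⟨x, hxU⟩, hx _⟩
  obtain ⟨t₀, ht₀, -⟩ := Y.sheaf.existsUnique_gluing' V U (fun x ↦ homOfLE (hV x)) hU t fun x y ↦ by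
    change res inf_le_left (t x) = res inf_le_right (t y)
    apply hinj'
    rw [app_res, app_res, ht, ht, res_res, res_res]
  have h (x : U) : res (hV x) t₀ = t x := ht₀ x
  have h₀ : g.app U t₀ = s := section_ext fun y hy ↦
    ⟨g ⁻¹ᵁ V ⟨g y, hy⟩, g.preimage_mono (hV _), hx ⟨g y, hy⟩,
      (app_res g (hV ⟨g y, hy⟩) t₀).symm.trans (by rw [h, ht])⟩
  exact ⟨t₀, h₀, fun t₁ ht₁ ↦ hinj' U (ht₁.trans h₀.symm)⟩

end Glue

/-! ### The involution of Ȳ -/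

section Involution

variable {X Y Yb : Scheme.{u}} {k : Y ⟶ X} [IsClosedImmersion k] {g : Yb ⟶ Y} [IsAffineHom g]

lemma isAffineOpen_preimage_preimage (k : Y ⟶ X) [IsClosedImmersion k] (g : Yb ⟶ Y) [IsAffineHom g]
    {V : X.Opens} (hV : IsAffineOpen V) : IsAffineOpen (g ⁻¹ᵁ k ⁻¹ᵁ V) :=
  (hV.preimage k).preimage g

lemma isOpensBasis_preimage (k : Y ⟶ X) [IsClosedImmersion k] :
    IsOpensBasis fun U : Y.Opens ↦ ∃ V : X.Opens, IsAffineOpen V ∧ k ⁻¹ᵁ V = U := fun U y hy ↦ by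
  obtain ⟨U, rfl⟩ := exists_preimage_eq k U
  obtain ⟨V, hVU, hyV, hV⟩ := isOpensBasis_isAffineOpen U (k y) hy
  exact ⟨k ⁻¹ᵁ V, k.preimage_mono hVU, hyV, V, hV, rfl⟩

/-- Unique involutions are compatible with restriction to basic opens. -/
lemma comp_res_of_basicOpen {V : X.Opens} (hV : IsAffineOpen V) (a : Γ(X, V))
    {D : X.Opens} (hD : D = X.basicOpen a) (hDV : D ≤ V)
    {σ : Γ(Yb, g ⁻¹ᵁ k ⁻¹ᵁ V) →+* Γ(Yb, g ⁻¹ᵁ k ⁻¹ᵁ V)}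
    (hσ : IsInvolution (g.app (k ⁻¹ᵁ V)).hom σ)
    {σ' : Γ(Yb, g ⁻¹ᵁ k ⁻¹ᵁ D) →+* Γ(Yb, g ⁻¹ᵁ k ⁻¹ᵁ D)}
    (hσ' : ∀ τ, IsInvolution (g.app (k ⁻¹ᵁ D)).hom τ → τ = σ') :
    σ'.comp (res (g.preimage_mono (k.preimage_mono hDV))) =
      (res (g.preimage_mono (k.preimage_mono hDV))).comp σ := by
  have h1 : k ⁻¹ᵁ D = Y.basicOpen (k.app V a) := by rw [hD, k.preimage_basicOpen]
  have h2 : g ⁻¹ᵁ k ⁻¹ᵁ D = Yb.basicOpen (g.app (k ⁻¹ᵁ V) (k.app V a)) := by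
    rw [h1, g.preimage_basicOpen]
  refine RingHom.ext fun b ↦ IsInvolution.comp_eq_of_isLocalization
    (ρ := res (k.preimage_mono hDV)) (k.app V a) ?_ ?_ (fun c ↦ app_res g _ c) hσ hσ' b
  · exact (hV.preimage k).isLocalization_of_eq_basicOpen _ (homOfLE (k.preimage_mono hDV)) h1
  · exact (isAffineOpen_preimage_preimage k g hV).isLocalization_of_eq_basicOpen _
      (homOfLE (g.preimage_mono (k.preimage_mono hDV))) h2

/-- Ring endomorphisms over the preimages of affine opens glue if they are compatible with
restriction to basic opens. -/
lemma exists_hom_fromSpec_eq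
    (σ : ∀ V : X.affineOpens, Γ(Yb, g ⁻¹ᵁ k ⁻¹ᵁ V) →+* Γ(Yb, g ⁻¹ᵁ k ⁻¹ᵁ V))
    (hσ : ∀ (V D : X.affineOpens) (a : Γ(X, V)) (_ : D = X.basicOpen a) (hDV : D.1 ≤ V.1),
      (σ D).comp (res (g.preimage_mono (k.preimage_mono hDV))) =
        (res (g.preimage_mono (k.preimage_mono hDV))).comp (σ V)) :
    ∃ ι : Yb ⟶ Yb, ∀ V : X.affineOpens,
      (isAffineOpen_preimage_preimage k g V.2).fromSpec ≫ ι = Spec.map (CommRingCat.ofHom (σ V)) ≫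
        (isAffineOpen_preimage_preimage k g V.2).fromSpec := by
  have hA (V : X.affineOpens) := isAffineOpen_preimage_preimage k g V.2
  let φ (V : X.affineOpens) : (g ⁻¹ᵁ k ⁻¹ᵁ V).toScheme ⟶ Yb :=
    (g ⁻¹ᵁ k ⁻¹ᵁ V).toSpecΓ ≫ Spec.map (CommRingCat.ofHom (σ V)) ≫ (hA V).fromSpec
  have hφ (V D : X.affineOpens) (a : Γ(X, V)) (hD : D = X.basicOpen a) (hDV : D.1 ≤ V.1) :
      Yb.homOfLE (g.preimage_mono (k.preimage_mono hDV)) ≫ φ V = φ D := by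
    have h := congr(Spec.map (CommRingCat.ofHom $(hσ V D a hD hDV)))
    rw [CommRingCat.ofHom_comp, CommRingCat.ofHom_comp, Spec.map_comp, Spec.map_comp] at h
    simp only [φ]
    rw [← Scheme.Opens.toSpecΓ_SpecMap_presheaf_map_assoc]
    change _ ≫ Spec.map (CommRingCat.ofHom (res _)) ≫ _ = _
    rw [← reassoc_of% h, ← (hA V).map_fromSpec (hA D)
      (homOfLE (g.preimage_mono (k.preimage_mono hDV))).op]
    rfl
  obtain ⟨ι, hι⟩ := exists_hom_of_opens (fun V : X.affineOpens ↦ g ⁻¹ᵁ k ⁻¹ᵁ V.1) (fun y ↦ by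
    obtain ⟨V, -, hyV, hV⟩ := isOpensBasis_isAffineOpen ⊤ (k (g y)) trivial
    exact ⟨⟨V, hV⟩, hyV⟩) φ fun V V' y hy hy' ↦ by
    obtain ⟨a, a', haa', hya⟩ := exists_basicOpen_le_affine_inter V.2 V'.2 (k (g y)) ⟨hy, hy'⟩
    have h1 : X.basicOpen a ≤ V.1 := X.basicOpen_le a
    have h2 : X.basicOpen a ≤ V'.1 := haa' ▸ X.basicOpen_le a'
    refine ⟨g ⁻¹ᵁ k ⁻¹ᵁ X.basicOpen a, g.preimage_mono (k.preimage_mono h1),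
      g.preimage_mono (k.preimage_mono h2), hya, ?_⟩
    rw [hφ V ⟨X.basicOpen a, V.2.basicOpen a⟩ a rfl h1,
      hφ V' ⟨X.basicOpen a, V.2.basicOpen a⟩ a' haa' h2]
  refine ⟨ι, fun V ↦ ?_⟩
  rw [← (hA V).isoSpec_inv_ι, Category.assoc, hι, IsAffineOpen.isoSpec_inv_toSpecΓ_assoc]
  rfl

lemma hom_ext_of_fromSpec {T : Scheme.{u}} {ι ι' : Yb ⟶ T} (h : ∀ V : X.affineOpens,
    (isAffineOpen_preimage_preimage k g V.2).fromSpec ≫ ι =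
      (isAffineOpen_preimage_preimage k g V.2).fromSpec ≫ ι') : ι = ι' :=
  hom_ext_of_forall _ _ fun y ↦ by
    obtain ⟨V, -, hyV, hV⟩ := isOpensBasis_isAffineOpen ⊤ (k (g y)) trivial
    refine ⟨g ⁻¹ᵁ k ⁻¹ᵁ V, hyV, ?_⟩
    rw [← (isAffineOpen_preimage_preimage k g hV).toSpecΓ_fromSpec, Category.assoc, h ⟨V, hV⟩,
      Category.assoc]

omit [IsAffineHom g] in
/-- The comorphism of a cover involution is a ring theoretic involution. -/
lemma IsCoverInvolution.isInvolution {ι : Yb ⟶ Yb} (hι : IsCoverInvolution g ι) (U : Y.Opens)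
    (hU : g ⁻¹ᵁ U ≤ ι ⁻¹ᵁ g ⁻¹ᵁ U) :
    IsInvolution (g.app U).hom (comorph ι hU) where
  map_base t := by
    change comorph ι hU (g.app U t) = g.app U t
    rw [← comorph_self_eq_app, comorph_comp]
    exact comorph_congr hι.comp_eq _ _ t
  involutive b := by
    refine (comorph_comp _ _ _ _ b).trans ((comorph_congr hι.involutive _ le_rfl b).trans ?_)
    rw [comorph_id]
    exact res_self b
  exists_eq b hb := (hι.existsUnique_of_invariant U b hb).exists

/-- Uniqueness over each affine open forces the local involutions to commute with restriction to
basic opens, so they glue; the same uniqueness identifies any other involution with the glued one.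
-/
theorem existsUnique_isCoverInvolution
    (hinj : ∀ V : X.Opens, IsAffineOpen V → Function.Injective (g.app (k ⁻¹ᵁ V)))
    (hinv : ∀ V : X.Opens, IsAffineOpen V →
      ∃ σ : Γ(Yb, g ⁻¹ᵁ k ⁻¹ᵁ V) →+* Γ(Yb, g ⁻¹ᵁ k ⁻¹ᵁ V), IsInvolution (g.app (k ⁻¹ᵁ V)).hom σ ∧
        ∀ τ, IsInvolution (g.app (k ⁻¹ᵁ V)).hom τ → τ = σ) :
    ∃! ι : Yb ⟶ Yb, IsCoverInvolution g ι := by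
  choose σ hσ huniq using fun V : X.affineOpens ↦ hinv V V.2
  obtain ⟨ι, hι⟩ := exists_hom_fromSpec_eq σ fun V D a hD hDV ↦
    comp_res_of_basicOpen V.2 a hD hDV (hσ V) (huniq D)
  have hA (V : X.affineOpens) := isAffineOpen_preimage_preimage k g V.2
  have hle (V : X.affineOpens) := le_preimage_and_appLE_eq (hA V) (hA V) (hι V)
  have hσσ (V : X.affineOpens) : (σ V).comp (σ V) = RingHom.id _ := RingHom.ext (hσ V).involutive
  have hg : ι ≫ g = g := hom_ext_of_fromSpec (k := k) (g := g) fun V ↦ by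
    have h1 := IsAffineOpen.SpecMap_appLE_fromSpec g (V.2.preimage k) (hA V) le_rfl
    rw [reassoc_of% hι V, ← h1, ← Spec.map_comp_assoc]
    congr 2
    ext t
    change σ V (comorph g (U := k ⁻¹ᵁ V.1) le_rfl t) = comorph g (U := k ⁻¹ᵁ V.1) le_rfl t
    rw [comorph_self_eq_app]
    exact (hσ V).map_base t
  refine ⟨ι, ⟨hom_ext_of_fromSpec (k := k) (g := g) fun V ↦ ?_, hg, fun U s hs ↦ ?_⟩, fun ι' hι' ↦
    hom_ext_of_fromSpec (k := k) (g := g) fun V ↦ ?_⟩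
  · rw [reassoc_of% hι V, hι V, ← Spec.map_comp_assoc, ← CommRingCat.ofHom_comp, hσσ]
    simp
  · refine existsUnique_app_eq_of_basis (isOpensBasis_preimage k) ?_ ?_
    · rintro _ ⟨V, hV, rfl⟩
      exact hinj V hV
    · rintro _ ⟨V, hV, rfl⟩ hVU
      refine (hσ ⟨V, hV⟩).exists_eq _ ?_
      obtain ⟨h1, h2⟩ := hle ⟨V, hV⟩
      have h3 : comorph ι h1 = σ ⟨V, hV⟩ := congrArg CommRingCat.Hom.hom h2
      rw [← h3, comorph_res]
      exact (res_comorph ι _ (g.preimage_mono hVU) s).symm.trans (congrArg _ hs)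
  · have h1 := le_preimage_of_comp_eq (IsCoverInvolution.comp_eq hι') (k ⁻¹ᵁ V.1)
    have h2 := huniq V _ (hι'.isInvolution (k ⁻¹ᵁ V) h1)
    rw [hι, ← IsAffineOpen.SpecMap_appLE_fromSpec ι' (hA V) (hA V) h1, ← h2]
    rfl

end Involution

end SemiSmooth

/-- The sheaves `(g_* T_Ȳ)^inv` and `g_* (T_X̄|_Ȳ)` on `Y` are regarded as sheaves on `X` through the
closed immersion `Y ⟶ X`. -/
theorem mainTheorem2 {K : Type u} [Field K] [IsAlgClosed K] (h2 : (2 : K) ≠ 0)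
    {X Xb : Scheme.{u}} (p : X ⟶ Spec (.of K)) [IsSemiSmooth p]
    (f : Xb ⟶ X) [IsNormalization f] :
    ∃ α : tangentSheaf p ⟶ (Modules.pushforward f).obj (tangentSheaf (f ≫ p)),
      (IsTangentLift p f α ∧ ∀ α', IsTangentLift p f α' → α' = α) ∧
      Mono α ∧
      IsIso ((Modules.restrictFunctor p.smoothLocus.ι).map α) ∧
      ∃ (ι : conductorSchemeBar f ⟶ conductorSchemeBar f)
        (hι : IsCoverInvolution (conductorMap f) ι),
        (∀ ι', IsCoverInvolution (conductorMap f) ι' → ι' = ι) ∧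
        ∃ τ : tangentSheaf (conductorMap f ≫ conductorι f ≫ p) ⟶
            (Modules.pullback (conductorBarι f)).obj (tangentSheaf (f ≫ p)),
          (IsTangentMap _ _ _ (conductor_square_over f p) τ ∧
            ∀ τ', IsTangentMap _ _ _ (conductor_square_over f p) τ' → τ' = τ) ∧
          ∃ π : (Modules.pushforward (conductorι f)).obj ((Modules.pushforward (conductorMap f)).obj
              ((Modules.pullback (conductorBarι f)).obj (tangentSheaf (f ≫ p)))) ⟶ cokernel α,
            (Modules.pushforward f).map
                ((Modules.pullbackPushforwardAdjunction (conductorBarι f)).unit.app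
                  (tangentSheaf (f ≫ p))) ≫
              (pushforwardSquare (conductor_square f)).hom.app _ ≫ π = cokernel.π α ∧
            ∃ w : (Modules.pushforward (conductorι f)).map
                (invariantTangentι hι.comp_eq (conductorι f ≫ p) ≫
                  (Modules.pushforward (conductorMap f)).map τ) ≫ π = 0,
              (ShortComplex.mk _ π w).ShortExact := by
  have H := isConductorSquare_conductor h2 p f
  obtain ⟨α, hα⟩ := H.exists_isTangentLift
  obtain ⟨ι, hι, hι'⟩ := existsUnique_isCoverInvolution (k := conductorι f) (g := conductorMap f)
    (fun _ hV ↦ H.app_injective hV)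
    fun _ hV ↦ H.exists_unique_isInvolution hV (isPinchNormalization_app h2 p f hV)
  obtain ⟨τ, hτ, hτ'⟩ := H.exists_unique_isTangentMap
  exact ⟨α, ⟨hα, fun _ ↦ H.eq_of_isTangentLift hα⟩, H.mono_of_isTangentLift hα,
    H.isIso_restrictFunctor_map hα fun _ hVp hV ↦
      app_surjective_of_le_smoothLocus hV (isPinchNormalization_app h2 p f hV) hVp,
    ι, hι, hι', τ, ⟨hτ, hτ'⟩, H.exists_shortExact hα hι hτ⟩
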